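/- **Conventions.** Let $n\ge 2$ and let $\mathfrak g$ be $\mathfrak b_n$ or $\mathfrak c_n$, with $\alpha_i=\epsilon_i-\epsilon_{i+1}$ for $i<n$ and $\alpha_n=\epsilon_n$ (type $\mathfrak b_n$), $\alpha_n=2\epsilon_n$ (type $\mathfrak c_n$), simple coroots $h_i$, fundamental weights $\omega_i$ and weight lattice $P=\bigoplus_i\mathbb Z\omega_i$; let $\mathfrak l\subset\mathfrak g$ be the Levi subalgebra with simple roots $\alpha_1,\dots,\alpha_{n-1}$. A $\mathfrak g$-crystal is a set $B$ with maps $\mathrm{wt}:B\to P$, $\varepsilon_i,\varphi_i:B\to\mathbb Z\cup\{-\infty\}$, $\tilde e_i,\tilde f_i:B\to B\cup\{\mathbf 0\}$ satisfying Kashiwara's axioms; in $B_1\otimes B_2$, $\tilde e_i$ (resp. $\tilde f_i$) acts on the first factor iff $\varphi_i(b_1)\ge\varepsilon_i(b_2)$ (resp. $\varphi_i(b_1)>\varepsilon_i(b_2)$), with $\mathrm{wt}(b_1\otimes b_2)=\mathrm{wt}(b_1)+\mathrm{wt}(b_2)$, $\varepsilon_i(b_1\otimes b_2)=\max\{\varepsilon_i(b_1),\varepsilon_i(b_2)-\langle\mathrm{wt}(b_1),h_i\rangle\}$,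 $\varphi_i(b_1\otimes b_2)=\max\{\varphi_i(b_1)+\langle\mathrm{wt}(b_2),h_i\rangle,\varphi_i(b_2)\}$. A morphism is a map $\psi:B_1\cup\{\mathbf 0\}\to B_2\cup\{\mathbf 0\}$ with $\psi(\mathbf 0)=\mathbf 0$ that preserves $\mathrm{wt},\varepsilon_i,\varphi_i$ at every $b$ with $\psi(b)\ne\mathbf 0$, and satisfies $\psi(\tilde x_ib)=\tilde x_i\psi(b)$ for $x=e,f$ whenever $\tilde x_i b\neq\mathbf 0$ and $\psi(b),\psi(\tilde x_ib)\neq\mathbf 0$; an *embedding* is an injective morphism. $T_\mu=\{t_\mu\}$ is the one-element crystal with $\mathrm{wt}(t_\mu)=\mu$ and $\varepsilon_i=\varphi_i=-\infty$. **Columns.** Tableaux are semistandard with entries in $[\overline n]=\{\overline n<\dots<\overline1\}$: rows weakly increase to the right and columns strictly increase downwards. For a column $U$, $U(i)$ is the $i$-th entry from the bottom and $\mathrm{ht}(U)$ the height; an inequality between entries is required where both exist. $[\overline n]$ is the dual of the natural $\mathfrak l$-crystal, $\overline j$ having weight $-\epsilon_j$; this gives the $\mathfrak l$-crystal structure on tableaux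 (columns are taken from right to left) and the $\mathfrak l$-weight $\mathrm{wt}_{\mathfrak l}$. Let $\mathbf T^{\rm sp}$ be the set of all columns, with $\mathrm{wt}(U)=\omega_n+\mathrm{wt}_{\mathfrak l}(U)$, and with $\tilde e_n$ (resp. $\tilde f_n$) removing $\overline n$ from (resp. adding it on) the top, and $\mathbf 0$ if impossible; this is a $\mathfrak b_n$-crystal. **Two columns.** For $a,b,c\ge0$ let $\lambda(a,b,c)=(2^{b+c},1^a)/(1^b)$ (two columns with $c$ common rows, $b$ further boxes on top of the right column and $a$ further boxes below the left one). For $T$ of this shape with left and right columns $T^{\tt L},T^{\tt R}$, let $\mathfrak r_T$ be the largest $k\le\min\{a,b\}$ such that sliding $T^{\tt R}$ down by $k$ positions yields a semistandard tableau. If $\mathfrak r_T=0$, let $\mathcal ET$ (for $a>0$) and $\mathcal FT$ (for $b>0$) be obtained by jeu de taquin sliding to the position below the bottom of $T^{\tt R}$, resp. above the top of $T^{\tt L}$; $\mathcal ET=\mathbf 0$ if $a=0$, and $\mathcal FT=\mathbf 0$ if $b=0$. For a pair of columns $(U,V)$ put $\mathcal X(U,V)=((\mathcal XT)^{\tt L},(\mathcal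 XT)^{\tt R})$, $\mathcal X=\mathcal E,\mathcal F$, where $T$ is the unique tableau with $(T^{\tt L},T^{\tt R})=(U,V)$ and $\mathfrak r_T=0$. For $0\le a<n$ let $\mathbf T^{\mathfrak c_n}(a)$ be the set of semistandard tableaux of shapes $\lambda(a,0,c)$, $c\ge 0$, and $\mathbf T^{\mathfrak b_n}(a)$ the set of those of shapes $\lambda(a,b,c)$, $b,c\ge0$, with $\mathfrak r_T=0$. The set $\mathbf T^{\mathfrak b_n}(a)$ is a $\mathfrak b_n$-crystal through $T\mapsto T^{\tt R}\otimes T^{\tt L}\in(\mathbf T^{\rm sp})^{\otimes2}$. The set $\mathbf T^{\mathfrak c_n}(a)$ is a $\mathfrak c_n$-crystal with $\mathrm{wt}(T)=\omega_n+\mathrm{wt}_{\mathfrak l}(T)$, the $\mathfrak l$-crystal structure of $T^{\tt R}\otimes T^{\tt L}$, and $\tilde e_n$ (resp. $\tilde f_n$) removing (resp. adding) a domino $\overline n\,\overline n$ on top. Put ${}^{\tt L}T=(\mathcal E^aT)^{\tt L}$ and ${}^{\tt R}T=(\mathcal E^aT)^{\tt R}$ for $T\in\mathbf T^{\mathfrak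 g}(a)$. For $a_1\le a_2<n$ and $T_2\in\mathbf T^{\mathfrak g}(a_2)$, $T_1\in\mathbf T^{\mathfrak g}(a_1)$ write $T_2\prec T_1$ if $\mathrm{ht}(T_2^{\tt R})\le\mathrm{ht}(T_1^{\tt L})-a_1$, and $T_2^{\tt R}(i)\le{}^{\tt L}T_1(i)$ and ${}^{\tt R}T_2(i+a_2-a_1)\le T_1^{\tt L}(i)$ for all $i\ge1$; for $T_1\in\mathbf T^{\rm sp}$ use the same conditions with $a_1=0$ and $T_1^{\tt L}={}^{\tt L}T_1=T_1$. **The spinor model.** Let $\mathscr P_n$ be the set of partitions with at most $n$ parts, and $\mathscr P_n^{\rm sp}=\{\mu+(\tfrac12,\dots,\tfrac12)\mid\mu\in\mathscr P_n\}$. Let $\lambda=\mu\in\mathscr P_n$ (with $\mathfrak g$ of either type), or $\lambda=\mu+(\tfrac12,\dots,\tfrac12)\in\mathscr P_n^{\rm sp}$ (with $\mathfrak g=\mathfrak b_n$). Put $\ell=\mu_1$ and $a_i=n-\mu'_i$ for $1\le i\le\ell$, where $\mu'$ is the conjugate of $\mu$. Let $\mathbf T_\lambda$ be the set of $\mathbf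 T=(T_\ell,\dots,T_1)$ with $T_i\in\mathbf T^{\mathfrak g}(a_i)$ and $T_\ell\prec\dots\prec T_1$ if $\lambda\in\mathscr P_n$, and of $\mathbf T=(T_\ell,\dots,T_1,T_0)$ with, in addition, $T_0\in\mathbf T^{\rm sp}$ and $T_1\prec T_0$ (if $\ell\geq 1$) if $\lambda\in\mathscr P_n^{\rm sp}$. It has the crystal structure for which $\mathbf T$ is identified with $T_1\otimes T_2\otimes\dots\otimes T_\ell$, resp. $T_0\otimes T_1\otimes\dots\otimes T_\ell$. **The crystal $\mathbf V_\lambda$.** Let $\mathbf V^{\mathfrak g}$ be the set of semistandard tableaux of shapes $\tau^\pi$ (the Young diagram of $\tau$ rotated by $180^\circ$), where $\tau$ runs over all partitions for $\mathfrak b_n$ and over those with even parts only for $\mathfrak c_n$. Put $\mathbf B=\mathbf T^{\rm sp}$ for $\mathfrak b_n$ and $\mathbf B=\mathbf T^{\mathfrak c_n}(0)$ for $\mathfrak c_n$. A tableau in $\mathbf V^{\mathfrak g}$ is identified with $U_1\otimes\dots\otimes U_k\otimes t_{-k\omega_n}\in\mathbf B^{\otimes k}\otimes T_{-k\omega_n}$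 for $k$ large, where $U_1,U_2,\dots$ are its columns (for $\mathfrak c_n$: its successive pairs of columns) from right to left, followed by empty ones; $\mathrm{wt},\varepsilon_i,\varphi_i,\tilde e_i,\tilde f_i$ do not depend on large $k$. Let $\nu=(a_\ell,\dots,a_1)'$, and let $SST(\nu)$ be the set of semistandard tableaux of shape $\nu$, with its $\mathfrak l$-crystal structure and $\varphi_n=-\infty$. Let $\mathbf V_\lambda=SST(\nu)\times\mathbf V^{\mathfrak g}$, where $(V_2,V_1)$ is identified with $V_1\otimes V_2$. **The separation algorithm.** Regard $\mathbf T\in\mathbf T_\lambda$ as the sequence of columns $(T_\ell^{\tt L},T_\ell^{\tt R},\dots,T_1^{\tt L},T_1^{\tt R})$, indexed by $2\ell,\dots,1$, followed by $T_0$ with index $0$ if $\lambda\in\mathscr P_n^{\rm sp}$. Let $\mathcal F_j$ apply $\mathcal F$ to the columns with indices $(j+1,j)$, and put $$\overline{\mathbf T}=(\mathcal F_\ell^{a_1}\cdots\mathcal F_2^{a_1})\cdots(\mathcal F_{2\ell-3}^{a_{\ell-2}}\mathcal F_{2\ell-4}^{a_{\ell-2}})\,\mathcal F_{2\ell-2}^{a_{\ell-1}}\,\mathbf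 T,$$ where the factor with exponent $a_i$ ($1\le i\le\ell-1$) is $\mathcal F^{a_i}_{\ell+i-1}\cdots\mathcal F_{2i+1}^{a_i}\mathcal F_{2i}^{a_i}$. Let $b_{2i-1}=\mathrm{ht}(T_i^{\tt R})$ and $b_{2i}=\mathrm{ht}(T_i^{\tt L})-a_i$ for $1\le i\le\ell$. Place the bottoms of the columns $\overline T_i$ with $i\le\ell$ on a horizontal line $L$, and the columns $\overline T_i$ with $\ell<i\le2\ell$ with their $b_i$ highest boxes above $L$ and the other boxes below $L$. Let $\mathbf T^{\tt body}$ and $\mathbf T^{\tt tail}$ be the parts of $\overline{\mathbf T}$ above and below $L$. **Theorem.** For every such $\mathfrak g$ and $\lambda$ and every $\mathbf T\in\mathbf T_\lambda$, $\overline{\mathbf T}$ is defined (that is, $\overline{\mathbf T}\ne\mathbf 0$) and $(\mathbf T^{\tt tail},\mathbf T^{\tt body})\in\mathbf V_\lambda$; and the map $$\Theta_\lambda:\mathbf T_\lambda\longrightarrow\mathbf V_\lambda\otimes T_{r\omega_n},\qquad \mathbf T\longmapsto(\mathbf T^{\tt tail},\mathbf T^{\tt body})\otimes t_{r\omega_n},$$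 is an embedding of $\mathfrak g$-crystals, where $r=\lambda_1$ if $\mathfrak g=\mathfrak c_n$ and $r=2\lambda_1$ if $\mathfrak g=\mathfrak b_n$. -/

import Mathlib

/-! ### Types `B_n`, `C_n` and their weights -/

/-- The type of the Lie algebra: `b` is `𝔟_n` (type `B_n`), `c` is `𝔠_n` (type `C_n`). -/
inductive ClType
  | b
  | c

/-- The weight lattice `P = ⊕ ℤ ω_i`.  A weight `μ` is recorded by its coordinates
`μ i = ⟨μ, h_i⟩` in the basis of fundamental weights.  The index `i : Fin n` stands for the
vertex `i + 1` of the Dynkin diagram. -/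
abbrev Wt (n : ℕ) : Type := Fin n → ℤ

/-- The weight `ε_j`, that is, the function `i ↦ ⟨ε_j, h_i⟩`, where `h_i = ε_i^∨ - ε_{i+1}^∨`
for `i < n`, and `h_n = 2 ε_n^∨` in type `B_n`, `h_n = ε_n^∨` in type `C_n`. -/
def epsWt {n : ℕ} (g : ClType) (j : Fin n) : Wt n := fun i =>
  if i.1 + 1 < n then (if j.1 = i.1 then 1 else 0) - (if j.1 = i.1 + 1 then 1 else 0)
  else if j.1 = i.1 then (match g with | .b => 2 | .c => 1) else 0

/-- The simple roots: `α_i = ε_i - ε_{i+1}` for `i < n`, and `α_n = ε_n` in type `B_n`,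
`α_n = 2 ε_n` in type `C_n`. -/
def simpleRoot {n : ℕ} (g : ClType) (i : Fin n) : Wt n :=
  if h : i.1 + 1 < n then epsWt g i - epsWt g ⟨i.1 + 1, h⟩
  else (match g with | .b => (1 : ℤ) | .c => 2) • epsWt g i

/-- The fundamental weight `ω_n` of the last vertex. -/
def omegaLast (n : ℕ) : Wt n := fun i => if i.1 + 1 = n then 1 else 0

theorem simpleRoot_self {n : ℕ} (g : ClType) (i : Fin n) : simpleRoot g i i = 2 := by
  unfold simpleRoot epsWt
  split_ifs with h
  · simp [h]
  · cases g <;> simp [h]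

/-! ### Crystals -/

/-- A `𝔤`-crystal on the set `B`.  The formal symbol `0` is `none : Option B`, and `-∞` is
`⊥ : WithBot ℤ`. -/
structure Crystal (g : ClType) (n : ℕ) (B : Type) where
  wt : B → Wt n
  ε : Fin n → B → WithBot ℤ
  φ : Fin n → B → WithBot ℤ
  e : Fin n → B → Option B
  f : Fin n → B → Option B
  φ_eq : ∀ i b, φ i b = ((wt b i : ℤ) : WithBot ℤ) + ε i b
  e_some : ∀ i b b', e i b = some b' →
    ε i b' + 1 = ε i b ∧ φ i b' = φ i b + 1 ∧ wt b' = wt b + simpleRoot g i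
  f_some : ∀ i b b', f i b = some b' →
    ε i b' = ε i b + 1 ∧ φ i b' + 1 = φ i b ∧ wt b' = wt b - simpleRoot g i
  f_iff : ∀ i b b', f i b = some b' ↔ e i b' = some b
  of_bot : ∀ i b, φ i b = ⊥ → e i b = none ∧ f i b = none

namespace Crystal

variable {g : ClType} {n : ℕ} {A B : Type}

/-- A morphism of crystals is a map `ψ : B₁ ∪ {0} → B₂ ∪ {0}` with `ψ(0) = 0`, hence is given by
its restriction `ψ : B₁ → B₂ ∪ {0}`. -/
structure IsMorphism (C₁ : Crystal g n A) (C₂ : Crystal g n B) (ψ : A → Option B) : Prop where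
  wt_eq : ∀ a b, ψ a = some b → C₂.wt b = C₁.wt a
  ε_eq : ∀ a b, ψ a = some b → ∀ i, C₂.ε i b = C₁.ε i a
  φ_eq : ∀ a b, ψ a = some b → ∀ i, C₂.φ i b = C₁.φ i a
  e_comm : ∀ i a a' b b', C₁.e i a = some a' → ψ a = some b → ψ a' = some b' → C₂.e i b = some b'
  f_comm : ∀ i a a' b b', C₁.f i a = some a' → ψ a = some b → ψ a' = some b' → C₂.f i b = some b'

/-- An embedding is a morphism which is injective as a map `B₁ ∪ {0} → B₂ ∪ {0}`
(in particular, it takes the value `0` only at `0`). -/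
def IsEmbedding (C₁ : Crystal g n A) (C₂ : Crystal g n B) (ψ : A → Option B) : Prop :=
  IsMorphism C₁ C₂ ψ ∧ Function.Injective fun x : Option A => x.bind ψ

/-- The crystal structure transported along a bijection. -/
def ofEquiv (C : Crystal g n A) (q : B ≃ A) : Crystal g n B where
  wt b := C.wt (q b)
  ε i b := C.ε i (q b)
  φ i b := C.φ i (q b)
  e i b := (C.e i (q b)).map q.symm
  f i b := (C.f i (q b)).map q.symm
  φ_eq i b := C.φ_eq i (q b)
  e_some i b b' h := by
    obtain ⟨a, ha, rfl⟩ := Option.map_eq_some_iff.1 h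
    simpa using C.e_some i _ _ ha
  f_some i b b' h := by
    obtain ⟨a, ha, rfl⟩ := Option.map_eq_some_iff.1 h
    simpa using C.f_some i _ _ ha
  f_iff i b b' := by
    have := C.f_iff i (q b) (q b')
    simp only [Option.map_eq_some_iff, Equiv.symm_apply_eq, exists_eq_right]
    exact this
  of_bot i b h := by
    have := C.of_bot i (q b) h
    simp [this.1, this.2]

/-- An element of `B ∪ {0}` seen in `S ∪ {0}`; elements outside of `S` go to `0`. -/
noncomputable def toSub (S : Set B) (o : Option B) : Option S :=
  open Classical in o.bind fun b => if h : b ∈ S then some ⟨b, h⟩ else none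

theorem toSub_eq_some (S : Set B) (o : Option B) (x : S) : toSub S o = some x ↔ o = some x.1 := by
  classical
  unfold toSub
  cases o with
  | none => simp
  | some b =>
    by_cases h : b ∈ S
    · simp [h, Subtype.ext_iff]
    · simp only [Option.bind_some, h, dite_false, Option.some.injEq]
      constructor
      · intro h'; exact absurd h' (by simp)
      · rintro rfl; exact absurd x.2 h

/-- The crystal structure on a subset, with all structure maps inherited from the ambient crystal. -/
noncomputable def restrict (C : Crystal g n B) (S : Set B) : Crystal g n S where
  wt b := C.wt b
  ε i b := C.ε i b
  φ i b := C.φ i b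
  e i b := toSub S (C.e i b)
  f i b := toSub S (C.f i b)
  φ_eq i b := C.φ_eq i b
  e_some i b b' h := C.e_some i _ _ ((toSub_eq_some _ _ _).1 h)
  f_some i b b' h := C.f_some i _ _ ((toSub_eq_some _ _ _).1 h)
  f_iff i b b' := by rw [toSub_eq_some, toSub_eq_some]; exact C.f_iff i _ _
  of_bot i b h := by
    have := C.of_bot i b h
    simp [this.1, this.2, toSub]

/-- The crystal `T_μ = {t_μ}`. -/
def single (g : ClType) {n : ℕ} (μ : Wt n) : Crystal g n Unit where
  wt _ := μ
  ε _ _ := ⊥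
  φ _ _ := ⊥
  e _ _ := none
  f _ _ := none
  φ_eq _ _ := by simp
  e_some _ _ _ h := by simp at h
  f_some _ _ _ h := by simp at h
  f_iff _ _ _ := by simp
  of_bot _ _ _ := by simp

/-- The structure of the trivial crystal `B(0)` on every element of a set; on a one-element set it
is the empty tensor product. -/
def unit (g : ClType) (n : ℕ) (B : Type) : Crystal g n B where
  wt _ := 0
  ε _ _ := 0
  φ _ _ := 0
  e _ _ := none
  f _ _ := none
  φ_eq _ _ := by simp
  e_some _ _ _ h := by simp at h
  f_some _ _ _ h := by simp at h
  f_iff _ _ _ := by simp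
  of_bot _ _ _ := by simp

/-- Either `ε_i(b) = φ_i(b) = -∞`, or both are integers. -/
theorem bot_or_int (C : Crystal g n B) (i : Fin n) (b : B) :
    (C.ε i b = ⊥ ∧ C.φ i b = ⊥) ∨ ∃ m : ℤ, C.ε i b = (m : WithBot ℤ) ∧
      C.φ i b = ((C.wt b i + m : ℤ) : WithBot ℤ) := by
  have h := C.φ_eq i b
  cases hm : C.ε i b with
  | bot => left; rw [hm] at h; simpa using h
  | coe m => right; refine ⟨m, rfl, ?_⟩; rw [h, hm]; push_cast; rfl

theorem int_of_e (C : Crystal g n B) (i : Fin n) (b b' : B) (h : C.e i b = some b') :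
    ∃ m : ℤ, C.ε i b = (m : WithBot ℤ) ∧ C.φ i b = ((C.wt b i + m : ℤ) : WithBot ℤ) ∧
      C.ε i b' = ((m - 1 : ℤ) : WithBot ℤ) ∧
      C.φ i b' = ((C.wt b i + m + 1 : ℤ) : WithBot ℤ) ∧ C.wt b' = C.wt b + simpleRoot g i := by
  rcases C.bot_or_int i b with ⟨_, h2⟩ | ⟨m, h1, h2⟩
  · have := (C.of_bot i b h2).1; rw [this] at h; simp at h
  · obtain ⟨e1, e2, e3⟩ := C.e_some i b b' h
    refine ⟨m, h1, h2, ?_, ?_, e3⟩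
    · rw [h1] at e1
      rcases C.bot_or_int i b' with ⟨h3, _⟩ | ⟨m', h3, _⟩
      · rw [h3] at e1; simp at e1
      · rw [h3] at e1 ⊢
        have : m' + 1 = m := by exact_mod_cast e1
        rw [← this]; simp
    · rw [e2, h2]; push_cast; rfl

/-- `ẽ_i` on a tensor product. -/
noncomputable def tensorE (C₁ : Crystal g n A) (C₂ : Crystal g n B) (i : Fin n) (x : A × B) :
    Option (A × B) :=
  if C₂.ε i x.2 ≤ C₁.φ i x.1 then (C₁.e i x.1).map fun a => (a, x.2)
  else (C₂.e i x.2).map fun b => (x.1, b)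

/-- `f̃_i` on a tensor product. -/
noncomputable def tensorF (C₁ : Crystal g n A) (C₂ : Crystal g n B) (i : Fin n) (x : A × B) :
    Option (A × B) :=
  if C₂.ε i x.2 < C₁.φ i x.1 then (C₁.f i x.1).map fun a => (a, x.2)
  else (C₂.f i x.2).map fun b => (x.1, b)

theorem tensorF_iff (C₁ : Crystal g n A) (C₂ : Crystal g n B) (i : Fin n) (x y : A × B) :
    tensorF C₁ C₂ i x = some y ↔ tensorE C₁ C₂ i y = some x := by
  obtain ⟨a, b⟩ := x
  obtain ⟨a', b'⟩ := y
  unfold tensorE tensorF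
  constructor
  · intro h
    split_ifs at h with hc
    · obtain ⟨a'', ha, h'⟩ := Option.map_eq_some_iff.1 h
      obtain ⟨rfl, rfl⟩ := Prod.mk.injEq .. ▸ h'
      have ha' := (C₁.f_iff i _ _).1 ha
      obtain ⟨m, h1, h2, h3, h4, h5⟩ := C₁.int_of_e i _ _ ha'
      have : C₂.ε i b ≤ C₁.φ i a'' := by
        simp only [h2, h4] at hc ⊢
        rcases C₂.bot_or_int i b with ⟨h6, h7⟩ | ⟨m', h6, h7⟩
        · simp [h6]
        · rw [h6] at hc ⊢; norm_cast at hc ⊢; omega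
      simp [this, ha']
    · obtain ⟨b'', hb, h'⟩ := Option.map_eq_some_iff.1 h
      obtain ⟨rfl, rfl⟩ := Prod.mk.injEq .. ▸ h'
      have hb' := (C₂.f_iff i _ _).1 hb
      obtain ⟨m, h1, h2, h3, h4, h5⟩ := C₂.int_of_e i _ _ hb'
      have : ¬ C₂.ε i b'' ≤ C₁.φ i a := by
        simp only [h1, h3] at hc ⊢
        rcases C₁.bot_or_int i a with ⟨h6, h7⟩ | ⟨m', h6, h7⟩
        · simp [h7]
        · rw [h7] at hc ⊢; norm_cast at hc ⊢; omega
      simp [this, hb']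
  · intro h
    split_ifs at h with hc
    · obtain ⟨a'', ha, h'⟩ := Option.map_eq_some_iff.1 h
      obtain ⟨rfl, rfl⟩ := Prod.mk.injEq .. ▸ h'
      obtain ⟨m, h1, h2, h3, h4, h5⟩ := C₁.int_of_e i _ _ ha
      have : C₂.ε i b' < C₁.φ i a'' := by
        simp only [h2, h4] at hc ⊢
        rcases C₂.bot_or_int i b' with ⟨h6, h7⟩ | ⟨m', h6, h7⟩
        · rw [h6]; exact WithBot.bot_lt_coe _
        · rw [h6] at hc ⊢; norm_cast at hc ⊢; omega
      simp [this, (C₁.f_iff i _ _).2 ha]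
    · obtain ⟨b'', hb, h'⟩ := Option.map_eq_some_iff.1 h
      obtain ⟨rfl, rfl⟩ := Prod.mk.injEq .. ▸ h'
      obtain ⟨m, h1, h2, h3, h4, h5⟩ := C₂.int_of_e i _ _ hb
      have : ¬ C₂.ε i b'' < C₁.φ i a' := by
        simp only [h1, h3] at hc ⊢
        rcases C₁.bot_or_int i a' with ⟨h6, h7⟩ | ⟨m', h6, h7⟩
        · simp [h7]
        · rw [h7] at hc ⊢; norm_cast at hc ⊢; omega
      simp [this, (C₂.f_iff i _ _).2 hb]

theorem tensorE_some (C₁ : Crystal g n A) (C₂ : Crystal g n B) (i : Fin n) (x y : A × B)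
    (h : tensorE C₁ C₂ i x = some y) :
    max (C₁.ε i y.1) (C₂.ε i y.2 + ((-(C₁.wt y.1 i) : ℤ) : WithBot ℤ)) + 1 =
      max (C₁.ε i x.1) (C₂.ε i x.2 + ((-(C₁.wt x.1 i) : ℤ) : WithBot ℤ)) ∧
    max (C₁.φ i y.1 + ((C₂.wt y.2 i : ℤ) : WithBot ℤ)) (C₂.φ i y.2) =
      max (C₁.φ i x.1 + ((C₂.wt x.2 i : ℤ) : WithBot ℤ)) (C₂.φ i x.2) + 1 ∧
    C₁.wt y.1 + C₂.wt y.2 = C₁.wt x.1 + C₂.wt x.2 + simpleRoot g i := by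
  obtain ⟨a, b⟩ := x
  unfold tensorE at h
  have hr := simpleRoot_self g i
  split_ifs at h with hc
  · obtain ⟨a', ha, rfl⟩ := Option.map_eq_some_iff.1 h
    obtain ⟨m, h1, h2, h3, h4, h5⟩ := C₁.int_of_e i a a' ha
    rcases C₂.bot_or_int i b with ⟨h6, h7⟩ | ⟨m', h6, h7⟩
    · simp only [h1, h2, h3, h4, h5, h6, h7, WithBot.bot_add, max_bot_right] at hc ⊢
      refine ⟨?_, ?_, by abel⟩
      · norm_cast; omega
      · norm_cast; omega
    · simp only [h1, h2, h3, h4, h5, h6, h7, Pi.add_apply, hr] at hc ⊢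
      norm_cast at hc ⊢
      refine ⟨?_, ?_, ?_⟩
      · omega
      · omega
      · abel
  · obtain ⟨b', hb, rfl⟩ := Option.map_eq_some_iff.1 h
    obtain ⟨m, h1, h2, h3, h4, h5⟩ := C₂.int_of_e i b b' hb
    rcases C₁.bot_or_int i a with ⟨h6, h7⟩ | ⟨m', h6, h7⟩
    · simp only [h1, h2, h3, h4, h5, h6, h7, WithBot.bot_add, max_bot_left] at hc ⊢
      refine ⟨?_, ?_, by abel⟩
      · norm_cast; omega
      · norm_cast
    · simp only [h1, h2, h3, h4, h5, h6, h7, Pi.add_apply, hr] at hc ⊢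
      norm_cast at hc ⊢
      refine ⟨?_, ?_, ?_⟩
      · omega
      · omega
      · abel

/-- The tensor product of crystals, with
`ẽ_i(b₁ ⊗ b₂) = ẽ_i b₁ ⊗ b₂` if `φ_i(b₁) ≥ ε_i(b₂)` and `b₁ ⊗ ẽ_i b₂` otherwise,
`f̃_i(b₁ ⊗ b₂) = f̃_i b₁ ⊗ b₂` if `φ_i(b₁) > ε_i(b₂)` and `b₁ ⊗ f̃_i b₂` otherwise. -/
noncomputable def tensor (C₁ : Crystal g n A) (C₂ : Crystal g n B) : Crystal g n (A × B) where
  wt x := C₁.wt x.1 + C₂.wt x.2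
  ε i x := max (C₁.ε i x.1) (C₂.ε i x.2 + ((-(C₁.wt x.1 i) : ℤ) : WithBot ℤ))
  φ i x := max (C₁.φ i x.1 + ((C₂.wt x.2 i : ℤ) : WithBot ℤ)) (C₂.φ i x.2)
  e := tensorE C₁ C₂
  f := tensorF C₁ C₂
  φ_eq i x := by
    rcases C₁.bot_or_int i x.1 with ⟨h1, h2⟩ | ⟨m, h1, h2⟩ <;>
    rcases C₂.bot_or_int i x.2 with ⟨h3, h4⟩ | ⟨m', h3, h4⟩ <;>
    simp only [h1, h2, h3, h4, Pi.add_apply, WithBot.bot_add, WithBot.add_bot, max_bot_left,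
      max_bot_right, le_refl, max_eq_left]
    · norm_cast; ring
    · norm_cast; ring
    · norm_cast; rw [← max_add_add_left]; congr 1 <;> ring
  e_some := tensorE_some C₁ C₂
  f_some i x y h := by
    obtain ⟨h1, h2, h3⟩ := tensorE_some C₁ C₂ i y x ((tensorF_iff C₁ C₂ i x y).1 h)
    exact ⟨h1.symm, h2.symm, by rw [h3]; abel⟩
  f_iff := tensorF_iff C₁ C₂
  of_bot i x h := by
    have h1 : C₁.φ i x.1 = ⊥ := by
      rcases C₁.bot_or_int i x.1 with ⟨_, h2⟩ | ⟨m, _, h2⟩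
      · exact h2
      · rw [h2] at h; exact absurd (max_eq_bot.1 h).1 (by norm_cast; exact WithBot.coe_ne_bot)
    have h2 : C₂.φ i x.2 = ⊥ := (max_eq_bot.1 h).2
    have h3 := C₁.of_bot i _ h1
    have h4 := C₂.of_bot i _ h2
    unfold tensorE tensorF
    simp [h3.1, h3.2, h4.1, h4.2]

/-- The tensor power `b_1 ⊗ b_2 ⊗ ⋯ ⊗ b_k`, where `b_{j+1}` is the value at `j : Fin k`. -/
noncomputable def tpow (C : Crystal g n B) : (k : ℕ) → Crystal g n (Fin k → B)
  | 0 => unit g n _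
  | k + 1 => (C.tensor (tpow C k)).ofEquiv (Fin.consEquiv fun _ => B).symm

/-- The restriction to the Levi subalgebra `𝔩` (vertices `1, …, n-1`), seen as a `𝔤`-crystal
with `ε_n = φ_n = -∞`. -/
def levi (C : Crystal g n B) : Crystal g n B where
  wt := C.wt
  ε i b := if i.1 + 1 < n then C.ε i b else ⊥
  φ i b := if i.1 + 1 < n then C.φ i b else ⊥
  e i b := if i.1 + 1 < n then C.e i b else none
  f i b := if i.1 + 1 < n then C.f i b else none
  φ_eq i b := by split_ifs <;> simp [C.φ_eq]
  e_some i b b' h := by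
    split_ifs at h ⊢ with hi
    exact C.e_some i b b' h
  f_some i b b' h := by
    split_ifs at h ⊢ with hi
    exact C.f_some i b b' h
  f_iff i b b' := by
    split_ifs
    · exact C.f_iff i b b'
    · simp
  of_bot i b h := by
    split_ifs at h ⊢ with hi
    · exact C.of_bot i b h
    · simp

end Crystal

/-! ### Columns -/

/-- The ordered set `[n̄] = {n̄ < ⋯ < 2̄ < 1̄}`; the letter `j̄` is `toDual j` (with `j : Fin n`
standing for `j + 1`). -/
abbrev Letter (n : ℕ) : Type := (Fin n)ᵒᵈ

/-- The letter `j̄`. -/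
abbrev bar {n : ℕ} (j : Fin n) : Letter n := OrderDual.toDual j

/-- Semistandard tableaux of single-column shape `(1^u)`, `u ≥ 0`, with entries in `[n̄]`:
a strictly increasing column is recorded by the set of its entries. -/
abbrev Col (n : ℕ) : Type := Finset (Letter n)

namespace Col

variable {n : ℕ}

/-- The entries listed from top to bottom. -/
def down (U : Col n) : List (Letter n) := U.sort (· ≤ ·)

/-- The entries listed from bottom to top. -/
def up (U : Col n) : List (Letter n) := U.sort (· ≥ ·)

/-- The weight `wt_𝔩` of a column: each letter `j̄` has weight `-ε_j`. -/
def wtL (g : ClType) (U : Col n) : Wt n := -∑ l ∈ U, epsWt g (OrderDual.ofDual l)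

/-- `ε_i` of a column.  For `i < n` it comes from the arrow `\overline{i+1} → \overline{i}` of
`[n̄]` and the tensor product rule on the word of the column read from top to bottom;
for `i = n` it tells whether `n̄` is on top. -/
def eps (i : Fin n) (U : Col n) : ℤ :=
  if h : i.1 + 1 < n then (if bar i ∈ U ∧ bar ⟨i.1 + 1, h⟩ ∉ U then 1 else 0)
  else if bar i ∈ U then 1 else 0

/-- `φ_i` of a column; for `i = n` it tells whether a box `n̄` may be added on top. -/
def phi (i : Fin n) (U : Col n) : ℤ :=
  if h : i.1 + 1 < n then (if bar i ∉ U ∧ bar ⟨i.1 + 1, h⟩ ∈ U then 1 else 0)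
  else if bar i ∈ U then 0 else 1

/-- `ẽ_i` of a column: replaces `\overline{i}` by `\overline{i+1}` for `i < n`, and removes `n̄` from
the top for `i = n`. -/
def e (i : Fin n) (U : Col n) : Option (Col n) :=
  if h : i.1 + 1 < n then
    (if bar i ∈ U ∧ bar ⟨i.1 + 1, h⟩ ∉ U then some (insert (bar ⟨i.1 + 1, h⟩) (U.erase (bar i)))
      else none)
  else if bar i ∈ U then some (U.erase (bar i)) else none

/-- `f̃_i` of a column: replaces `\overline{i+1}` by `\overline{i}` for `i < n`, and adds `n̄` on top
for `i = n`. -/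
def f (i : Fin n) (U : Col n) : Option (Col n) :=
  if h : i.1 + 1 < n then
    (if bar i ∉ U ∧ bar ⟨i.1 + 1, h⟩ ∈ U then some (insert (bar i) (U.erase (bar ⟨i.1 + 1, h⟩)))
      else none)
  else if bar i ∈ U then none else some (insert (bar i) U)

theorem f_iff (i : Fin n) (U V : Col n) : f i U = some V ↔ e i V = some U := by
  unfold f e
  split_ifs with h h1 h2 h2 h1 h2 h2 <;> simp only [Option.some.injEq, iff_false,
    false_iff]
  · have hne : bar i ≠ bar ⟨i.1 + 1, h⟩ := by
      intro hh; have := congrArg (fun x => (OrderDual.ofDual x).1) hh; simp at this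
    constructor
    · rintro rfl
      ext x; simp only [Finset.mem_insert, Finset.mem_erase]
      grind
    · rintro rfl
      ext x; simp only [Finset.mem_insert, Finset.mem_erase]
      grind
  · rintro rfl
    have hne : bar i ≠ bar ⟨i.1 + 1, h⟩ := by
      intro hh; have := congrArg (fun x => (OrderDual.ofDual x).1) hh; simp at this
    grind
  · rintro rfl
    have hne : bar i ≠ bar ⟨i.1 + 1, h⟩ := by
      intro hh; have := congrArg (fun x => (OrderDual.ofDual x).1) hh; simp at this
    grind
  · grind
  · grind
  · grind

theorem eps_phi_of_e (i : Fin n) (U V : Col n) (h : e i U = some V) :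
    eps i U = 1 ∧ phi i U = 0 ∧ eps i V = 0 ∧ phi i V = 1 := by
  have h' := (f_iff i V U).2 h
  unfold e at h; unfold f at h'; unfold eps phi
  split_ifs at h h' ⊢ <;> grind

theorem wtL_apply_of_lt (g : ClType) (i : Fin n) (h : i.1 + 1 < n) (U : Col n) :
    wtL g U i = (if bar ⟨i.1 + 1, h⟩ ∈ U then 1 else 0) - (if bar i ∈ U then 1 else 0) := by
  have h1 : ∀ (k : Fin n), (∑ l ∈ U, if (OrderDual.ofDual l).1 = k.1 then (1 : ℤ) else 0) =
      if bar k ∈ U then 1 else 0 := by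
    intro k
    rw [← Finset.sum_ite_eq' U (bar k) (fun _ => (1 : ℤ))]
    refine Finset.sum_congr rfl fun l _ => ?_
    congr 1
    simp only [eq_iff_iff]
    exact ⟨fun hh => OrderDual.ofDual.injective (Fin.ext hh), fun hh => by rw [hh]; rfl⟩
  simp only [wtL, Pi.neg_apply, Finset.sum_apply, epsWt, h, if_true, Finset.sum_sub_distrib]
  rw [h1 i, h1 ⟨i.1 + 1, h⟩]
  ring

theorem wtL_apply_last (g : ClType) (i : Fin n) (h : ¬ i.1 + 1 < n) (U : Col n) :
    wtL g U i = if bar i ∈ U then (match g with | .b => -2 | .c => -1) else 0 := by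
  have h1 : ∀ c : ℤ, (∑ l ∈ U, if (OrderDual.ofDual l).1 = i.1 then c else 0) =
      if bar i ∈ U then c else 0 := by
    intro c
    rw [← Finset.sum_ite_eq' U (bar i) (fun _ => c)]
    refine Finset.sum_congr rfl fun l _ => ?_
    congr 1
    simp only [eq_iff_iff]
    exact ⟨fun hh => OrderDual.ofDual.injective (Fin.ext hh), fun hh => by rw [hh]; rfl⟩
  simp only [wtL, Pi.neg_apply, Finset.sum_apply, epsWt, h, if_false]
  cases g <;> simp only [h1] <;> split_ifs <;> simp

theorem phi_eq_of_lt (g : ClType) (i : Fin n) (h : i.1 + 1 < n) (U : Col n) :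
    phi i U = wtL g U i + eps i U := by
  rw [wtL_apply_of_lt g i h]
  unfold phi eps
  simp only [h, dite_true]
  split_ifs <;> grind

theorem wtL_insert (g : ClType) (l : Letter n) (U : Col n) (h : l ∉ U) :
    wtL g (insert l U) = wtL g U - epsWt g (OrderDual.ofDual l) := by
  unfold wtL; rw [Finset.sum_insert h]; abel

theorem wtL_erase (g : ClType) (l : Letter n) (U : Col n) (h : l ∈ U) :
    wtL g (U.erase l) = wtL g U + epsWt g (OrderDual.ofDual l) := by
  have := wtL_insert g l (U.erase l) (Finset.notMem_erase l U)
  rw [Finset.insert_erase h] at this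
  rw [this]; abel

theorem wtL_e_of_lt (g : ClType) (i : Fin n) (h : i.1 + 1 < n) (U V : Col n)
    (he : e i U = some V) : wtL g V = wtL g U + simpleRoot g i := by
  unfold e at he
  simp only [h, dite_true] at he
  split_ifs at he with h1
  obtain rfl := Option.some.inj he
  rw [wtL_insert, wtL_erase _ _ _ h1.1]
  · simp only [simpleRoot, h, dite_true, OrderDual.ofDual_toDual]; abel
  · intro hh; exact h1.2 (Finset.mem_of_mem_erase hh)

theorem wtL_e_last (g : ClType) (i : Fin n) (h : ¬ i.1 + 1 < n) (U V : Col n)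
    (he : e i U = some V) : wtL g V = wtL g U + epsWt g i := by
  unfold e at he
  simp only [h, dite_false] at he
  split_ifs at he with h1
  obtain rfl := Option.some.inj he
  rw [wtL_erase _ _ _ h1]; rfl

end Col

theorem omegaLast_of_lt {n : ℕ} (i : Fin n) (h : i.1 + 1 < n) : omegaLast n i = 0 := by
  simp [omegaLast, h.ne]

theorem omegaLast_last {n : ℕ} (i : Fin n) (h : ¬ i.1 + 1 < n) : omegaLast n i = 1 := by
  have : i.1 + 1 = n := by omega
  simp [omegaLast, this]

/-- Columns as an `𝔩`-crystal (with `ε_n = φ_n = -∞`). -/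
def colLevi (g : ClType) (n : ℕ) : Crystal g n (Col n) where
  wt := Col.wtL g
  ε i U := if i.1 + 1 < n then (Col.eps i U : WithBot ℤ) else ⊥
  φ i U := if i.1 + 1 < n then (Col.phi i U : WithBot ℤ) else ⊥
  e i U := if i.1 + 1 < n then Col.e i U else none
  f i U := if i.1 + 1 < n then Col.f i U else none
  φ_eq i U := by
    split_ifs with h
    · rw [Col.phi_eq_of_lt g i h]; push_cast; rfl
    · simp
  e_some i U V h := by
    split_ifs at h ⊢ with hi
    obtain ⟨h1, h2, h3, h4⟩ := Col.eps_phi_of_e i U V h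
    rw [h1, h2, h3, h4]
    exact ⟨by norm_num, by norm_num, Col.wtL_e_of_lt g i hi U V h⟩
  f_some i U V h := by
    split_ifs at h ⊢ with hi
    obtain ⟨h1, h2, h3, h4⟩ := Col.eps_phi_of_e i V U ((Col.f_iff i U V).1 h)
    rw [h1, h2, h3, h4]
    refine ⟨by norm_num, by norm_num, ?_⟩
    rw [Col.wtL_e_of_lt g i hi V U ((Col.f_iff i U V).1 h)]; abel
  f_iff i U V := by
    split_ifs
    · exact Col.f_iff i U V
    · simp
  of_bot i U h := by
    split_ifs at h ⊢ with hi
    · exact absurd h WithBot.coe_ne_bot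
    · exact ⟨rfl, rfl⟩

/-- The crystal `𝐓^sp` of type `B_n`: the spin crystal on columns, of weight `ω_n + wt_𝔩`. -/
def spinCrystal (n : ℕ) : Crystal .b n (Col n) where
  wt U := omegaLast n + Col.wtL .b U
  ε i U := (Col.eps i U : WithBot ℤ)
  φ i U := (Col.phi i U : WithBot ℤ)
  e := Col.e
  f := Col.f
  φ_eq i U := by
    have : Col.phi i U = (omegaLast n + Col.wtL .b U) i + Col.eps i U := by
      rw [Pi.add_apply]
      by_cases h : i.1 + 1 < n
      · rw [omegaLast_of_lt i h, Col.phi_eq_of_lt .b i h, zero_add]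
      · rw [omegaLast_last i h, Col.wtL_apply_last .b i h]
        unfold Col.phi Col.eps
        simp only [h, dite_false]
        split_ifs <;> norm_num
    rw [this]; push_cast; rfl
  e_some i U V h := by
    obtain ⟨h1, h2, h3, h4⟩ := Col.eps_phi_of_e i U V h
    rw [h1, h2, h3, h4]
    refine ⟨by norm_num, by norm_num, ?_⟩
    by_cases hi : i.1 + 1 < n
    · rw [Col.wtL_e_of_lt .b i hi U V h, add_assoc]
    · rw [Col.wtL_e_last .b i hi U V h]; simp [simpleRoot, hi, add_assoc]
  f_some i V U h := by
    have h := (Col.f_iff i V U).1 h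
    obtain ⟨h1, h2, h3, h4⟩ := Col.eps_phi_of_e i U V h
    rw [h1, h2, h3, h4]
    refine ⟨by norm_num, by norm_num, ?_⟩
    by_cases hi : i.1 + 1 < n
    · rw [Col.wtL_e_of_lt .b i hi U V h]; abel
    · rw [Col.wtL_e_last .b i hi U V h]; simp [simpleRoot, hi]; abel
  f_iff := Col.f_iff
  of_bot i U h := by simp at h

/-! ### Two-column tableaux

A pair of columns `T` is stored as `T = (T^R, T^L)`: `T.1` is the right column and `T.2` is the
left column. -/

/-- `ẽ_i` on pairs in type `C_n`: for `i < n` it is that of `T^R ⊗ T^L`, while `ẽ_n` removes a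
domino `n̄ n̄` from the top. -/
noncomputable def dominoE {n : ℕ} (i : Fin n) (T : Col n × Col n) : Option (Col n × Col n) :=
  if i.1 + 1 < n then ((colLevi .c n).tensor (colLevi .c n)).e i T
  else if bar i ∈ T.1 ∧ bar i ∈ T.2 then some (T.1.erase (bar i), T.2.erase (bar i)) else none

/-- `f̃_i` on pairs in type `C_n`: for `i < n` it is that of `T^R ⊗ T^L`, while `f̃_n` adds a domino
`n̄ n̄` on top. -/
noncomputable def dominoF {n : ℕ} (i : Fin n) (T : Col n × Col n) : Option (Col n × Col n) :=
  if i.1 + 1 < n then ((colLevi .c n).tensor (colLevi .c n)).f i T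
  else if bar i ∉ T.1 ∧ bar i ∉ T.2 then some (insert (bar i) T.1, insert (bar i) T.2) else none

/-- `ε_i` on pairs in type `C_n`. -/
noncomputable def dominoEps {n : ℕ} (i : Fin n) (T : Col n × Col n) : WithBot ℤ :=
  if i.1 + 1 < n then ((colLevi .c n).tensor (colLevi .c n)).ε i T
  else if bar i ∈ T.1 ∧ bar i ∈ T.2 then 1 else 0

/-- `φ_i` on pairs in type `C_n`. -/
noncomputable def dominoPhi {n : ℕ} (i : Fin n) (T : Col n × Col n) : WithBot ℤ :=
  if i.1 + 1 < n then ((colLevi .c n).tensor (colLevi .c n)).φ i T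
  else if bar i ∉ T.1 ∧ bar i ∉ T.2 then 1 else 0

theorem dominoF_iff {n : ℕ} (i : Fin n) (T S : Col n × Col n) :
    dominoF i T = some S ↔ dominoE i S = some T := by
  unfold dominoF dominoE
  by_cases hi : i.1 + 1 < n
  · simp only [hi, if_true]; exact Crystal.f_iff _ i T S
  · simp only [hi, if_false]
    constructor
    · intro h
      split_ifs at h with h1
      obtain rfl := Option.some.inj h
      simp [h1.1, h1.2]
    · intro h
      split_ifs at h with h1
      obtain rfl := Option.some.inj h
      simp [h1.1, h1.2]

theorem dominoE_some {n : ℕ} (i : Fin n) (T S : Col n × Col n) (h : dominoE i T = some S) :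
    dominoEps i S + 1 = dominoEps i T ∧ dominoPhi i S = dominoPhi i T + 1 ∧
      omegaLast n + ((colLevi .c n).tensor (colLevi .c n)).wt S =
        omegaLast n + ((colLevi .c n).tensor (colLevi .c n)).wt T + simpleRoot .c i := by
  unfold dominoE at h
  unfold dominoEps dominoPhi
  by_cases hi : i.1 + 1 < n
  · simp only [hi, if_true] at h ⊢
    obtain ⟨a1, a2, a3⟩ := Crystal.e_some _ i T S h
    exact ⟨a1, a2, by rw [a3, add_assoc]⟩
  · simp only [hi, if_false] at h ⊢
    split_ifs at h with h1
    obtain rfl := Option.some.inj h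
    refine ⟨by simp [h1.1, h1.2], by simp [h1.1, h1.2], ?_⟩
    simp only [Crystal.tensor, colLevi, simpleRoot, hi, dite_false]
    rw [Col.wtL_erase _ _ _ h1.1, Col.wtL_erase _ _ _ h1.2, OrderDual.ofDual_toDual, two_smul]
    abel

/-- The `𝔠_n`-crystal structure on pairs of columns `T = (T^R, T^L)`, of weight
`ω_n + wt_𝔩(T)`. -/
noncomputable def dominoCrystal (n : ℕ) : Crystal .c n (Col n × Col n) where
  wt T := omegaLast n + ((colLevi .c n).tensor (colLevi .c n)).wt T
  ε := dominoEps
  φ := dominoPhi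
  e := dominoE
  f := dominoF
  φ_eq i T := by
    unfold dominoEps dominoPhi
    split_ifs with h h1 h2 h2
    · rw [Crystal.φ_eq, Pi.add_apply, omegaLast_of_lt i h, zero_add]
    · grind
    all_goals
      rw [Pi.add_apply, omegaLast_last i h]
      simp only [Crystal.tensor, colLevi, Pi.add_apply, Col.wtL_apply_last .c i h]
      split_ifs <;> first | grind | rfl
  e_some := dominoE_some
  f_some i T S h := by
    obtain ⟨h1, h2, h3⟩ := dominoE_some i S T ((dominoF_iff i T S).1 h)
    exact ⟨h1.symm, h2.symm, by rw [h3]; abel⟩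
  f_iff := dominoF_iff
  of_bot i T h := by
    unfold dominoPhi at h
    unfold dominoE dominoF
    by_cases hi : i.1 + 1 < n
    · simp only [hi, if_true] at h ⊢
      exact Crystal.of_bot _ i T h
    · simp only [hi, if_false] at h
      split_ifs at h <;> simp at h

/-! ### The limit of `B^{⊗ k} ⊗ T_{-kω_n}` for `k → ∞` -/

/-- Sequences `(c_0, c_1, …)` which are eventually equal to `v`. -/
abbrev FinSeq (β : Type) (v : β) : Type := {c : ℕ → β // ∃ k, ∀ j, k ≤ j → c j = v}

namespace FinSeq

variable {β : Type} {v : β}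

open Classical in
/-- The least `k` such that `c_j = v` for all `j ≥ k`. -/
noncomputable def bound (c : FinSeq β v) : ℕ := Nat.find c.2

theorem bound_spec (c : FinSeq β v) (j : ℕ) (h : c.bound ≤ j) : c.1 j = v := by
  classical exact Nat.find_spec c.2 j h

/-- The first `k` terms. -/
def trunc (k : ℕ) (c : ℕ → β) : Fin k → β := fun j => c j

/-- Extension of a finite sequence by the value `v`. -/
def extend (v : β) {k : ℕ} (x : Fin k → β) : FinSeq β v :=
  ⟨fun j => if h : j < k then x ⟨j, h⟩ else v, k, fun j h => by simp [not_lt.2 h]⟩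

theorem trunc_extend {k : ℕ} (x : Fin k → β) : trunc k (extend v x).1 = x := by
  funext j; simp [trunc, extend]

theorem extend_trunc {k : ℕ} (c : FinSeq β v) (h : c.bound ≤ k) : extend v (trunc k c.1) = c := by
  apply Subtype.ext
  funext j
  simp only [extend, trunc]
  split_ifs with hj
  · rfl
  · exact (c.bound_spec j (by omega)).symm

/-- Adds a first term to a finite sequence. -/
def consF {k : ℕ} (a : β) (x : Fin k → β) : Fin (k + 1) → β := Fin.cons a x

theorem extend_consF {k l : ℕ} (a : β) (x : Fin k → β) (y : Fin l → β)
    (h : extend v x = extend v y) : extend v (consF a x) = extend v (consF a y) := by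
  apply Subtype.ext
  funext j
  have h' := congrArg Subtype.val h
  rcases j with _ | j
  · simp [extend, consF]
  · have := congrFun h' j
    simp only [extend] at this ⊢
    simp only [Nat.add_lt_add_iff_right]
    exact this

theorem extend_trunc_succ (k : ℕ) (c : ℕ → β) (h : ∀ j, k ≤ j → c j = v) :
    extend v (trunc (k + 1) c) = extend v (trunc k c) := by
  apply Subtype.ext
  funext j
  simp only [extend, trunc]
  split_ifs with h1 h2 h2
  · rfl
  · exact h j (by omega)
  · omega
  · rfl

theorem map_consF {k l : ℕ} (a : β) (x : Option (Fin k → β)) (y : Option (Fin l → β))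
    (h : x.map (extend v) = y.map (extend v)) :
    (x.map (consF a)).map (extend v) = (y.map (consF a)).map (extend v) := by
  cases x <;> cases y <;> simp at h ⊢
  exact extend_consF a _ _ h

end FinSeq

namespace Crystal

variable {g : ClType} {n : ℕ} {β : Type}

open FinSeq

theorem tpow_ε_trunc (D : Crystal g n β) (v : β) (hε : ∀ i, D.ε i v = 0)
    (hw : ∀ i, 0 ≤ D.wt v i) (i : Fin n) (k : ℕ) :
    ∀ c : ℕ → β, (∀ j, k ≤ j → c j = v) →
      (D.tpow (k + 1)).ε i (trunc (k + 1) c) = (D.tpow k).ε i (trunc k c) := by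
  induction k with
  | zero =>
    intro c hc
    change max (D.ε i (c 0)) ((0 : WithBot ℤ) + ((-(D.wt (c 0) i) : ℤ) : WithBot ℤ)) = 0
    rw [hc 0 le_rfl, hε i, zero_add]
    apply max_eq_left
    have := hw i
    exact_mod_cast (by omega : -(D.wt v i) ≤ 0)
  | succ k ih =>
    intro c hc
    change max (D.ε i (c 0)) ((D.tpow (k + 1)).ε i (trunc (k + 1) fun j => c (j + 1)) +
        ((-(D.wt (c 0) i) : ℤ) : WithBot ℤ)) =
      max (D.ε i (c 0)) ((D.tpow k).ε i (trunc k fun j => c (j + 1)) +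
        ((-(D.wt (c 0) i) : ℤ) : WithBot ℤ))
    rw [ih (fun j => c (j + 1)) fun j hj => hc (j + 1) (by omega)]

theorem tpow_wt_trunc (D : Crystal g n β) (v : β) (k : ℕ) :
    ∀ c : ℕ → β, (∀ j, k ≤ j → c j = v) →
      (D.tpow (k + 1)).wt (trunc (k + 1) c) = (D.tpow k).wt (trunc k c) + D.wt v := by
  induction k with
  | zero =>
    intro c hc
    change D.wt (c 0) + 0 = 0 + D.wt v
    rw [hc 0 le_rfl, add_zero, zero_add]
  | succ k ih =>
    intro c hc
    change D.wt (c 0) + (D.tpow (k + 1)).wt (trunc (k + 1) fun j => c (j + 1)) =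
      D.wt (c 0) + (D.tpow k).wt (trunc k fun j => c (j + 1)) + D.wt v
    rw [ih (fun j => c (j + 1)) fun j hj => hc (j + 1) (by omega), add_assoc]

theorem tpow_succ_e (D : Crystal g n β) (i : Fin n) (k : ℕ) (c : ℕ → β) :
    (D.tpow (k + 1)).e i (trunc (k + 1) c) =
      if (D.tpow k).ε i (trunc k fun j => c (j + 1)) ≤ D.φ i (c 0) then
        (D.e i (c 0)).map fun a => consF a (trunc k fun j => c (j + 1))
      else ((D.tpow k).e i (trunc k fun j => c (j + 1))).map (consF (c 0)) := by
  change Option.map (fun p : β × (Fin k → β) => consF p.1 p.2) (tensorE D (D.tpow k) i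
        (c 0, trunc k fun j => c (j + 1))) = _
  unfold tensorE
  split_ifs <;> rw [Option.map_map] <;> rfl

theorem tpow_succ_f (D : Crystal g n β) (i : Fin n) (k : ℕ) (c : ℕ → β) :
    (D.tpow (k + 1)).f i (trunc (k + 1) c) =
      if (D.tpow k).ε i (trunc k fun j => c (j + 1)) < D.φ i (c 0) then
        (D.f i (c 0)).map fun a => consF a (trunc k fun j => c (j + 1))
      else ((D.tpow k).f i (trunc k fun j => c (j + 1))).map (consF (c 0)) := by
  change Option.map (fun p : β × (Fin k → β) => consF p.1 p.2) (tensorF D (D.tpow k) i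
        (c 0, trunc k fun j => c (j + 1))) = _
  unfold tensorF
  split_ifs <;> rw [Option.map_map] <;> rfl

theorem tpow_e_trunc (D : Crystal g n β) (v : β) (hε : ∀ i, D.ε i v = 0)
    (hw : ∀ i, 0 ≤ D.wt v i) (he : ∀ i, D.e i v = none) (i : Fin n) (k : ℕ) :
    ∀ c : ℕ → β, (∀ j, k ≤ j → c j = v) →
      ((D.tpow (k + 1)).e i (trunc (k + 1) c)).map (extend v) =
        ((D.tpow k).e i (trunc k c)).map (extend v) := by
  induction k with
  | zero =>
    intro c hc
    rw [tpow_succ_e, hc 0 le_rfl, he]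
    split_ifs <;> rfl
  | succ k ih =>
    intro c hc
    have hc' : ∀ j, k ≤ j → (fun j => c (j + 1)) j = v := fun j hj => hc (j + 1) (by omega)
    rw [tpow_succ_e D i (k + 1) c, tpow_succ_e D i k c, tpow_ε_trunc D v hε hw i k _ hc']
    split_ifs
    · cases D.e i (c 0) with
      | none => rfl
      | some a =>
        simp only [Option.map_some, Option.some.injEq]
        exact extend_consF a _ _ (extend_trunc_succ k _ hc')
    · exact map_consF (c 0) _ _ (ih _ hc')

theorem tpow_f_trunc (D : Crystal g n β) (v : β) (hε : ∀ i, D.ε i v = 0)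
    (hw : ∀ i, 0 ≤ D.wt v i) (i : Fin n) (k : ℕ) :
    ∀ c : ℕ → β, (∀ j, k ≤ j → c j = v) →
      ((D.tpow (k + 2)).f i (trunc (k + 2) c)).map (extend v) =
        ((D.tpow (k + 1)).f i (trunc (k + 1) c)).map (extend v) := by
  induction k with
  | zero =>
    intro c hc
    have hc' : ∀ j, 0 ≤ j → (fun j => c (j + 1)) j = v := fun j hj => hc (j + 1) (by omega)
    rw [tpow_succ_f D i 1 c, tpow_succ_f D i 0 c, tpow_ε_trunc D v hε hw i 0 _ hc']
    have h0 : (D.tpow 0).ε i (trunc 0 fun j => c (j + 1)) = 0 := rfl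
    split_ifs with h
    · cases D.f i (c 0) with
      | none => rfl
      | some a =>
        simp only [Option.map_some, Option.some.injEq]
        exact extend_consF a _ _ (extend_trunc_succ 0 _ hc')
    · rw [h0, hc 0 le_rfl] at h
      have h1 : (D.tpow 0).ε i (trunc 0 fun j => c (j + 1 + 1)) = 0 := rfl
      rw [tpow_succ_f D i 0 (fun j => c (j + 1)), h1, hc 1 (by omega), if_neg h]
      rfl
  | succ k ih =>
    intro c hc
    have hc' : ∀ j, k ≤ j → (fun j => c (j + 1)) j = v := fun j hj => hc (j + 1) (by omega)
    rw [tpow_succ_f D i (k + 2) c, tpow_succ_f D i (k + 1) c,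
      tpow_ε_trunc D v hε hw i (k + 1) _ fun j hj => hc' j (by omega)]
    split_ifs
    · cases D.f i (c 0) with
      | none => rfl
      | some a =>
        simp only [Option.map_some, Option.some.injEq]
        exact extend_consF a _ _ (extend_trunc_succ (k + 1) _ fun j hj => hc' j (by omega))
    · exact map_consF (c 0) _ _ (ih _ hc')

/-- The crystal `B^{⊗ k} ⊗ T_{-kω_n}`. -/
noncomputable def level (D : Crystal g n β) (k : ℕ) : Crystal g n ((Fin k → β) × Unit) :=
  (D.tpow k).tensor (single g (-((k : ℤ) • omegaLast n)))

theorem level_ε (D : Crystal g n β) (k : ℕ) (i : Fin n) (x : (Fin k → β) × Unit) :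
    (D.level k).ε i x = (D.tpow k).ε i x.1 := by
  change max _ (⊥ + _) = _
  simp

theorem level_e (D : Crystal g n β) (k : ℕ) (i : Fin n) (x : (Fin k → β) × Unit) :
    (D.level k).e i x = ((D.tpow k).e i x.1).map fun y => (y, ()) := by
  change tensorE (D.tpow k) (single g (-((k : ℤ) • omegaLast n))) i x = _
  unfold tensorE
  have h : (single g (-((k : ℤ) • omegaLast n))).ε i x.2 ≤ (D.tpow k).φ i x.1 := bot_le
  rw [if_pos h]

theorem level_f (D : Crystal g n β) (k : ℕ) (i : Fin n) (x : (Fin k → β) × Unit) :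
    (D.level k).f i x = ((D.tpow k).f i x.1).map fun y => (y, ()) := by
  change tensorF (D.tpow k) (single g (-((k : ℤ) • omegaLast n))) i x = _
  unfold tensorF
  split_ifs with h
  · rfl
  · have h1 : (D.tpow k).φ i x.1 = ⊥ := by
      have : ¬ (⊥ : WithBot ℤ) < (D.tpow k).φ i x.1 := h
      simpa using this
    rw [((D.tpow k).of_bot i _ h1).2]
    rfl

/-- The value of `ẽ_i` on a sequence, computed in `B^{⊗ k} ⊗ T_{-kω_n}`. -/
noncomputable def levelE (D : Crystal g n β) (v : β) (i : Fin n) (k : ℕ) (c : FinSeq β v) :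
    Option (FinSeq β v) :=
  ((D.level k).e i (trunc k c.1, ())).map fun p => extend v p.1

/-- The value of `f̃_i` on a sequence, computed in `B^{⊗ k} ⊗ T_{-kω_n}`. -/
noncomputable def levelF (D : Crystal g n β) (v : β) (i : Fin n) (k : ℕ) (c : FinSeq β v) :
    Option (FinSeq β v) :=
  ((D.level k).f i (trunc k c.1, ())).map fun p => extend v p.1

theorem wt_nonneg (D : Crystal g n β) (v : β) (hw : D.wt v = omegaLast n) (i : Fin n) :
    0 ≤ D.wt v i := by
  rw [hw]; unfold omegaLast; split_ifs <;> norm_num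

theorem level_ε_eq (D : Crystal g n β) (v : β) (hε : ∀ i, D.ε i v = 0) (hw : D.wt v = omegaLast n)
    (i : Fin n) (c : FinSeq β v) (k : ℕ) (hk : c.bound ≤ k) :
    (D.level k).ε i (trunc k c.1, ()) =
      (D.level (c.bound + 1)).ε i (trunc (c.bound + 1) c.1, ()) := by
  have h : ∀ k, c.bound ≤ k → (D.tpow k).ε i (trunc k c.1) =
      (D.tpow c.bound).ε i (trunc c.bound c.1) := by
    intro k hk
    induction k, hk using Nat.le_induction with
    | base => rfl
    | succ k hk ih =>
      rw [tpow_ε_trunc D v hε (wt_nonneg D v hw) i k c.1 fun j hj => c.bound_spec j (by omega), ih]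
  rw [level_ε, level_ε, h k hk, h (c.bound + 1) (by omega)]

theorem level_wt_eq (D : Crystal g n β) (v : β) (hw : D.wt v = omegaLast n)
    (c : FinSeq β v) (k : ℕ) (hk : c.bound ≤ k) :
    (D.level k).wt (trunc k c.1, ()) =
      (D.level (c.bound + 1)).wt (trunc (c.bound + 1) c.1, ()) := by
  have h : ∀ k, c.bound ≤ k → (D.level k).wt (trunc k c.1, ()) =
      (D.level c.bound).wt (trunc c.bound c.1, ()) := by
    intro k hk
    induction k, hk using Nat.le_induction with
    | base => rfl
    | succ k hk ih =>
      rw [← ih]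
      change (D.tpow (k + 1)).wt (trunc (k + 1) c.1) + -(((k + 1 : ℕ) : ℤ) • omegaLast n) =
        (D.tpow k).wt (trunc k c.1) + -((k : ℤ) • omegaLast n)
      rw [tpow_wt_trunc D v k c.1 fun j hj => c.bound_spec j (by omega), hw]
      push_cast
      rw [add_smul, one_smul]; abel
  rw [h k hk, h (c.bound + 1) (by omega)]

theorem level_φ_eq (D : Crystal g n β) (v : β) (hε : ∀ i, D.ε i v = 0) (hw : D.wt v = omegaLast n)
    (i : Fin n) (c : FinSeq β v) (k : ℕ) (hk : c.bound ≤ k) :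
    (D.level k).φ i (trunc k c.1, ()) =
      (D.level (c.bound + 1)).φ i (trunc (c.bound + 1) c.1, ()) := by
  rw [Crystal.φ_eq, Crystal.φ_eq, level_ε_eq D v hε hw i c k hk, level_wt_eq D v hw c k hk]

theorem levelE_eq (D : Crystal g n β) (v : β) (hε : ∀ i, D.ε i v = 0) (he : ∀ i, D.e i v = none) (hw : D.wt v = omegaLast n)
    (i : Fin n) (c : FinSeq β v) (k : ℕ) (hk : c.bound ≤ k) :
    levelE D v i k c = levelE D v i (c.bound + 1) c := by
  have h : ∀ k, c.bound ≤ k → levelE D v i k c = levelE D v i c.bound c := by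
    intro k hk
    induction k, hk using Nat.le_induction with
    | base => rfl
    | succ k hk ih =>
      rw [← ih]
      unfold levelE
      rw [level_e, level_e, Option.map_map, Option.map_map]
      exact tpow_e_trunc D v hε (wt_nonneg D v hw) he i k c.1
        fun j hj => c.bound_spec j (by omega)
  rw [h k hk, h (c.bound + 1) (by omega)]

theorem levelF_eq (D : Crystal g n β) (v : β) (hε : ∀ i, D.ε i v = 0) (hw : D.wt v = omegaLast n)
    (i : Fin n) (c : FinSeq β v) (k : ℕ) (hk : c.bound + 1 ≤ k) :
    levelF D v i k c = levelF D v i (c.bound + 1) c := by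
  induction k, hk using Nat.le_induction with
  | base => rfl
  | succ k hk ih =>
    rw [← ih]
    obtain ⟨m, rfl⟩ : ∃ m, k = m + 1 := ⟨k - 1, by omega⟩
    unfold levelF
    rw [level_f, level_f, Option.map_map, Option.map_map]
    exact tpow_f_trunc D v hε (wt_nonneg D v hw) i m c.1
      fun j hj => c.bound_spec j (by omega)

theorem map_extend_iff {v : β} {k : ℕ} (o : Option ((Fin k → β) × Unit)) (c : FinSeq β v)
    (h : c.bound ≤ k) :
    (o.map fun p => extend v p.1) = some c ↔ o = some (trunc k c.1, ()) := by
  rw [Option.map_eq_some_iff]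
  constructor
  · rintro ⟨⟨x, _⟩, rfl, h1⟩
    rw [← h1, trunc_extend]
  · rintro rfl
    exact ⟨_, rfl, extend_trunc c h⟩

/-- Let `D` be a crystal with an element `v` such that `ẽ_i v = 0` and `ε_i(v) = 0` for all `i`, and
`wt(v) = ω_n`.  The map `b_1 ⊗ ⋯ ⊗ b_k ⊗ t_{-kω_n} ↦ b_1 ⊗ ⋯ ⊗ b_k ⊗ v ⊗ t_{-(k+1)ω_n}` is an
embedding of `B^{⊗ k} ⊗ T_{-kω_n}` into `B^{⊗ (k+1)} ⊗ T_{-(k+1)ω_n}`.  This is the crystal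
structure on the union over all `k`: the structure maps are computed for `k` large. -/
noncomputable def limit (D : Crystal g n β) (v : β) (hε : ∀ i, D.ε i v = 0)
    (he : ∀ i, D.e i v = none) (hw : D.wt v = omegaLast n) : Crystal g n (FinSeq β v) where
  wt c := (D.level (c.bound + 1)).wt (trunc _ c.1, ())
  ε i c := (D.level (c.bound + 1)).ε i (trunc _ c.1, ())
  φ i c := (D.level (c.bound + 1)).φ i (trunc _ c.1, ())
  e i c := levelE D v i (c.bound + 1) c
  f i c := levelF D v i (c.bound + 1) c
  φ_eq i c := Crystal.φ_eq _ i _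
  e_some i c c' h := by
    have hk : c.bound ≤ max (c.bound + 1) (c'.bound + 1) := by omega
    have hk' : c'.bound ≤ max (c.bound + 1) (c'.bound + 1) := by omega
    rw [← levelE_eq D v hε he hw i c _ hk] at h
    have h1 := Crystal.e_some _ i _ _ ((map_extend_iff _ _ hk').1 h)
    rwa [level_ε_eq D v hε hw i c _ hk, level_ε_eq D v hε hw i c' _ hk',
      level_φ_eq D v hε hw i c _ hk, level_φ_eq D v hε hw i c' _ hk',
      level_wt_eq D v hw c _ hk, level_wt_eq D v hw c' _ hk'] at h1
  f_some i c c' h := by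
    have hk : c.bound ≤ max (c.bound + 1) (c'.bound + 1) := by omega
    have hk' : c'.bound ≤ max (c.bound + 1) (c'.bound + 1) := by omega
    rw [← levelF_eq D v hε hw i c (max (c.bound + 1) (c'.bound + 1)) (le_max_left _ _)] at h
    have h1 := Crystal.f_some _ i _ _ ((map_extend_iff _ _ hk').1 h)
    rwa [level_ε_eq D v hε hw i c _ hk, level_ε_eq D v hε hw i c' _ hk',
      level_φ_eq D v hε hw i c _ hk, level_φ_eq D v hε hw i c' _ hk',
      level_wt_eq D v hw c _ hk, level_wt_eq D v hw c' _ hk'] at h1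
  f_iff i c c' := by
    have hk : c.bound ≤ max (c.bound + 1) (c'.bound + 1) := by omega
    have hk' : c'.bound ≤ max (c.bound + 1) (c'.bound + 1) := by omega
    rw [← levelF_eq D v hε hw i c (max (c.bound + 1) (c'.bound + 1)) (le_max_left _ _),
      ← levelE_eq D v hε he hw i c' _ hk']
    unfold levelE levelF
    rw [map_extend_iff _ _ hk', map_extend_iff _ _ hk]
    exact Crystal.f_iff _ i _ _
  of_bot i c h := by
    have := Crystal.of_bot _ i _ h
    unfold levelE levelF
    rw [this.1, this.2]
    exact ⟨rfl, rfl⟩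

end Crystal

/-! ### Jeu de taquin on two columns -/

section TwoColumns

variable {n : ℕ}

/-- Comparison of two entries; void if one of the two positions is empty. -/
def EntryLE (x y : Option (Letter n)) : Prop := ∀ a ∈ x, ∀ b ∈ y, a ≤ b

instance (x y : Option (Letter n)) : Decidable (EntryLE x y) := by
  unfold EntryLE
  cases x <;> cases y <;> simp only [Option.mem_def, reduceCtorEq, false_imp_iff, implies_true,
    Option.some.injEq, forall_eq'] <;> infer_instance

/-- Place the columns `U` (left) and `V` (right) so that the `k` lowest boxes of `V` are in the same
rows as the `k` highest boxes of `U`: these `k` rows are weakly increasing. -/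
def Overlap (U V : Col n) (k : ℕ) : Prop :=
  k ≤ U.card ∧ k ≤ V.card ∧ ∀ j < k, EntryLE U.up[U.card - k + j]? V.up[j]?

instance (U V : Col n) (k : ℕ) : Decidable (Overlap U V k) := by unfold Overlap; infer_instance

/-- `T` is a semistandard tableau of shape `λ(a,b,c) = (2^{b+c},1^a)/(1^b)`. -/
def IsSST (a b c : ℕ) (T : Col n × Col n) : Prop :=
  T.2.card = a + c ∧ T.1.card = b + c ∧ Overlap T.2 T.1 c

/-- `𝔯_T = 0` for `T` of shape `λ(a,b,c)`: for no `0 < k ≤ min(a,b)`, sliding `T^R` down by `k`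
positions gives a semistandard tableau (of shape `λ(a-k,b-k,c+k)`). -/
def SlideZero (a b c : ℕ) (T : Col n × Col n) : Prop :=
  ∀ k, 0 < k → k ≤ min a b → ¬ IsSST (a - k) (b - k) (c + k) T

/-- The set `𝐓^𝔤(a)`. -/
def TSet (g : ClType) (a : ℕ) : Set (Col n × Col n) :=
  match g with
  | .c => {T | ∃ c, IsSST a 0 c T}
  | .b => {T | ∃ b c, IsSST a b c T ∧ SlideZero a b c T}

/-- The unique `k` such that the columns `U`, `V` form a semistandard tableau `T` of shape
`λ(u-k,v-k,k)` with `𝔯_T = 0`, namely the largest `k` for which they form a semistandard tableau. -/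
def overlap (U V : Col n) : ℕ := Nat.findGreatest (Overlap U V) (min U.card V.card)

/-- Jeu de taquin sliding into a hole of the left column.  Here `xs` are the entries of the left
column below the hole, and `ys` those of the right column from the row of the hole on, from top to
bottom.  If the entry `x` below the hole is not larger than the entry `y` to the right, then `x`
moves up and the hole goes down by one row; otherwise `y` moves to the left, and the sliding goes on
inside the right column.  The result is the entry moving from the right to the left column. -/
def slideLeft : List (Letter n) → List (Letter n) → Option (Letter n)
  | _, [] => none
  | [], y :: _ => some y
  | x :: xs, y :: ys => if x ≤ y then slideLeft xs ys else some y

/-- Jeu de taquin sliding into a hole of the right column.  Here `xs` are the entries of the left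
column from the row of the hole on, and `ys` those of the right column above the hole, from bottom to
top.  If the entry `y` above the hole is not smaller than the entry `x` to the left, then `y`
moves down and the hole goes up by one row; otherwise `x` moves to the right, and the sliding goes on
inside the left column.  The result is the entry moving from the left to the right column. -/
def slideRight : List (Letter n) → List (Letter n) → Option (Letter n)
  | [], _ => none
  | x :: _, [] => some x
  | x :: xs, y :: ys => if x ≤ y then slideRight xs ys else some x

/-- `ℰ`: sliding into the position below the bottom of the right column; it is `0` if the tail
is empty. -/
def jdtE (T : Col n × Col n) : Option (Col n × Col n) :=
  let a := T.2.card - overlap T.2 T.1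
  if a = 0 then none
  else (slideRight (T.2.up.drop (a - 1)) T.1.up).map fun x => (insert x T.1, T.2.erase x)

/-- `ℱ`: sliding into the position above the top of the left column; it is `0` if the right
column does not exceed the left one at the top. -/
def jdtF (T : Col n × Col n) : Option (Col n × Col n) :=
  let b := T.1.card - overlap T.2 T.1
  if b = 0 then none
  else (slideLeft T.2.down (T.1.down.drop (b - 1))).map fun y => (T.1.erase y, insert y T.2)

/-- `ℰ^a T = (^R T, ^L T)` for `T ∈ 𝐓^𝔤(a)`. -/
def jdtEPow (a : ℕ) (T : Col n × Col n) : Option (Col n × Col n) :=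
  (fun o : Option (Col n × Col n) => o.bind jdtE)^[a] (some T)

/-- The pair `(T₂, T₁)` with `T₂ ∈ 𝐓^𝔤(a₂)` is admissible.  The remaining arguments are `a₁`, `T₁^L` and
`^L T₁`. -/
def AdmissibleCols (a₂ : ℕ) (T₂ : Col n × Col n) (a₁ : ℕ) (T₁L LT₁ : Col n) : Prop :=
  T₂.1.card + a₁ ≤ T₁L.card ∧
  (∀ i : ℕ, EntryLE T₂.1.up[i]? LT₁.up[i]?) ∧
  ∃ S, jdtEPow a₂ T₂ = some S ∧ ∀ i : ℕ, EntryLE S.1.up[i + (a₂ - a₁)]? T₁L.up[i]?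

/-- Admissibility `T₂ ≺ T₁` for `T₂ ∈ 𝐓^𝔤(a₂)`, `T₁ ∈ 𝐓^𝔤(a₁)`. -/
def Admissible (a₂ : ℕ) (T₂ : Col n × Col n) (a₁ : ℕ) (T₁ : Col n × Col n) : Prop :=
  ∃ S, jdtEPow a₁ T₁ = some S ∧ AdmissibleCols a₂ T₂ a₁ T₁.2 S.2

/-- Admissibility `T₂ ≺ T₁` for `T₂ ∈ 𝐓^𝔤(a₂)`, `T₁ ∈ 𝐓^sp`. -/
def AdmissibleSpin (a₂ : ℕ) (T₂ : Col n × Col n) (T₁ : Col n) : Prop :=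
  AdmissibleCols a₂ T₂ 0 T₁ T₁

end TwoColumns

/-! ### The spinor model -/

section Spinor

variable {n : ℕ}

/-- The number `ℓ = μ_1` of columns of a partition `μ ∈ 𝒫_n`. -/
def numCols (μ : Fin n → ℕ) : ℕ := Finset.univ.sup μ

/-- `a_i = n - μ'_i` for `1 ≤ i ≤ ℓ`, where `μ'_i = #{j | μ_j ≥ i}` is the height of the `i`-th column
of `μ`. -/
def tailLen (μ : Fin n → ℕ) (i : ℕ) : ℕ := n - (Finset.univ.filter fun j => i ≤ μ j).card

/-- The crystal structure on pairs of columns which `𝐓^𝔤(a)` inherits, given by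
`T^R ⊗ T^L ∈ (𝐓^sp)^{⊗2}` in type `B_n`, and by dominoes in type `C_n`. -/
noncomputable def pairCrystal (n : ℕ) : (g : ClType) → Crystal g n (Col n × Col n)
  | .b => (spinCrystal n).tensor (spinCrystal n)
  | .c => dominoCrystal n

/-- The set `𝐓^𝔤_λ` for `λ = μ ∈ 𝒫_n`.  The component `T_{i+1} ∈ 𝐓^𝔤(a_{i+1})` is the value at
`i : Fin ℓ`. -/
def spinorSet (g : ClType) (μ : Fin n → ℕ) : Set (Fin (numCols μ) → Col n × Col n) :=
  {T | (∀ i : Fin (numCols μ), T i ∈ TSet g (tailLen μ (i + 1))) ∧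
    ∀ i j : Fin (numCols μ), j.1 = i.1 + 1 → Admissible (tailLen μ (j + 1)) (T j) (tailLen μ (i + 1)) (T i)}

/-- The crystal `𝐓^𝔤_λ` for `λ = μ ∈ 𝒫_n`: `(T_ℓ, …, T_1)` is identified with
`T_1 ⊗ T_2 ⊗ ⋯ ⊗ T_ℓ`. -/
noncomputable def spinorCrystal (g : ClType) (μ : Fin n → ℕ) : Crystal g n (spinorSet g μ) :=
  ((pairCrystal n g).tpow (numCols μ)).restrict (spinorSet g μ)

/-- The set `𝐓^{𝔟_n}_λ` for `λ = μ + (1/2, …, 1/2) ∈ 𝒫_n^sp`; its elements are `(T_0, (T_1, …, T_ℓ))`. -/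
def spinorSpinSet (μ : Fin n → ℕ) : Set (Col n × (Fin (numCols μ) → Col n × Col n)) :=
  {T | T.2 ∈ spinorSet .b μ ∧ ∀ i : Fin (numCols μ), i.1 = 0 → AdmissibleSpin (tailLen μ 1) (T.2 i) T.1}

/-- The crystal `𝐓^{𝔟_n}_λ` for `λ = μ + (1/2, …, 1/2) ∈ 𝒫_n^sp`: `(T_ℓ, …, T_1, T_0)` is identified
with `T_0 ⊗ T_1 ⊗ ⋯ ⊗ T_ℓ`. -/
noncomputable def spinorSpinCrystal (μ : Fin n → ℕ) : Crystal .b n (spinorSpinSet μ) :=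
  ((spinCrystal n).tensor ((pairCrystal n .b).tpow (numCols μ))).restrict (spinorSpinSet μ)

end Spinor

/-! ### The crystal of a maximal parabolic Verma module -/

section Verma

variable {n : ℕ}

theorem Col.eps_empty (i : Fin n) : Col.eps i (∅ : Col n) = 0 := by simp [Col.eps]

theorem Col.e_empty (i : Fin n) : Col.e i (∅ : Col n) = none := by simp [Col.e]

theorem Col.wtL_empty (g : ClType) : Col.wtL g (∅ : Col n) = 0 := by simp [Col.wtL]

/-- Reading a sequence of columns two by two. -/
def pairUp (c : FinSeq (Col n) ∅) : FinSeq (Col n × Col n) (∅, ∅) :=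
  ⟨fun j => (c.1 (2 * j), c.1 (2 * j + 1)), by
    obtain ⟨k, hk⟩ := c.2
    exact ⟨k, fun j hj => by simp only [hk (2 * j) (by omega), hk (2 * j + 1) (by omega)]⟩⟩

/-- The inverse of `pairUp`. -/
def unpair (d : FinSeq (Col n × Col n) (∅, ∅)) : FinSeq (Col n) ∅ :=
  ⟨fun j => if j % 2 = 0 then (d.1 (j / 2)).1 else (d.1 (j / 2)).2, by
    obtain ⟨k, hk⟩ := d.2
    exact ⟨2 * k, fun j hj => by simp only [hk (j / 2) (by omega), ite_self]⟩⟩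

def pairEquiv : FinSeq (Col n) ∅ ≃ FinSeq (Col n × Col n) (∅, ∅) where
  toFun := pairUp
  invFun := unpair
  left_inv c := by
    apply Subtype.ext
    funext j
    simp only [pairUp, unpair]
    split_ifs with h
    · exact congrArg c.1 (by omega)
    · exact congrArg c.1 (by omega)
  right_inv d := by
    apply Subtype.ext
    funext j
    simp only [pairUp, unpair]
    have h1 : 2 * j % 2 = 0 := by omega
    have h2 : ¬ (2 * j + 1) % 2 = 0 := by omega
    have h3 : 2 * j / 2 = j := by omega
    have h4 : (2 * j + 1) / 2 = j := by omega
    simp only [h1, h2, h3, h4, if_true, if_false]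

/-- The crystal structure inherited by `𝐕^𝔤`, on sequences of columns read from right to left (the
column with index `j` is the `(j+1)`-th from the right).  The tableau is identified with
`T_1 ⊗ ⋯ ⊗ T_k ⊗ t_{-kω_n}` for `k` large, where `T_i` is the `i`-th column from the right in type
`B_n`, and consists of the columns `2i-1` (right) and `2i` (left) in type `C_n`. -/
noncomputable def columnsCrystal (n : ℕ) : (g : ClType) → Crystal g n (FinSeq (Col n) ∅)
  | .b => (spinCrystal n).limit ∅
      (fun i => by simp [spinCrystal, Col.eps_empty])
      (fun i => by simp [spinCrystal, Col.e_empty])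
      (by simp [spinCrystal, Col.wtL_empty])
  | .c => ((dominoCrystal n).limit (∅, ∅)
      (fun i => by
        simp only [dominoCrystal, dominoEps, Crystal.tensor, colLevi, Col.eps_empty, Col.wtL_empty]
        split_ifs with h1 h2
        · simp
        · exact absurd h2.1 (Finset.notMem_empty _)
        · rfl)
      (fun i => by
        simp only [dominoCrystal, dominoE, Crystal.tensor, Crystal.tensorE, colLevi, Col.e_empty]
        split_ifs with h1 h2 h3
        · rfl
        · rfl
        · exact absurd h3.1 (Finset.notMem_empty _)
        · rfl)
      (by simp [dominoCrystal, Crystal.tensor, colLevi, Col.wtL_empty])).ofEquiv pairEquiv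

/-- The set `𝐕^𝔤`: the semistandard tableaux of shape `τ^π`, where `τ` is a partition, all of whose
parts are even in type `C_n`.  The columns are aligned at the bottom; the heights of the columns, read
from the right, are the parts of the conjugate partition `τ'`. -/
def vermaBodySet (g : ClType) (n : ℕ) : Set (FinSeq (Col n) ∅) :=
  {c | (∀ j, (c.1 (j + 1)).card ≤ (c.1 j).card ∧
      ∀ i : ℕ, EntryLE (c.1 (j + 1)).up[i]? (c.1 j).up[i]?) ∧
    (g = .c → ∀ j, (c.1 (2 * j)).card = (c.1 (2 * j + 1)).card)}

/-- The crystal `𝐕^𝔤`. -/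
noncomputable def vermaBodyCrystal (g : ClType) (n : ℕ) : Crystal g n (vermaBodySet g n) :=
  (columnsCrystal n g).restrict (vermaBodySet g n)

/-- The set `SST(ν)` for `ν = (a_ℓ, …, a_1)'`: the value at `i : Fin ℓ` is the `(i+1)`-th column
from the right, of height `a_{i+1}`; the columns are aligned at the top. -/
def vermaTailSet (μ : Fin n → ℕ) : Set (Fin (numCols μ) → Col n) :=
  {t | (∀ i : Fin (numCols μ), (t i).card = tailLen μ (i + 1)) ∧
    ∀ i j : Fin (numCols μ), j.1 = i.1 + 1 → ∀ k : ℕ, EntryLE (t j).down[k]? (t i).down[k]?}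

/-- The crystal `SST(ν)`, with its usual `𝔩`-crystal structure (the columns are read from right to
left) and `φ_n = -∞`. -/
noncomputable def vermaTailCrystal (g : ClType) (μ : Fin n → ℕ) : Crystal g n (vermaTailSet μ) :=
  ((colLevi g n).tpow (numCols μ)).levi.restrict (vermaTailSet μ)

/-- The crystal `𝐕^𝔤_λ`: a pair `(V_2, V_1) ∈ SST(ν) × 𝐕^𝔤` is identified with
`V_1 ⊗ V_2` and stored as `(V_1, V_2)`.  (It depends on `λ` only through `μ`.) -/
noncomputable def vermaCrystal (g : ClType) (μ : Fin n → ℕ) :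
    Crystal g n (vermaBodySet g n × vermaTailSet μ) :=
  (vermaBodyCrystal g n).tensor (vermaTailCrystal g μ)

end Verma

/-! ### The separation algorithm and the map `Θ_λ` -/

section Separation

variable {n : ℕ}

/-- The columns of `𝐓 = (T_ℓ, …, T_1)` or `(T_ℓ, …, T_1, T_0)`: the column with index `2i` is `T_i^L`, that
with index `2i - 1` is `T_i^R` (`1 ≤ i ≤ ℓ`), and that with index `0` is `T_0`. -/
def columnsOf (T₀ : Col n) {ℓ : ℕ} (T : Fin ℓ → Col n × Col n) : ℕ → Col n
  | 0 => T₀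
  | m + 1 => if h : m / 2 < ℓ then (if m % 2 = 0 then (T ⟨m / 2, h⟩).1 else (T ⟨m / 2, h⟩).2) else ∅

/-- `ℱ_j`: apply `ℱ` to the columns with indices `j + 1` (left) and `j` (right). -/
def jdtFAt (j : ℕ) (c : ℕ → Col n) : Option (ℕ → Col n) :=
  (jdtF (c j, c (j + 1))).map fun S => Function.update (Function.update c j S.1) (j + 1) S.2

/-- `ℱ_j^m`. -/
def jdtFAtPow (j m : ℕ) (c : ℕ → Col n) : Option (ℕ → Col n) :=
  (fun o : Option (ℕ → Col n) => o.bind (jdtFAt j))^[m] (some c)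

/-- The indices `(j, i)` of the operators `ℱ_j^{a_i}` of the separation algorithm, in the order in which
they are applied: `i = ℓ-1, …, 1`, and for each `i`, `j = 2i, 2i+1, …, ℓ+i-1`. -/
def separationSteps (ℓ : ℕ) : List (ℕ × ℕ) :=
  (List.range' 1 (ℓ - 1)).reverse.flatMap fun i => (List.range' (2 * i) (ℓ - i)).map fun j => (j, i)

/-- The columns of `\overline{𝐓}`. -/
def separate (ℓ : ℕ) (a : ℕ → ℕ) (c : ℕ → Col n) : Option (ℕ → Col n) :=
  (separationSteps ℓ).foldlM (fun d p => jdtFAtPow p.1 (a p.2) d) c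

/-- The number `b_i` of boxes above the line `L` in the column of `𝐓` with index `i`: the height of
`T_j^R` for `i = 2j-1`, and the height of `T_j^L` minus `a_j` for `i = 2j`. -/
def bodyHt (a : ℕ → ℕ) (c : ℕ → Col n) (i : ℕ) : ℕ :=
  if i % 2 = 0 then (c i).card - a (i / 2) else (c i).card

/-- The part above `L` of the column with index `i` of `\overline{𝐓}`: for `i ≤ ℓ` the whole column, and for
`i > ℓ` its `b_i` highest boxes. -/
def bodyPart (ℓ : ℕ) (a : ℕ → ℕ) (c d : ℕ → Col n) (i : ℕ) : Col n :=
  if i ≤ ℓ then d i else ((d i).down.take (bodyHt a c i)).toFinset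

/-- The part below `L` of the column with index `i > ℓ` of `\overline{𝐓}`. -/
def tailPart (a : ℕ → ℕ) (c d : ℕ → Col n) (i : ℕ) : Col n :=
  ((d i).down.drop (bodyHt a c i)).toFinset

open Classical in
/-- The pair `𝐓^body`, `𝐓^tail` as an element of `𝐕^𝔤_λ`, or `0` if `\overline{𝐓}` is not defined or if one of
the two is not a semistandard tableau of the right shape.  The body starts with the column of
index `s` (`s = 1` for `λ ∈ 𝒫_n`, `s = 0` for `λ ∈ 𝒫_n^sp`). -/
noncomputable def bodyTail (g : ClType) (μ : Fin n → ℕ) (s : ℕ) (c : ℕ → Col n) :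
    Option (vermaBodySet g n × vermaTailSet μ) :=
  (separate (numCols μ) (tailLen μ) c).bind fun d =>
    let body : ℕ → Col n := fun k => bodyPart (numCols μ) (tailLen μ) c d (k + s)
    let tail : Fin (numCols μ) → Col n := fun i => tailPart (tailLen μ) c d (numCols μ + i + 1)
    if h : ∃ hb : (∃ k, ∀ j, k ≤ j → body j = ∅),
        (⟨body, hb⟩ : FinSeq (Col n) ∅) ∈ vermaBodySet g n ∧ tail ∈ vermaTailSet μ then
      some (⟨⟨body, h.fst⟩, h.snd.1⟩, ⟨tail, h.snd.2⟩)
    else none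

/-- The map `Θ_λ : 𝐓 ↦ (𝐓^tail, 𝐓^body) ⊗ t_{rω_n}` for `λ = μ ∈ 𝒫_n`. -/
noncomputable def thetaMap (g : ClType) (μ : Fin n → ℕ) (T : spinorSet g μ) :
    Option ((vermaBodySet g n × vermaTailSet μ) × Unit) :=
  (bodyTail g μ 1 (columnsOf ∅ T.1)).map fun V => (V, ())

/-- The map `Θ_λ : 𝐓 ↦ (𝐓^tail, 𝐓^body) ⊗ t_{rω_n}` for `λ = μ + (1/2, …, 1/2) ∈ 𝒫_n^sp`. -/
noncomputable def thetaSpinMap (μ : Fin n → ℕ) (T : spinorSpinSet μ) :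
    Option ((vermaBodySet .b n × vermaTailSet μ) × Unit) :=
  (bodyTail .b μ 0 (columnsOf T.1.1 T.1.2)).map fun V => (V, ())

/-- The integer `r` for `λ = μ ∈ 𝒫_n`: `r = λ_1` in type `C_n` and `r = 2λ_1` in type `B_n`. -/
def twist (g : ClType) (μ : Fin n → ℕ) : ℕ :=
  match g with
  | .b => 2 * numCols μ
  | .c => numCols μ

end Separation

/-! A column U is encoded by its counting function t ↦ `cnt U t`, the number of its letters among
the t largest ones. Row inequalities between neighbouring columns become inequalities between
counting functions. For a pair of columns with difference D = `colDiff` (left minus right), jeu de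
taquin becomes a signature rule: ℱ moves to the left the letter at the last maximum of D, and ℰ
moves to the right the letter just before the first maximum (`jdtF_eq_some_iff`, `jdtE_some`). Hence
the letters moved by ℱ^a have the counting function t ↦ min(a, min_{s ≥ t} (max D - D(s))), which
`MovedBy` records by inequalities.

Let G_i count the letters moved by ℰ^{a_i} in T_i. Membership in 𝐓_λ then yields the inequalities
`SepData`. Each block of the separation algorithm preserves the inequalities `SepInv`
(`SepInv.chain`), so that no ℱ_j ever fails. At the end, the columns without their tails have
decreasing counting functions, and the tails form a tableau of shape ν (`separate_exists`,
`SpinorColumns.bodyTail_eq`).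

Injectivity and the vertices i < n: each ℱ_j is injective and compatible with the 𝔩-crystal
structure on sequences of columns (`FStep.injective`, `FStep.pair_comm`, `LeviCompat`). Cutting off
the tails can also be written with operators ℱ_j. After adjoining ℓ empty columns, ℱ^{a_k}
repeatedly applied carries exactly the k-th tail to the left across the body
(`Separated.chains_finish`). So the body followed by the tail, as one sequence, is the image of 𝐓
padded with empty columns under a composition of operators ℱ_j (`flattenColumns`).

The vertex n: the signature rule is read off from the path `colPath`, which goes up at a column
containing n̄ and down at the others. Its maximum is ε_n, and ẽ_n acts at the step leading to the
first maximum. Separation and cutting only lower the path, and never at the first maximum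
(`IsChainMove.keepsFirstMax`, `SpinorColumns.keepsFirstMax_body`), so ε_n and the column acted upon
are the same for 𝐓 and for its body. Moreover the displacements depend only on the letters other
than n̄ (`separate_cnt_eq`), so removing n̄ from a column of 𝐓 removes it from the same column of
the body and leaves the tail alone (`body_of_erase`). In type C_n the domino path is half of
`colPath` at even positions, with the same first maximum (`firstMax_domino_iff`). Everything meets
in `isEmbedding_of_columns`. -/

/-! ### Counting functions of columns -/

section Counting

variable {n : ℕ}

/-- The position of the letter `j̄` from the end of the alphabet. -/
def letterIdx (x : Letter n) : ℕ := (OrderDual.ofDual x).1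

theorem letterIdx_lt (x : Letter n) : letterIdx x < n := (OrderDual.ofDual x).2

theorem letterIdx_bar (j : Fin n) : letterIdx (bar j) = j.1 := rfl

theorem letterIdx_le_iff (x y : Letter n) : letterIdx x ≤ letterIdx y ↔ y ≤ x := Iff.rfl

theorem letterIdx_lt_iff (x y : Letter n) : letterIdx x < letterIdx y ↔ y < x := Iff.rfl

theorem letterIdx_inj {x y : Letter n} (h : letterIdx x = letterIdx y) : x = y :=
  OrderDual.ofDual.injective (Fin.ext h)

namespace Col

/-- The number of letters of `U` among the `t` largest letters. -/
def cnt (U : Col n) (t : ℕ) : ℤ := ((U.filter fun x => letterIdx x < t).card : ℤ)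

/-- The indicator of the letter in position `t`. -/
def has (U : Col n) (t : ℕ) : ℤ := if ∃ x ∈ U, letterIdx x = t then 1 else 0

theorem has_letterIdx (U : Col n) (x : Letter n) : has U (letterIdx x) = if x ∈ U then 1 else 0 := by
  unfold has
  congr 1
  simp only [eq_iff_iff]
  constructor
  · rintro ⟨y, hy, h⟩
    rwa [← letterIdx_inj h]
  · exact fun h => ⟨x, h, rfl⟩

theorem has_fin (U : Col n) (j : Fin n) : has U j.1 = if bar j ∈ U then 1 else 0 :=
  has_letterIdx U (bar j)

theorem has_nonneg (U : Col n) (t : ℕ) : 0 ≤ has U t := by unfold has; split_ifs <;> norm_num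

theorem has_le_one (U : Col n) (t : ℕ) : has U t ≤ 1 := by unfold has; split_ifs <;> norm_num

theorem has_of_ge (U : Col n) (t : ℕ) (h : n ≤ t) : has U t = 0 := by
  unfold has
  rw [if_neg]
  rintro ⟨x, -, rfl⟩
  exact absurd (letterIdx_lt x) (by omega)

@[simp] theorem cnt_zero (U : Col n) : cnt U 0 = 0 := by simp [cnt]

theorem cnt_succ (U : Col n) (t : ℕ) : cnt U (t + 1) = cnt U t + has U t := by
  unfold cnt has
  by_cases h : ∃ x ∈ U, letterIdx x = t
  · obtain ⟨x, hx, rfl⟩ := h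
    have : (U.filter fun y => letterIdx y < letterIdx x + 1) =
        insert x (U.filter fun y => letterIdx y < letterIdx x) := by
      ext y
      simp only [Finset.mem_filter, Finset.mem_insert]
      constructor
      · rintro ⟨h1, h2⟩
        rcases Nat.lt_succ_iff_lt_or_eq.1 h2 with h3 | h3
        · exact Or.inr ⟨h1, h3⟩
        · exact Or.inl (letterIdx_inj h3)
      · rintro (rfl | ⟨h1, h2⟩)
        · exact ⟨hx, by omega⟩
        · exact ⟨h1, by omega⟩
    rw [this, Finset.card_insert_of_notMem (by simp), if_pos ⟨x, hx, rfl⟩]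
    push_cast; ring
  · rw [if_neg h, add_zero]
    congr 2
    ext y
    simp only [Finset.mem_filter]
    constructor
    · rintro ⟨h1, h2⟩
      exact ⟨h1, lt_of_le_of_ne (by omega) fun h3 => h ⟨y, h1, h3⟩⟩
    · rintro ⟨h1, h2⟩
      exact ⟨h1, by omega⟩

theorem cnt_mono (U : Col n) : Monotone (cnt U) :=
  monotone_nat_of_le_succ fun t => by rw [cnt_succ]; linarith [has_nonneg U t]

theorem cnt_nonneg (U : Col n) (t : ℕ) : 0 ≤ cnt U t := by unfold cnt; positivity

theorem cnt_of_ge (U : Col n) (t : ℕ) (h : n ≤ t) : cnt U t = U.card := by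
  unfold cnt
  rw [Finset.filter_true_of_mem]
  intro x _
  exact lt_of_lt_of_le (letterIdx_lt x) h

theorem cnt_le_card (U : Col n) (t : ℕ) : cnt U t ≤ U.card := by
  unfold cnt
  exact_mod_cast Finset.card_filter_le _ _

theorem cnt_inj {U V : Col n} (h : ∀ t, cnt U t = cnt V t) : U = V := by
  ext x
  have h1 := cnt_succ U (letterIdx x)
  have h2 := cnt_succ V (letterIdx x)
  rw [h, h, h2, has_letterIdx, has_letterIdx] at h1
  by_cases hU : x ∈ U <;> by_cases hV : x ∈ V <;> simp [hU, hV] at h1 ⊢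

@[simp] theorem cnt_empty (t : ℕ) : cnt (∅ : Col n) t = 0 := by simp [cnt]

theorem cnt_insert (U : Col n) (x : Letter n) (h : x ∉ U) (t : ℕ) :
    cnt (insert x U) t = cnt U t + if letterIdx x < t then 1 else 0 := by
  unfold cnt
  rw [Finset.filter_insert]
  split_ifs with h1
  · rw [Finset.card_insert_of_notMem (by simp [h])]; push_cast; ring
  · ring

theorem cnt_erase (U : Col n) (x : Letter n) (h : x ∈ U) (t : ℕ) :
    cnt (U.erase x) t = cnt U t - if letterIdx x < t then 1 else 0 := by
  have := cnt_insert (U.erase x) x (Finset.notMem_erase x U) t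
  rw [Finset.insert_erase h] at this
  linarith

/-- In a strictly decreasing list the entries before x are exactly those larger than x, that is, of
smaller index. This is the dictionary between positions of boxes and counting functions. -/
theorem getElem?_of_pairwise (l : List (Letter n)) (h : l.Pairwise (· > ·)) (p : ℕ) (x : Letter n) :
    l[p]? = some x ↔ x ∈ l ∧ l.countP (fun y => letterIdx y < letterIdx x) = p := by
  induction l generalizing p with
  | nil => simp
  | cons a l ih =>
    rw [List.pairwise_cons] at h
    have ha : a ∉ l := fun ha => lt_irrefl a (h.1 a ha)
    rcases p with _ | p
    · simp only [List.getElem?_cons_zero, Option.some.injEq, List.mem_cons]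
      constructor
      · rintro rfl
        refine ⟨Or.inl rfl, ?_⟩
        rw [List.countP_eq_zero]
        intro y hy
        simp only [decide_eq_true_eq, not_lt, letterIdx_le_iff]
        rcases List.mem_cons.1 hy with rfl | hy
        · exact le_rfl
        · exact (h.1 y hy).le
      · rintro ⟨rfl | hx, h2⟩
        · rfl
        · rw [List.countP_eq_zero] at h2
          have := h2 a (by simp)
          simp only [decide_eq_true_eq, not_lt, letterIdx_le_iff] at this
          exact absurd (h.1 x hx) (not_lt.2 this)
    · rw [List.getElem?_cons_succ, ih h.2, List.mem_cons, List.countP_cons]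
      constructor
      · rintro ⟨h1, h2⟩
        have : letterIdx a < letterIdx x := (letterIdx_lt_iff _ _).2 (h.1 x h1)
        simp [h1, h2, this]
      · rintro ⟨rfl | h1, h2⟩
        · exfalso
          simp only [lt_self_iff_false, decide_false, Bool.false_eq_true, if_false, add_zero] at h2
          have : l.countP (fun y => letterIdx y < letterIdx x) = 0 := by
            rw [List.countP_eq_zero]
            intro y hy
            simp only [decide_eq_true_eq, not_lt, letterIdx_le_iff]
            exact (h.1 y hy).le
          omega
        · have : letterIdx a < letterIdx x := (letterIdx_lt_iff _ _).2 (h.1 x h1)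
          simp only [this, decide_true, if_true] at h2
          exact ⟨h1, by omega⟩

theorem countP_of_nodup (l : List (Letter n)) (hl : l.Nodup) (U : Col n) (h : ∀ x, x ∈ l ↔ x ∈ U)
    (t : ℕ) : (l.countP (fun y => letterIdx y < t) : ℤ) = cnt U t := by
  unfold cnt
  have : U = l.toFinset := by ext x; simp [h]
  rw [this, List.countP_eq_length_filter, ← List.toFinset_card_of_nodup (hl.filter _),
    List.toFinset_filter]
  simp

theorem up_getElem? (U : Col n) (p : ℕ) (x : Letter n) :
    U.up[p]? = some x ↔ x ∈ U ∧ cnt U (letterIdx x) = p := by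
  have h1 : U.up.Pairwise (· > ·) := (Finset.sortedGT_sort U).pairwise
  rw [getElem?_of_pairwise _ h1, ← countP_of_nodup U.up (Finset.sort_nodup _ _) U
    (fun x => Finset.mem_sort _)]
  simp [up]

theorem length_up (U : Col n) : U.up.length = U.card := Finset.length_sort _

theorem length_down (U : Col n) : U.down.length = U.card := Finset.length_sort _

theorem down_eq (U : Col n) : U.down = U.up.reverse := by
  unfold down up
  exact (List.Perm.eq_of_pairwise' (r := (· ≤ ·)) (List.pairwise_reverse.2 (Finset.pairwise_sort U (· ≥ ·)))
    (Finset.pairwise_sort U (· ≤ ·)) ((List.reverse_perm _).trans ((Finset.sort_perm_toList _ _).trans (Finset.sort_perm_toList _ _).symm))).symm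

theorem down_getElem? (U : Col n) (p : ℕ) (x : Letter n) :
    U.down[p]? = some x ↔ x ∈ U ∧ cnt U (letterIdx x + 1) + p = U.card := by
  have h : ∀ hx : x ∈ U, cnt U (letterIdx x + 1) = cnt U (letterIdx x) + 1 := by
    intro hx; rw [cnt_succ, has_letterIdx, if_pos hx]
  rw [down_eq]
  by_cases hp : p < U.card
  · rw [List.getElem?_reverse (by rwa [length_up]), up_getElem?, length_up]
    constructor
    · rintro ⟨h1, h2⟩
      refine ⟨h1, ?_⟩
      rw [h h1, h2]; omega
    · rintro ⟨h1, h2⟩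
      refine ⟨h1, ?_⟩
      rw [h h1] at h2; omega
  · rw [List.getElem?_eq_none (by rw [List.length_reverse, length_up]; omega)]
    simp only [reduceCtorEq, false_iff, not_and]
    intro h1 h2
    rw [h h1] at h2
    have := cnt_nonneg U (letterIdx x)
    omega

theorem exists_up (U : Col n) (p t : ℕ) (h : (p : ℤ) < cnt U t) :
    ∃ x, U.up[p]? = some x ∧ letterIdx x < t := by
  have h1 : p < U.up.length := by
    rw [length_up]; have := cnt_le_card U t; omega
  refine ⟨U.up[p], List.getElem?_eq_getElem h1, ?_⟩
  have h2 := ((up_getElem? U p _).1 (List.getElem?_eq_getElem h1)).2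
  by_contra h3
  have := cnt_mono U (not_lt.1 h3)
  omega

theorem exists_down (U : Col n) (p t : ℕ) (h : cnt U t + p < U.card) :
    ∃ x, U.down[p]? = some x ∧ t ≤ letterIdx x := by
  have h1 : p < U.down.length := by
    rw [length_down]; have := cnt_nonneg U t; omega
  refine ⟨U.down[p], List.getElem?_eq_getElem h1, ?_⟩
  have h2 := ((down_getElem? U p _).1 (List.getElem?_eq_getElem h1)).2
  by_contra h3
  have := cnt_mono U (show letterIdx (U.down[p]) + 1 ≤ t by omega)
  omega

theorem cnt_succ_of_mem (U : Col n) (x : Letter n) (h : x ∈ U) :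
    cnt U (letterIdx x + 1) = cnt U (letterIdx x) + 1 := by
  rw [cnt_succ, has_letterIdx, if_pos h]

theorem cnt_succ_of_notMem (U : Col n) (x : Letter n) (h : x ∉ U) :
    cnt U (letterIdx x + 1) = cnt U (letterIdx x) := by
  rw [cnt_succ, has_letterIdx, if_neg h, add_zero]

end Col

/-! ### Semistandardness and overlaps as inequalities between counting functions. -/

open Col

/-- If the inequality fails at t, the box of U in position `cnt U t - 1` from the bottom faces a box
of V that is too small. The bound on heights guarantees that this facing box exists; without it the
comparison of entries would be void there. -/
theorem entryLE_up_iff (U V : Col n) (d : ℕ) (h : U.card ≤ V.card + d) :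
    (∀ i : ℕ, EntryLE U.up[i + d]? V.up[i]?) ↔ ∀ t, cnt U t ≤ cnt V t + d := by
  constructor
  · intro H t
    by_contra hc
    obtain ⟨p, hp⟩ : ∃ p : ℕ, (p : ℤ) = cnt U t - d - 1 :=
      ⟨(cnt U t - d - 1).toNat, by have := cnt_nonneg V t; omega⟩
    obtain ⟨x, hx, hxt⟩ := exists_up U (p + d) t (by push_cast; omega)
    have := cnt_le_card U t
    have h4 : p < V.up.length := by rw [length_up]; omega
    have h1 := H p x hx _ (List.getElem?_eq_getElem h4)
    have h2 := (up_getElem? V p _).1 (List.getElem?_eq_getElem h4)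
    rw [← letterIdx_le_iff] at h1
    have h3 := cnt_succ_of_mem V _ h2.1
    have := cnt_mono V (show letterIdx V.up[p] + 1 ≤ t by omega)
    omega
  · intro H i a ha b hb
    have h1 := (up_getElem? U _ _).1 ha
    have h2 := (up_getElem? V _ _).1 hb
    rw [← letterIdx_le_iff]
    by_contra hc
    have h3 := cnt_succ_of_mem U a h1.1
    have h4 := cnt_mono V (show letterIdx a + 1 ≤ letterIdx b by omega)
    have := H (letterIdx a + 1)
    have h5 := h1.2
    push_cast at h5
    omega

/-- The version for columns aligned at the top: positions from the top are counted by the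
complements card - `cnt`. It serves for the tails. -/
theorem entryLE_down (U V : Col n)
    (H : ∀ t, cnt U t + V.card ≤ cnt V t + U.card) (i : ℕ) : EntryLE U.down[i]? V.down[i]? := by
  intro a ha b hb
  have h1 := (down_getElem? U _ _).1 ha
  have h2 := (down_getElem? V _ _).1 hb
  rw [← letterIdx_le_iff]
  by_contra hc
  have h3 := cnt_succ_of_mem V b h2.1
  have h4 := cnt_mono V (show letterIdx a + 1 ≤ letterIdx b by omega)
  have := H (letterIdx a + 1)
  omega

theorem overlap_iff (U V : Col n) (k : ℕ) : Overlap U V k ↔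
    k ≤ U.card ∧ k ≤ V.card ∧ ∀ t, cnt U t + k ≤ cnt V t + U.card := by
  unfold Overlap
  refine and_congr_right fun h1 => and_congr_right fun h2 => ?_
  rw [show (∀ t, cnt U t + k ≤ cnt V t + U.card) ↔ ∀ t, cnt U t ≤ cnt V t + (U.card - k : ℕ) from
    forall_congr' fun t => by omega, ← entryLE_up_iff U V _ (by omega)]
  constructor
  · intro h i
    by_cases hi : i < k
    · have := h i hi
      rwa [add_comm] at this
    · rw [List.getElem?_eq_none (by rw [length_up]; omega)]
      intro a ha; simp at ha
  · intro h j _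
    rw [add_comm]; exact h j

/-- The difference of the counting functions of the two columns `T = (T^R, T^L)`. -/
def colDiff (T : Col n × Col n) (t : ℕ) : ℤ := cnt T.2 t - cnt T.1 t

theorem colDiff_zero (T : Col n × Col n) : colDiff T 0 = 0 := by simp [colDiff]

theorem colDiff_of_ge (T : Col n × Col n) (t : ℕ) (h : n ≤ t) : colDiff T t = T.2.card - T.1.card := by
  simp [colDiff, cnt_of_ge _ t h]

/-- `m` is the maximum of the function `D`. -/
def IsMaxVal (D : ℕ → ℤ) (m : ℤ) : Prop := (∀ t, D t ≤ m) ∧ ∃ t, D t = m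

theorem exists_isMaxVal (T : Col n × Col n) : ∃ m, IsMaxVal (colDiff T) m := by
  obtain ⟨t, ht, h⟩ := Finset.exists_max_image (Finset.range (n + 1)) (colDiff T) ⟨0, by simp⟩
  refine ⟨colDiff T t, fun s => ?_, t, rfl⟩
  by_cases hs : s ≤ n
  · exact h s (by simp; omega)
  · rw [colDiff_of_ge T s (by omega), ← colDiff_of_ge T n le_rfl]
    exact h n (by simp)

/-- By `overlap_iff`, an overlap by k rows means `colDiff` ≤ card U - k everywhere, so the largest k
is governed by the maximum m. The values of `colDiff` at 0 and at n bound m from below and make this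
k compatible with both heights. Thus m is the number of boxes of the left column below the right
one. -/
theorem overlap_eq (U V : Col n) (m : ℤ) (h : IsMaxVal (colDiff (V, U)) m) :
    (overlap U V : ℤ) = U.card - m := by
  obtain ⟨h1, s, h2⟩ := h
  have h0 := h1 0
  have hn := h1 n
  rw [colDiff_zero] at h0
  rw [colDiff_of_ge _ n le_rfl] at hn
  simp only [colDiff] at h1 h2 hn
  have hs1 := cnt_le_card U s
  have hs2 := cnt_nonneg V s
  obtain ⟨k, hk⟩ : ∃ k : ℕ, (k : ℤ) = U.card - m := ⟨(U.card - m).toNat, by omega⟩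
  have hO : Overlap U V k := by
    rw [overlap_iff]
    refine ⟨by omega, by omega, fun t => ?_⟩
    have := h1 t; omega
  have hle : k ≤ overlap U V := Nat.le_findGreatest (by omega) hO
  have hsp : Overlap U V (overlap U V) := Nat.findGreatest_spec (P := Overlap U V) (m := k) (by omega) hO
  rw [overlap_iff] at hsp
  have := hsp.2.2 s
  omega

end Counting

/-! ### Jeu de taquin in terms of counting functions -/

section JeuDeTaquin

variable {n : ℕ}

open Col

/-- Unfolds the recursion: the hole goes down p rows in the left column, past p weakly increasing
rows, and is stopped by the first row that is not weakly increasing, or at the end of the left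
column. -/
theorem slideLeft_some (xs ys : List (Letter n)) (y : Letter n) (h : slideLeft xs ys = some y) :
    ∃ p : ℕ, ys[p]? = some y ∧
      (∀ q < p, ∃ x y', xs[q]? = some x ∧ ys[q]? = some y' ∧ x ≤ y') ∧
      ∀ x, xs[p]? = some x → ¬ x ≤ y := by
  induction ys generalizing xs with
  | nil => cases xs <;> simp [slideLeft] at h
  | cons b ys ih =>
    cases xs with
    | nil =>
      simp only [slideLeft, Option.some.injEq] at h
      exact ⟨0, by simp [h], by simp, by simp⟩
    | cons a xs =>
      simp only [slideLeft] at h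
      split_ifs at h with hab
      · obtain ⟨p, h1, h2, h3⟩ := ih xs h
        refine ⟨p + 1, by simpa using h1, fun q hq => ?_, by simpa using h3⟩
        rcases q with _ | q
        · exact ⟨a, b, rfl, rfl, hab⟩
        · simpa using h2 q (by omega)
      · obtain rfl := Option.some.inj h
        exact ⟨0, rfl, by simp, by simpa using hab⟩

theorem slideLeft_none (xs ys : List (Letter n)) (h : slideLeft xs ys = none) :
    ∀ q < ys.length, ∃ x y', xs[q]? = some x ∧ ys[q]? = some y' ∧ x ≤ y' := by
  induction ys generalizing xs with
  | nil => simp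
  | cons b ys ih =>
    cases xs with
    | nil => simp [slideLeft] at h
    | cons a xs =>
      simp only [slideLeft] at h
      split_ifs at h with hab
      intro q hq
      rcases q with _ | q
      · exact ⟨a, b, rfl, rfl, hab⟩
      · simpa using ih xs h q (by simpa using hq)

theorem slideRight_some (xs ys : List (Letter n)) (x : Letter n) (h : slideRight xs ys = some x) :
    ∃ p : ℕ, xs[p]? = some x ∧
      (∀ q < p, ∃ x' y, xs[q]? = some x' ∧ ys[q]? = some y ∧ x' ≤ y) ∧
      ∀ y, ys[p]? = some y → ¬ x ≤ y := by
  induction xs generalizing ys with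
  | nil => cases ys <;> simp [slideRight] at h
  | cons a xs ih =>
    cases ys with
    | nil =>
      simp only [slideRight, Option.some.injEq] at h
      exact ⟨0, by simp [h], by simp, by simp⟩
    | cons b ys =>
      simp only [slideRight] at h
      split_ifs at h with hab
      · obtain ⟨p, h1, h2, h3⟩ := ih ys h
        refine ⟨p + 1, by simpa using h1, fun q hq => ?_, by simpa using h3⟩
        rcases q with _ | q
        · exact ⟨a, b, rfl, rfl, hab⟩
        · simpa using h2 q (by omega)
      · obtain rfl := Option.some.inj h
        exact ⟨0, rfl, by simp, by simpa using hab⟩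

/-- `S` is obtained from `T` by moving to the left column the letter at the last maximum of
`colDiff T`. -/
def FStep (T S : Col n × Col n) : Prop :=
  ∃ x, x ∈ T.1 ∧ x ∉ T.2 ∧ S = (T.1.erase x, insert x T.2) ∧
    (∀ t, colDiff T t ≤ colDiff T (letterIdx x)) ∧
    ∀ t, letterIdx x < t → colDiff T t < colDiff T (letterIdx x)

/-- `S` is obtained from `T` by moving to the right column the letter just before the first maximum
of `colDiff T`. -/
def EStep (T S : Col n × Col n) : Prop :=
  ∃ x, x ∈ T.2 ∧ x ∉ T.1 ∧ S = (insert x T.1, T.2.erase x) ∧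
    (∀ t, colDiff T t ≤ colDiff T (letterIdx x + 1)) ∧
    ∀ t, t ≤ letterIdx x → colDiff T t < colDiff T (letterIdx x + 1)

theorem FStep.unique {T S S' : Col n × Col n} (h : FStep T S) (h' : FStep T S') : S = S' := by
  obtain ⟨x, -, -, rfl, h1, h2⟩ := h
  obtain ⟨y, -, -, rfl, h3, h4⟩ := h'
  have : x = y := by
    apply letterIdx_inj
    rcases lt_trichotomy (letterIdx x) (letterIdx y) with h | h | h
    · exact absurd (h2 _ h) (not_lt.2 (h3 _))
    · exact h
    · exact absurd (h4 _ h) (not_lt.2 (h1 _))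
  rw [this]

/-- After the move D is raised by 2 strictly after the moved letter x, where it was below its
maximum. Its maximum therefore grows by 1 and is attained for the first time just after x, so x can
be recovered from the result. -/
theorem FStep.injective {T T' S : Col n × Col n} (h : FStep T S) (h' : FStep T' S) : T = T' := by
  obtain ⟨x, hx1, hx2, rfl, h1, h2⟩ := h
  obtain ⟨y, hy1, hy2, hS, h3, h4⟩ := h'
  rw [Prod.mk.injEq] at hS
  have key : ∀ (T : Col n × Col n) (x : Letter n), x ∈ T.1 → x ∉ T.2 → ∀ t,
      colDiff (T.1.erase x, insert x T.2) t = colDiff T t + if letterIdx x < t then 2 else 0 := by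
    intro T x h1 h2 t
    unfold colDiff
    rw [cnt_insert _ _ h2, cnt_erase _ _ h1]
    split_ifs <;> ring
  have hk : ∀ t, (colDiff T t + if letterIdx x < t then 2 else 0) =
      (colDiff T' t + if letterIdx y < t then 2 else 0) := by
    intro t
    rw [← key T x hx1 hx2, ← key T' y hy1 hy2, hS.1, hS.2]
  have succ : ∀ (T : Col n × Col n) (x : Letter n), x ∈ T.1 → x ∉ T.2 →
      colDiff T (letterIdx x + 1) = colDiff T (letterIdx x) - 1 := by
    intro T x h1 h2
    unfold colDiff
    rw [cnt_succ_of_mem _ _ h1, cnt_succ_of_notMem _ _ h2]; ring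
  have hxy : x = y := by
    apply letterIdx_inj
    have e1 := succ T x hx1 hx2
    have e2 := succ T' y hy1 hy2
    have k1 := hk (letterIdx x + 1)
    have k2 := hk (letterIdx y + 1)
    have a1 := h1 (letterIdx y + 1)
    have a2 := h3 (letterIdx x + 1)
    have b1 := h1 (letterIdx y)
    have b2 := h3 (letterIdx x)
    have k3 := hk (letterIdx x)
    have k4 := hk (letterIdx y)
    rcases lt_trichotomy (letterIdx x) (letterIdx y) with h | h | h
    · have := h2 _ h
      have := h2 (letterIdx y + 1) (by omega)
      split_ifs at k1 k2 k3 k4 <;> omega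
    · exact h
    · have := h4 _ h
      have := h4 (letterIdx x + 1) (by omega)
      split_ifs at k1 k2 k3 k4 <;> omega
  subst hxy
  apply Prod.ext
  · rw [← Finset.insert_erase hx1, hS.1, Finset.insert_erase hy1]
  · rw [← Finset.erase_insert hx2, hS.2, Finset.erase_insert hy2]

/-- With b the excess of the right column at the top, the conclusion says that `colDiff T t` is
below its maximum. The p rows passed by the hole are weakly increasing, and this forbids the maximum
at every t with fewer than b + p letters of the right column of index at least t. -/
theorem jdtF_aux (T : Col n × Col n) (b p t : ℕ) (hb : 0 < b) (ht : (T.1.card : ℤ) - cnt T.1 t < b + p)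
    (h : ∀ q < p, ∃ x y', T.2.down[q]? = some x ∧ (T.1.down.drop (b - 1))[q]? = some y' ∧ x ≤ y') :
    (T.1.card : ℤ) - cnt T.1 t < b + (T.2.card - cnt T.2 t) := by
  by_contra hc
  have hL := cnt_le_card T.2 t
  obtain ⟨q, hq⟩ : ∃ q : ℕ, (q : ℤ) = T.1.card - cnt T.1 t - b :=
    ⟨(T.1.card - cnt T.1 t - b).toNat, by omega⟩
  obtain ⟨x, y, hx, hy, hxy⟩ := h q (by omega)
  rw [List.getElem?_drop] at hy
  have h1 := (down_getElem? _ _ _).1 hx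
  have h2 := (down_getElem? _ _ _).1 hy
  rw [← letterIdx_le_iff] at hxy
  have h3 := h2.2
  have hyt : t ≤ letterIdx y := by
    by_contra hlt
    have := cnt_mono T.1 (show letterIdx y + 1 ≤ t by omega)
    omega
  have h4 := cnt_mono T.2 (show t ≤ letterIdx x by omega)
  have h5 := cnt_succ_of_mem _ _ h1.1
  omega

theorem jdtF_some {T S : Col n × Col n} (h : jdtF T = some S) : FStep T S := by
  obtain ⟨m, hm⟩ := exists_isMaxVal T
  have hov := overlap_eq T.2 T.1 m hm
  have hn := hm.1 n
  rw [colDiff_of_ge _ n le_rfl] at hn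
  unfold jdtF at h
  set b := T.1.card - overlap T.2 T.1 with hbdef
  have hb' : (b : ℤ) = m - (T.2.card - T.1.card) := by omega
  simp only at h
  split_ifs at h with hb
  obtain ⟨y, hy, rfl⟩ := Option.map_eq_some_iff.1 h
  obtain ⟨p, h1, h2, h3⟩ := slideLeft_some _ _ _ hy
  rw [List.getElem?_drop] at h1
  have h4 := (down_getElem? _ _ _).1 h1
  have h4' := h4.2
  have hs := cnt_succ_of_mem _ _ h4.1
  -- The rows that the hole has passed exclude a maximum after y; the row that stops it forces one
  -- at y.
  have haux : ∀ t, letterIdx y < t → colDiff T t < m := by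
    intro t ht
    have hmono := cnt_mono T.1 (show letterIdx y + 1 ≤ t by omega)
    have := jdtF_aux T b p t (by omega) (by omega) h2
    unfold colDiff
    omega
  -- the number of letters of the left column which are at most `y`
  have hle : (T.2.card : ℤ) - cnt T.2 (letterIdx y) ≤ p := by
    by_contra hc
    obtain ⟨x, hx, hxy⟩ := exists_down T.2 p (letterIdx y) (by omega)
    exact h3 x hx ((letterIdx_le_iff _ _).1 hxy)
  have hge : m ≤ colDiff T (letterIdx y) := by unfold colDiff; omega
  have heq : colDiff T (letterIdx y) = m := le_antisymm (hm.1 _) hge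
  refine ⟨y, h4.1, fun hmem => ?_, rfl, fun t => heq ▸ hm.1 t, fun t ht => heq ▸ haux t ht⟩
  have h5 := haux _ (Nat.lt_succ_self _)
  rw [← heq] at h5
  unfold colDiff at h5
  rw [Nat.succ_eq_add_one, hs, cnt_succ_of_mem _ _ hmem] at h5
  omega

/-- If D exceeds its final value somewhere, the right column sticks out at the top. Were the slide
to find no letter, all the remaining rows would be weakly increasing, and `jdtF_aux` would exclude a
maximum of D everywhere. -/
theorem jdtF_ne_none {T : Col n × Col n} (t : ℕ) (h : colDiff T n < colDiff T t) : jdtF T ≠ none := by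
  intro hnone
  obtain ⟨m, hm⟩ := exists_isMaxVal T
  have hov := overlap_eq T.2 T.1 m hm
  have hn := hm.1 n
  have ht := hm.1 t
  rw [colDiff_of_ge _ n le_rfl] at hn h
  unfold jdtF at hnone
  set b := T.1.card - overlap T.2 T.1 with hbdef
  have hb' : (b : ℤ) = m - (T.2.card - T.1.card) := by omega
  simp only at hnone
  split_ifs at hnone with hb
  · omega
  · rw [Option.map_eq_none_iff] at hnone
    have h1 := slideLeft_none _ _ hnone
    rw [List.length_drop, length_down] at h1
    obtain ⟨s, hs⟩ := hm.2
    have hnn := cnt_nonneg T.1 s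
    have := jdtF_aux T b (T.1.card - (b - 1)) s (by omega) (by omega) h1
    unfold colDiff at hs
    omega

theorem jdtF_eq_some_iff {T S : Col n × Col n} : jdtF T = some S ↔ FStep T S := by
  refine ⟨jdtF_some, fun h => ?_⟩
  obtain ⟨x, -, -, -, -, h2⟩ := id h
  have := jdtF_ne_none (T := T) (letterIdx x) (h2 n (letterIdx_lt x))
  cases hS : jdtF T with
  | none => exact absurd hS this
  | some S' => rw [(jdtF_some hS).unique h]

/-- The mirror image of `jdtF_some`: the rows passed by the hole keep D below its maximum up to x,
and the stop forces a maximum just after x. Only this implication is needed, since the success of ℰ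
is part of the definition of admissibility. -/
theorem jdtE_some {T S : Col n × Col n} (h : jdtE T = some S) : EStep T S := by
  obtain ⟨m, hm⟩ := exists_isMaxVal T
  have hov := overlap_eq T.2 T.1 m hm
  have h0 := hm.1 0
  rw [colDiff_zero] at h0
  unfold jdtE at h
  set a := T.2.card - overlap T.2 T.1 with hadef
  have ha' : (a : ℤ) = m := by omega
  simp only at h
  split_ifs at h with ha
  obtain ⟨x, hx, rfl⟩ := Option.map_eq_some_iff.1 h
  obtain ⟨p, h1, h2, h3⟩ := slideRight_some _ _ _ hx
  rw [List.getElem?_drop] at h1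
  have h4 := (up_getElem? _ _ _).1 h1
  have h4' := h4.2
  have hs := cnt_succ_of_mem _ _ h4.1
  have hle : cnt T.1 (letterIdx x + 1) ≤ p := by
    by_contra hc
    obtain ⟨y, hy, hxy⟩ := exists_up T.1 p (letterIdx x + 1) (by omega)
    exact h3 y hy ((letterIdx_le_iff _ _).1 (by omega))
  have heq : colDiff T (letterIdx x + 1) = m := by
    refine le_antisymm (hm.1 _) ?_
    unfold colDiff; push_cast at h4'; omega
  have haux : ∀ t, t ≤ letterIdx x → colDiff T t < m := by
    intro t ht
    by_contra hc
    have hmono := cnt_mono T.2 ht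
    have hnn := cnt_nonneg T.1 t
    unfold colDiff at hc
    obtain ⟨q, hq⟩ : ∃ q : ℕ, (q : ℤ) = cnt T.1 t := ⟨(cnt T.1 t).toNat, by omega⟩
    push_cast at h4'
    obtain ⟨x', y, hx', hy, hxy⟩ := h2 q (by omega)
    rw [List.getElem?_drop] at hx'
    have h5 := (up_getElem? _ _ _).1 hx'
    have h6 := (up_getElem? _ _ _).1 hy
    have h5' := h5.2
    rw [← letterIdx_le_iff] at hxy
    push_cast at h5'
    have hlt : letterIdx x' < t := by
      by_contra hge
      have := cnt_mono T.2 (not_lt.1 hge)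
      omega
    have := cnt_succ_of_mem _ _ h6.1
    have := cnt_mono T.1 (show letterIdx y + 1 ≤ t by omega)
    omega
  refine ⟨x, h4.1, fun hmem => ?_, rfl, fun t => heq ▸ hm.1 t, fun t ht => heq ▸ haux t ht⟩
  have h5 := haux _ le_rfl
  rw [← heq] at h5
  unfold colDiff at h5
  rw [hs, cnt_succ_of_mem _ _ hmem] at h5
  omega

theorem jdtEPow_succ (a : ℕ) (T : Col n × Col n) :
    jdtEPow (a + 1) T = (jdtE T).bind (jdtEPow a) := by
  have h : ∀ a, (fun o : Option (Col n × Col n) => o.bind jdtE)^[a] none = none := by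
    intro a
    induction a with
    | zero => rfl
    | succ a ih => rw [Function.iterate_succ_apply]; exact ih
  unfold jdtEPow
  rw [Function.iterate_succ_apply]
  cases hT : jdtE T with
  | none => simp [hT, h]
  | some S => simp [hT]

/-- The counting function of the letters moved by `ℰ^a`. -/
theorem jdtEPow_some (a : ℕ) (T S : Col n × Col n) (m : ℤ) (hm : ∀ t, colDiff T t ≤ m)
    (h : jdtEPow a T = some S) :
    ∃ G : ℕ → ℤ, Monotone G ∧ (∀ t, G t ≤ a) ∧ (∀ t, n ≤ t → G t = a) ∧
      (∀ t, cnt S.1 t = cnt T.1 t + G t) ∧ (∀ t, cnt S.2 t = cnt T.2 t - G t) ∧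
      ∀ t, colDiff T t ≤ G t + (m - a) := by
  induction a generalizing T m with
  | zero =>
    obtain rfl : T = S := by simpa [jdtEPow] using h
    exact ⟨fun _ => 0, monotone_const, by simp, by simp, by simp, by simp, fun t => by
      simpa using hm t⟩
  | succ a ih =>
    rw [jdtEPow_succ, Option.bind_eq_some_iff] at h
    obtain ⟨T₁, hT₁, h⟩ := h
    obtain ⟨x, hx2, hx1, rfl, h1, h2⟩ := jdtE_some hT₁
    have e1 : ∀ t, cnt (insert x T.1) t = _ := cnt_insert T.1 x hx1
    have e2 : ∀ t, cnt (T.2.erase x) t = _ := cnt_erase T.2 x hx2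
    have hd : ∀ t, colDiff (insert x T.1, T.2.erase x) t =
        colDiff T t - if letterIdx x < t then 2 else 0 := by
      intro t
      unfold colDiff
      rw [e1, e2]
      split_ifs <;> ring
    have hs : colDiff T (letterIdx x + 1) = colDiff T (letterIdx x) + 1 := by
      unfold colDiff
      rw [cnt_succ_of_mem _ _ hx2, cnt_succ_of_notMem _ _ hx1]; ring
    set m' := colDiff T (letterIdx x + 1) with hm'
    -- The new maximum is at most m' - 1: the values after x drop by 2, and those up to x were below
    -- m' already.
    obtain ⟨G, g1, g2, g3, g4, g5, g6⟩ := ih (insert x T.1, T.2.erase x) (m' - 1) (fun t => by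
      rw [hd]
      have := h1 t
      split_ifs with ht
      · omega
      · have := h2 t (by omega); omega) h
    have hle := hm (letterIdx x + 1)
    refine ⟨fun t => G t + if letterIdx x < t then 1 else 0, ?_, ?_, ?_, ?_, ?_, ?_⟩
    · intro s t hst
      have := g1 hst
      dsimp only
      split_ifs <;> omega
    · intro t
      have := g2 t
      push_cast
      split_ifs <;> omega
    · intro t ht
      have := g3 t ht
      have := letterIdx_lt x
      push_cast
      rw [if_pos (by omega)]
      omega
    · intro t; rw [g4, e1]; ring
    · intro t; rw [g5, e2]; ring
    · intro t
      have a1 := g6 t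
      have a2 := g6 (letterIdx x)
      have a3 := h1 t
      rw [hd] at a1 a2
      rw [if_neg (lt_irrefl _)] at a2
      push_cast
      split_ifs at a1 ⊢ with ht
      · have := g1 ht.le
        omega
      · have := h2 t (by omega)
        omega

end JeuDeTaquin

/-! ### Powers of `ℱ` and their compositions -/

section Moves

variable {n : ℕ}

open Col

/-- The counting function `A` of the set of the `a` letters moved by `ℱ^a`, where `K` is the
difference of the maximum of `colDiff` and `colDiff`. -/
structure MovedBy (n a : ℕ) (K A : ℕ → ℤ) : Prop where
  mono : Monotone A
  nonneg : ∀ t, 0 ≤ A t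
  le : ∀ t, A t ≤ a
  eq : ∀ t, n ≤ t → A t = a
  upper : ∀ t, A t ≤ K t
  lower : ∀ t, A t = a ∨ ∃ s, t ≤ s ∧ K s ≤ A t

/-- The axioms determine A as t ↦ min(a, min_{s ≥ t} K s). The values of K from n on play no role
once they are at least a. This is the source of the independence of the letters n̄, because these
enter counting functions only from t = n on. -/
theorem MovedBy.le_of_eq {a : ℕ} {K K' A A' : ℕ → ℤ} (h : MovedBy n a K A) (h' : MovedBy n a K' A')
    (hK : ∀ t, t < n → K t = K' t) (hn' : ∀ t, n ≤ t → (a : ℤ) ≤ K' t) (t : ℕ) : A t ≤ A' t := by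
  rcases h'.lower t with h1 | ⟨s, hs, h1⟩
  · rw [h1]; exact h.le t
  · by_cases hsn : s < n
    · calc A t ≤ A s := h.mono hs
        _ ≤ K s := h.upper s
        _ = K' s := hK s hsn
        _ ≤ A' t := h1
    · have := hn' s (by omega)
      have := h.le t
      omega

theorem MovedBy.unique {a : ℕ} {K K' A A' : ℕ → ℤ} (h : MovedBy n a K A) (h' : MovedBy n a K' A')
    (hK : ∀ t, t < n → K t = K' t) (hn : ∀ t, n ≤ t → (a : ℤ) ≤ K t)
    (hn' : ∀ t, n ≤ t → (a : ℤ) ≤ K' t) : A = A' :=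
  funext fun t => le_antisymm (h.le_of_eq h' hK hn' t)
    (h'.le_of_eq h (fun t ht => (hK t ht).symm) hn t)

theorem jdtFAt_eq_some_iff {j : ℕ} {c d : ℕ → Col n} : jdtFAt j c = some d ↔
    FStep (c j, c (j + 1)) (d j, d (j + 1)) ∧ ∀ k, k ≠ j → k ≠ j + 1 → d k = c k := by
  unfold jdtFAt
  rw [Option.map_eq_some_iff]
  constructor
  · rintro ⟨S, hS, rfl⟩
    rw [jdtF_eq_some_iff] at hS
    refine ⟨by simpa using hS, fun k h1 h2 => by simp [h1, h2]⟩
  · rintro ⟨h1, h2⟩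
    refine ⟨_, jdtF_eq_some_iff.2 h1, ?_⟩
    funext k
    by_cases hk1 : k = j + 1
    · subst hk1; simp
    · by_cases hk : k = j
      · subst hk; simp
      · simp [hk, hk1, h2 k hk hk1]

theorem jdtFAtPow_succ (j m : ℕ) (c : ℕ → Col n) :
    jdtFAtPow j (m + 1) c = (jdtFAt j c).bind (jdtFAtPow j m) := by
  have h : ∀ m, (fun o : Option (ℕ → Col n) => o.bind (jdtFAt j))^[m] none = none := by
    intro m
    induction m with
    | zero => rfl
    | succ m ih => rw [Function.iterate_succ_apply]; exact ih
  unfold jdtFAtPow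
  rw [Function.iterate_succ_apply]
  cases hc : jdtFAt j c with
  | none => simp [hc, h]
  | some d => simp [hc]

/-- Each application of ℱ raises the maximum of `colDiff` by 1 and its final value by 2. So m
applications are possible as soon as the final value is at least m below the maximum. -/
theorem jdtFAtPow_exists (j m : ℕ) (c : ℕ → Col n) (ε : ℤ)
    (hε : IsMaxVal (colDiff (c j, c (j + 1))) ε) (hφ : colDiff (c j, c (j + 1)) n + m ≤ ε) :
    ∃ d A, jdtFAtPow j m c = some d ∧ (∀ k, k ≠ j → k ≠ j + 1 → d k = c k) ∧
      (∀ t, cnt (d j) t = cnt (c j) t - A t) ∧ (∀ t, cnt (d (j + 1)) t = cnt (c (j + 1)) t + A t) ∧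
      MovedBy n m (fun t => ε - colDiff (c j, c (j + 1)) t) A := by
  induction m generalizing c ε with
  | zero =>
    refine ⟨c, fun _ => 0, rfl, fun _ _ _ => rfl, by simp, by simp, ?_⟩
    refine ⟨monotone_const, by simp, by simp, by simp, fun t => ?_, by simp⟩
    have := hε.1 t; simpa using this
  | succ m ih =>
    obtain ⟨t₀, ht₀⟩ := hε.2
    push_cast at hφ
    obtain ⟨S, hS⟩ := Option.ne_none_iff_exists'.1
      (jdtF_ne_none (T := (c j, c (j + 1))) t₀ (by omega))
    obtain ⟨x, hx1, hx2, rfl, h1, h2⟩ := jdtF_eq_some_iff.1 hS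
    dsimp only at hx1 hx2
    have hxn := letterIdx_lt x
    have hmax : colDiff (c j, c (j + 1)) (letterIdx x) = ε :=
      le_antisymm (hε.1 _) (ht₀ ▸ h1 t₀)
    set c₁ := Function.update (Function.update c j ((c j).erase x)) (j + 1) (insert x (c (j + 1)))
      with hc₁
    have hcj : c₁ j = (c j).erase x := by simp [hc₁]
    have hcj1 : c₁ (j + 1) = insert x (c (j + 1)) := by simp [hc₁]
    have hstep : jdtFAt j c = some c₁ := by
      unfold jdtFAt; rw [hS]; rfl
    have hd : ∀ t, colDiff (c₁ j, c₁ (j + 1)) t =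
        colDiff (c j, c (j + 1)) t + if letterIdx x < t then 2 else 0 := by
      intro t
      unfold colDiff
      rw [hcj, hcj1, cnt_insert _ _ hx2, cnt_erase _ _ hx1]
      split_ifs <;> ring
    have hs : colDiff (c j, c (j + 1)) (letterIdx x + 1) = ε - 1 := by
      rw [← hmax]
      unfold colDiff
      rw [cnt_succ_of_mem _ _ hx1, cnt_succ_of_notMem _ _ hx2]; ring
    obtain ⟨d, A, g1, g2, g3, g4, g5⟩ := ih c₁ (ε + 1) ⟨fun t => by
        rw [hd]
        have := hε.1 t
        split_ifs with ht
        · have := h2 t ht; omega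
        · omega, letterIdx x + 1, by rw [hd, hs, if_pos (by omega)]; ring⟩
      (by rw [hd, if_pos hxn]; omega)
    refine ⟨d, fun t => A t + if letterIdx x < t then 1 else 0, ?_, ?_, ?_, ?_, ?_⟩
    · rw [jdtFAtPow_succ, hstep]; exact g1
    · intro k hk1 hk2
      rw [g2 k hk1 hk2]; simp [hc₁, hk1, hk2]
    · intro t; rw [g3, hcj, cnt_erase _ _ hx1]; ring
    · intro t; rw [g4, hcj1, cnt_insert _ _ hx2]; ring
    -- After the first move the new maximum is attained just after x, so all later moves concern
    -- letters of larger index than x.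
    · have hA0 : ∀ t, t ≤ letterIdx x → A t = 0 := by
        intro t ht
        have a1 := g5.upper (letterIdx x + 1)
        rw [hd, hs, if_pos (by omega)] at a1
        have a2 := g5.mono (show t ≤ letterIdx x + 1 by omega)
        have a3 := g5.nonneg t
        omega
      refine ⟨?_, ?_, ?_, ?_, ?_, ?_⟩
      · intro s t hst
        have := g5.mono hst
        dsimp only
        split_ifs <;> omega
      · intro t
        have := g5.nonneg t
        split_ifs <;> omega
      · intro t
        have := g5.le t
        push_cast
        split_ifs <;> omega
      · intro t ht
        have := g5.eq t ht
        push_cast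
        rw [if_pos (by omega)]; omega
      · intro t
        have a1 := g5.upper t
        have a2 := hε.1 t
        rw [hd] at a1
        split_ifs at a1 ⊢ with ht
        · omega
        · have := hA0 t (by omega); omega
      · intro t
        split_ifs with ht
        · rcases g5.lower t with a1 | ⟨s, hs1, a1⟩
          · left; push_cast; omega
          · right
            refine ⟨s, hs1, ?_⟩
            rw [hd, if_pos (by omega)] at a1
            omega
        · right
          refine ⟨letterIdx x, by omega, ?_⟩
          rw [hmax, hA0 t (by omega)]; simp

/-- The operators `ℱ_j^a`, `ℱ_{j+1}^a`, …, `ℱ_{j+m-1}^a`, applied one after the other. -/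
def jdtChain (a j m : ℕ) (c : ℕ → Col n) : Option (ℕ → Col n) :=
  (List.range' j m).foldlM (fun d k => jdtFAtPow k a d) c

theorem jdtChain_succ (a j m : ℕ) (c : ℕ → Col n) :
    jdtChain a j (m + 1) c = (jdtFAtPow j a c).bind (jdtChain a (j + 1) m) := by
  unfold jdtChain
  rw [List.range'_succ, List.foldlM_cons]
  rfl

/-- The displacement by `jdtChain a j m`, in terms of counting functions: `A k` is the counting
function of the set of letters moved into the column with index `k`. -/
structure IsChainMove (n a j m : ℕ) (c A : ℕ → ℕ → ℤ) : Prop where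
  zero : ∀ k, k ≤ j ∨ j + m < k → ∀ t, A k t = 0
  moved : ∀ k, j ≤ k → k < j + m → MovedBy n a (fun t => c k t + A k t - c (k + 1) t) (A (k + 1))
  step : ∀ k, j < k → k ≤ j + m → ∀ t, c k (t + 1) + A k (t + 1) ≤ c k t + A k t + 1

/-- When the counting functions decrease along the columns, each `colDiff` has maximum 0, attained
at 0. A condition on heights is needed only for the first pair: afterwards the column on the right
has just received a letters, which it can pass on. -/
theorem jdtChain_exists (a j m : ℕ) (c : ℕ → Col n)
    (hle : ∀ k, j ≤ k → k < j + m → ∀ t, cnt (c (k + 1)) t ≤ cnt (c k) t)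
    (hcard : 0 < m → (c (j + 1)).card + a ≤ (c j).card) :
    ∃ d A, jdtChain a j m c = some d ∧ IsChainMove n a j m (fun k => cnt (c k)) A ∧
      ∀ k t, cnt (d k) t = cnt (c k) t + A k t - A (k + 1) t := by
  induction m generalizing j c with
  | zero =>
    refine ⟨c, fun _ _ => 0, rfl, ⟨fun _ _ _ => rfl, fun k _ _ => by omega, fun k _ _ => by omega⟩,
      by simp⟩
  | succ m ih =>
    have h0 := hle j le_rfl (by omega)
    have hcard := hcard (by omega)
    obtain ⟨c₁, A₁, g1, g2, g3, g4, g5⟩ := jdtFAtPow_exists j a c 0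
      ⟨fun t => by have := h0 t; unfold colDiff; dsimp only; omega, 0, colDiff_zero _⟩
      (by rw [colDiff_of_ge _ n le_rfl]; dsimp only; omega)
    have hc₁ : ∀ k, j + 1 < k → c₁ k = c k := fun k hk => g2 k (by omega) (by omega)
    obtain ⟨d, A, e1, e2, e3⟩ := ih (j + 1) c₁ (fun k hk1 hk2 t => by
        rw [hc₁ (k + 1) (by omega)]
        have := hle k (by omega) (by omega) t
        rcases Nat.lt_or_ge (j + 1) k with h | h
        · rwa [hc₁ k h]
        · obtain rfl : k = j + 1 := by omega
          rw [g4]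
          have := g5.nonneg t
          omega) (fun hm => by
        have a1 := g4 n
        have a2 := hle (j + 1) (by omega) (by omega) n
        have a3 := g5.eq n le_rfl
        rw [cnt_of_ge _ n le_rfl] at a1 a2
        rw [cnt_of_ge _ n le_rfl] at a1 a2
        rw [hc₁ (j + 1 + 1) (by omega)]
        omega)
    -- The later chain records no letters entering its own first column j + 1; here the letters
    -- coming from column j are put in.
    obtain ⟨A', hA1, hA2⟩ : ∃ A' : ℕ → ℕ → ℤ, A' (j + 1) = A₁ ∧ ∀ k, k ≠ j + 1 → A' k = A k :=
      ⟨Function.update A (j + 1) A₁, by simp, fun k hk => by simp [hk]⟩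
    refine ⟨d, A', by rw [jdtChain_succ, g1]; exact e1, ⟨?_, ?_, ?_⟩, ?_⟩
    · intro k hk t
      rw [hA2 k (by omega)]
      exact e2.zero k (by omega) t
    · intro k hk1 hk2
      rcases hk1.eq_or_lt with rfl | hlt
      · have hK : (fun t => cnt (c j) t + A' j t - cnt (c (j + 1)) t) =
            fun t => 0 - colDiff (c j, c (j + 1)) t := by
          funext t
          rw [hA2 j (by omega), e2.zero j (by omega)]
          unfold colDiff; ring
        rw [hA1, hK]
        exact g5
      · have hK : (fun t => cnt (c k) t + A' k t - cnt (c (k + 1)) t) =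
            fun t => cnt (c₁ k) t + A k t - cnt (c₁ (k + 1)) t := by
          funext t
          rw [hc₁ (k + 1) (by omega)]
          by_cases hk : k = j + 1
          · subst hk
            rw [hA1, g4, e2.zero (j + 1) (by omega)]; ring
          · rw [hA2 k hk, hc₁ k (by omega)]
        rw [hK, hA2 (k + 1) (by omega)]
        exact e2.moved k (by omega) (by omega)
    -- Column k plus what it has received counts an actual column, the one present before column k
    -- passes letters on; so it grows by at most 1 at each t.
    · intro k hk1 hk2 t
      by_cases hk : k = j + 1
      · subst hk
        have := cnt_succ (c₁ (j + 1)) t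
        have := has_le_one (c₁ (j + 1)) t
        rw [hA1]
        rw [g4, g4] at *
        omega
      · rw [hA2 k hk]
        have := e2.step k (by omega) (by omega) t
        rwa [hc₁ k (by omega)] at this
    · intro k t
      rw [e3]
      by_cases hk : k = j
      · subst hk
        rw [hA2 k (by omega), hA1, g3, e2.zero k (by omega), e2.zero (k + 1) (by omega)]
        ring
      · rw [hA2 (k + 1) (by omega)]
        by_cases hk1 : k = j + 1
        · subst hk1
          rw [hA1, g4, e2.zero (j + 1) (by omega)]; ring
        · rw [hA2 k hk1, g2 k hk hk1]

/-- The chains with parameters `(a_i, j_i, m_i)` for `i = k, k - 1, …, 1`, applied one after the other. -/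
def jdtChains (a j m : ℕ → ℕ) : ℕ → (ℕ → Col n) → Option (ℕ → Col n)
  | 0, c => some c
  | k + 1, c => (jdtChain (a (k + 1)) (j (k + 1)) (m (k + 1)) c).bind (jdtChains a j m k)

theorem foldlM_flatMap_chains (a j m : ℕ → ℕ) (k : ℕ) (c : ℕ → Col n) :
    ((List.range' 1 k).reverse.flatMap fun i => (List.range' (j i) (m i)).map fun p => (p, i)).foldlM
      (fun d p => jdtFAtPow p.1 (a p.2) d) c = jdtChains a j m k c := by
  induction k generalizing c with
  | zero => rfl
  | succ k ih =>
    rw [List.range'_concat, List.reverse_append, List.reverse_singleton, List.singleton_append,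
      List.flatMap_cons, List.foldlM_append, jdtChains]
    simp only [one_mul, Nat.add_comm 1 k, List.foldlM_map]
    unfold jdtChain
    congr 1
    funext d
    exact ih d

theorem separate_eq (ℓ : ℕ) (a : ℕ → ℕ) (c : ℕ → Col n) :
    separate ℓ a c = jdtChains a (fun i => 2 * i) (fun i => ℓ - i) (ℓ - 1) c :=
  foldlM_flatMap_chains a _ _ _ c

end Moves

/-! ### The first maximum of a path -/

section FirstMax

/-- The path `W` takes its maximum on `{0, …, M}` at `p`, for the first time. -/
def FirstMax (W : ℕ → ℤ) (M p : ℕ) : Prop := p ≤ M ∧ (∀ q ≤ M, W q ≤ W p) ∧ ∀ q < p, W q < W p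

theorem exists_firstMax (W : ℕ → ℤ) (M : ℕ) : ∃ p, FirstMax W M p := by
  classical
  obtain ⟨t, ht, h⟩ := Finset.exists_max_image (Finset.range (M + 1)) W ⟨0, by simp⟩
  have hex : ∃ p, p ≤ M ∧ W p = W t := ⟨t, by simpa [Nat.lt_succ_iff] using ht, rfl⟩
  refine ⟨Nat.find hex, (Nat.find_spec hex).1, fun q hq => ?_, fun q hq => ?_⟩
  · rw [(Nat.find_spec hex).2]; exact h q (by simp; omega)
  · have h1 := (Nat.find_spec hex).1
    have h2 := Nat.find_min hex hq
    rw [(Nat.find_spec hex).2]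
    exact lt_of_le_of_ne (h q (by simp; omega)) fun h3 => h2 ⟨by omega, h3⟩

/-- The first maximum of `W` on `{0, …, M}` is the first maximum of `W'`, with the same value. -/
def KeepsFirstMax (W W' : ℕ → ℤ) (M : ℕ) : Prop := ∀ p, FirstMax W M p → FirstMax W' M p ∧ W' p = W p

theorem KeepsFirstMax.refl (W : ℕ → ℤ) (M : ℕ) : KeepsFirstMax W W M := fun _ h => ⟨h, rfl⟩

theorem KeepsFirstMax.trans {W W' W'' : ℕ → ℤ} {M : ℕ} (h : KeepsFirstMax W W' M)
    (h' : KeepsFirstMax W' W'' M) : KeepsFirstMax W W'' M := fun p hp => by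
  obtain ⟨h1, h2⟩ := h p hp
  obtain ⟨h3, h4⟩ := h' p h1
  exact ⟨h3, h4.trans h2⟩

theorem FirstMax.of_le {W W' : ℕ → ℤ} {M p : ℕ} (h : FirstMax W M p) (hle : ∀ q ≤ M, W' q ≤ W q)
    (heq : W' p = W p) : FirstMax W' M p :=
  ⟨h.1, fun q hq => heq ▸ (hle q hq).trans (h.2.1 q hq), fun q hq => heq ▸
    (hle q (hq.le.trans h.1)).trans_lt (h.2.2 q hq)⟩

/-- Lowering a path does no harm to its first maximum if every lowered position was already matched
or exceeded by an earlier one. -/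
theorem KeepsFirstMax.of_le {W W' : ℕ → ℤ} {M : ℕ} (hle : ∀ q ≤ M, W' q ≤ W q)
    (hne : ∀ p ≤ M, W' p ≠ W p → ∃ q < p, W p ≤ W q) : KeepsFirstMax W W' M := by
  intro p hp
  have heq : W' p = W p := by
    by_contra h
    obtain ⟨q, hq, h1⟩ := hne p hp.1 h
    exact absurd (hp.2.2 q hq) (not_lt.2 h1)
  exact ⟨hp.of_le hle heq, heq⟩

end FirstMax

/-! ### The separation algorithm in terms of counting functions -/

section SeparationCounts

variable {n : ℕ}

open Col

/-- The properties of the columns of an element of `𝐓_λ` which are used for the separation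
algorithm: `G i` is the counting function of the set of letters moved by `ℰ^{a_i}` from `T_i^L`
to `T_i^R`. -/
structure SepData (ℓ : ℕ) (a : ℕ → ℕ) (c : ℕ → Col n) (G : ℕ → ℕ → ℤ) : Prop where
  mono : ∀ i, 1 ≤ i → i ≤ ℓ → Monotone (G i)
  le : ∀ i, 1 ≤ i → i ≤ ℓ → ∀ t, G i t ≤ a i
  eq : ∀ i, 1 ≤ i → i ≤ ℓ → ∀ t, n ≤ t → G i t = a i
  diff : ∀ i, 1 ≤ i → i ≤ ℓ → ∀ t, cnt (c (2 * i)) t ≤ cnt (c (2 * i - 1)) t + G i t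
  a_mono : ∀ i, 1 ≤ i → i < ℓ → a i ≤ a (i + 1)
  admL : ∀ i, 1 ≤ i → i < ℓ → ∀ t, cnt (c (2 * i + 1)) t + G i t ≤ cnt (c (2 * i)) t
  admR : ∀ i, 1 ≤ i → i < ℓ → ∀ t,
    cnt (c (2 * i + 1)) t + G (i + 1) t + a i ≤ cnt (c (2 * i)) t + a (i + 1)
  step : ∀ i, 1 ≤ i → i < ℓ → ∀ t,
    cnt (c (2 * i - 1)) (t + 1) + G i (t + 1) ≤ cnt (c (2 * i - 1)) t + G i t + 1
  card_le : ∀ i, 1 ≤ i → i ≤ ℓ → a i ≤ (c (2 * i)).card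
  empty : ∀ j, 2 * ℓ < j → c j = ∅

/-- The state `d` of the separation algorithm after the operators with exponents `a_{ℓ-1}`, …, `a_i`;
`A j` is the counting function of the letters moved last into the column with index `j`. -/
structure SepInv (ℓ : ℕ) (a : ℕ → ℕ) (c : ℕ → Col n) (G : ℕ → ℕ → ℤ) (i : ℕ) (d : ℕ → Col n)
    (A : ℕ → ℕ → ℤ) : Prop where
  same : ∀ j, j < 2 * i ∨ 2 * ℓ < j → d j = c j
  start : A (2 * i) = G i
  mono : ∀ j, 2 * i ≤ j → j ≤ ℓ + i → Monotone (A j)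
  le : ∀ j, 2 * i ≤ j → j ≤ ℓ + i → ∀ t, A j t ≤ a i
  inc : ∀ j, 2 * i ≤ j → j < ℓ + i → ∀ t, A j t ≤ A (j + 1) t
  zero : ∀ t, A (ℓ + i + 1) t = 0
  diff : ∀ j, 2 * i - 1 ≤ j → j < ℓ + i → ∀ t,
    cnt (d (j + 1)) t + A (j + 2) t ≤ cnt (d j) t + A (j + 1) t
  tail : ∀ k, i ≤ k → k < ℓ → ∀ t,
    cnt (d (ℓ + k + 1)) t + a k ≤ cnt (d (ℓ + k)) t + a (k + 1)
  card : ∀ j, ((d j).card : ℤ) = (c j).card - (if j % 2 = 0 ∧ 2 * i ≤ j ∧ j < 2 * ℓ then a (j / 2) else 0) +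
    (if ℓ + i ≤ j ∧ j < 2 * ℓ then a (j - ℓ) else 0)

/-- The path of the letters `n̄` in the columns with indices `s`, `s + 1`, …. -/
def colPath (s : ℕ) (d : ℕ → Col n) (p : ℕ) : ℤ :=
  ∑ j ∈ Finset.range p, (2 * has (d (s + j)) (n - 1) - 1)

theorem colPath_succ (s : ℕ) (d : ℕ → Col n) (p : ℕ) :
    colPath s d (p + 1) = colPath s d p + (2 * has (d (s + p)) (n - 1) - 1) :=
  Finset.sum_range_succ _ _

variable {ℓ : ℕ} {a : ℕ → ℕ} {c : ℕ → Col n} {G : ℕ → ℕ → ℤ}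

theorem SepInv.anti {i : ℕ} {d : ℕ → Col n} {A : ℕ → ℕ → ℤ} (H : SepInv ℓ a c G i d A) (hi : 1 ≤ i)
    (j : ℕ) (h1 : 2 * i - 1 ≤ j) (h2 : j + 1 < ℓ + i) (t : ℕ) : cnt (d (j + 1)) t ≤ cnt (d j) t := by
  have h3 := H.diff j h1 (by omega) t
  have h4 : A (j + 1) t ≤ A (j + 2) t := H.inc (j + 1) (by omega) h2 t
  omega

/-- Before any operator is applied, the letters of ℰ^{a_ℓ} play the part of the letters last moved
into column 2ℓ. -/
theorem SepData.init (H : SepData ℓ a c G) (hℓ : 1 ≤ ℓ) :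
    ∃ A, SepInv ℓ a c G ℓ c A := by
  refine ⟨fun j => if j = 2 * ℓ then G ℓ else 0, ?_, ?_, ?_, ?_, ?_, ?_, ?_, ?_, ?_⟩
  · exact fun _ _ => rfl
  · simp
  · intro j h1 h2
    rw [if_pos (by omega)]; exact H.mono ℓ hℓ le_rfl
  · intro j h1 h2 t
    rw [if_pos (by omega)]; exact H.le ℓ hℓ le_rfl t
  · intro j h1 h2; omega
  · intro t; rw [if_neg (by omega)]; rfl
  · intro j h1 h2 t
    obtain rfl : j = 2 * ℓ - 1 := by omega
    rw [if_neg (by omega), if_pos (by omega), show 2 * ℓ - 1 + 1 = 2 * ℓ by omega]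
    have := H.diff ℓ hℓ le_rfl t
    simpa using this
  · intro k h1 h2; omega
  · intro j
    rw [if_neg (by omega), if_neg (by omega)]; ring

/-- The inductive step. The letters B k moved by the new block are bounded below in two ways: by
those entering the preceding column of the block, which gives `inc`, and by the letters A (k + 1) of
the preceding block up to the shift a_{i+1} - a_i, which gives `tail`. Both bounds propagate from
column to column through the formula behind `MovedBy`, and start from the two admissibility
inequalities. -/
theorem SepInv.chain {i : ℕ} {d : ℕ → Col n} {A : ℕ → ℕ → ℤ} (D : SepData ℓ a c G)
    (H : SepInv ℓ a c G (i + 1) d A) (hi : 1 ≤ i) (hiℓ : i < ℓ) :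
    ∃ e B B', jdtChain (a i) (2 * i) (ℓ - i) d = some e ∧
      IsChainMove n (a i) (2 * i) (ℓ - i) (fun k => cnt (d k)) B ∧
      (∀ k t, cnt (e k) t = cnt (d k) t + B k t - B (k + 1) t) ∧
      (∀ k, 2 * i ≤ k → k < ℓ + i → ∀ t, cnt (d (k + 1)) t ≤ cnt (d k) t) ∧
      SepInv ℓ a c G i e B' := by
  have s0 : d (2 * i - 1) = c (2 * i - 1) := H.same _ (by omega)
  have s1 : d (2 * i) = c (2 * i) := H.same _ (by omega)
  have s2 : d (2 * i + 1) = c (2 * i + 1) := H.same _ (by omega)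
  have hL := D.admL i hi hiℓ
  -- At the first pair, admissibility leaves the extra room G i, which starts the monotonicity of
  -- the displacements below.
  have hanti : ∀ k, 2 * i ≤ k → k < ℓ + i → ∀ t, cnt (d (k + 1)) t + (if k = 2 * i then G i t else 0) ≤
      cnt (d k) t := by
    intro k h1 h2 t
    split_ifs with hk
    · subst hk; rw [s1, s2]; exact hL t
    · rw [add_zero]; exact H.anti (by omega) k (by omega) (by omega) t
  have hGz : ∀ t, 0 ≤ G i t := by
    intro t
    have h1 := D.mono i hi hiℓ.le (Nat.zero_le t)
    have h2 := D.diff i hi hiℓ.le 0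
    simp only [cnt_zero] at h2
    omega
  have hanti' : ∀ k, 2 * i ≤ k → k < ℓ + i → ∀ t, cnt (d (k + 1)) t ≤ cnt (d k) t := by
    intro k h1 h2 t
    have := hanti k h1 h2 t
    have := hGz t
    split_ifs at * <;> omega
  obtain ⟨e, B, g1, g2, g3⟩ := jdtChain_exists (a i) (2 * i) (ℓ - i) d
    (fun k h1 h2 => hanti' k h1 (by omega)) (fun _ => by
      have := hL n
      rw [D.eq i hi hiℓ.le n le_rfl, cnt_of_ge _ n le_rfl, cnt_of_ge _ n le_rfl] at this
      rw [s1, s2]; omega)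
  have hBn : ∀ k, 2 * i < k → k ≤ ℓ + i → MovedBy n (a i)
      (fun t => cnt (d (k - 1)) t + B (k - 1) t - cnt (d k) t) (B k) := by
    intro k h1 h2
    have := g2.moved (k - 1) (by omega) (by omega)
    rwa [show k - 1 + 1 = k by omega] at this
  have hBz : ∀ k, k ≤ 2 * i ∨ ℓ + i < k → ∀ t, B k t = 0 := fun k hk t => g2.zero k (by omega) t
  -- Nothing is moved into column 2i, but the invariant wants G i there: it is the surplus allowed
  -- to T_i^L over T_i^R.
  obtain ⟨B', hB0, hBne⟩ : ∃ B' : ℕ → ℕ → ℤ, B' (2 * i) = G i ∧ ∀ k, k ≠ 2 * i → B' k = B k :=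
    ⟨Function.update B (2 * i) (G i), by simp, fun k hk => by simp [hk]⟩
  -- Comparison with the preceding block, one column further on. It starts from the inequality of
  -- T_i^L with the right column of ℰ^{a_{i+1}} T_{i+1}, and continues by `diff` of the old state.
  have hBA : ∀ k, 2 * i < k → k ≤ ℓ + i → ∀ t, A (k + 1) t + a i ≤ B k t + a (i + 1) := by
    intro k hk
    induction k, hk using Nat.le_induction with
    | base =>
      intro h2 t
      change A (2 * i + 1 + 1) t + _ ≤ B (2 * i + 1) t + _
      rcases (hBn (2 * i + 1) (by omega) h2).lower t with h3 | ⟨s, hs, h3⟩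
      · have := H.le (2 * i + 1 + 1) (by omega) (by omega) t
        omega
      · rw [show 2 * i + 1 - 1 = 2 * i by omega, hBz (2 * i) (by omega), s1, s2] at h3
        have h4 := D.admR i hi hiℓ s
        have h5 := D.mono (i + 1) (by omega) (by omega) hs
        rw [show 2 * i + 1 + 1 = 2 * (i + 1) by ring, H.start]
        omega
    | succ k hk ih =>
      intro h2 t
      rcases (hBn (k + 1) (by omega) h2).lower t with h3 | ⟨s, hs, h3⟩
      · have := H.le (k + 1 + 1) (by omega) (by omega) t
        omega
      · rw [show k + 1 - 1 = k by omega] at h3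
        have h4 := ih (by omega) s
        have h5 := H.diff k (by omega) (by omega) s
        have h6 := H.mono (k + 2) (by omega) (by omega) hs
        rw [show k + 1 + 1 = k + 2 by ring]
        omega
  refine ⟨e, B, B', g1, g2, g3, hanti', ?_, hB0, ?_, ?_, ?_, ?_, ?_, ?_, ?_⟩
  · intro j hj
    rw [← H.same j (by omega)]
    apply cnt_inj
    intro t
    rw [g3, hBz j (by omega), hBz (j + 1) (by omega)]; ring
  · intro j h1 h2
    rcases h1.eq_or_lt with rfl | h1
    · rw [hB0]; exact D.mono i hi hiℓ.le
    · rw [hBne j (by omega)]; exact (hBn j h1 h2).mono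
  · intro j h1 h2
    rcases h1.eq_or_lt with rfl | h1
    · rw [hB0]; exact D.le i hi hiℓ.le
    · rw [hBne j (by omega)]; exact (hBn j h1 h2).le
  -- By `hanti` the function K governing the next move is at least the displacement that entered
  -- column j, so at least as many letters move on.
  · intro j h1 h2 t
    rw [hBne (j + 1) (by omega)]
    rcases (hBn (j + 1) (by omega) (by omega)).lower t with h3 | ⟨s, hs, h3⟩
    · rw [h3]
      rcases h1.eq_or_lt with rfl | h1
      · rw [hB0]; exact D.le i hi hiℓ.le t
      · rw [hBne j (by omega)]; exact (hBn j h1 (by omega)).le t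
    · rw [show j + 1 - 1 = j by omega] at h3
      have h4 := hanti j h1 h2 s
      rcases h1.eq_or_lt with rfl | h1
      · rw [hBz (2 * i) (by omega)] at h3
        rw [if_pos rfl] at h4
        have := D.mono i hi hiℓ.le hs
        rw [hB0]; omega
      · rw [if_neg (by omega)] at h4
        have := (hBn j h1 (by omega)).mono hs
        rw [hBne j (by omega)]; omega
  · intro t
    rw [hBne _ (by omega)]; exact hBz _ (by omega) t
  · intro j h1 h2 t
    rw [g3, g3]
    rcases h1.eq_or_lt with rfl | h1
    · have h3 := D.diff i hi hiℓ.le t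
      rw [show 2 * i - 1 + 1 = 2 * i by omega, show 2 * i - 1 + 2 = 2 * i + 1 by omega, hB0,
        hBne _ (by omega), hBz (2 * i) (by omega), hBz (2 * i - 1) (by omega), s0, s1]
      omega
    · have h3 := (hBn (j + 1) (by omega) (by omega)).upper t
      rw [show j + 1 - 1 = j by omega] at h3
      rw [hBne _ (by omega), hBne _ (by omega), show j + 1 + 1 = j + 2 by ring]
      omega
  -- The only new inequality is at k = i: column ℓ + i has received B (ℓ + i), and `hBA` compares
  -- this with the old surplus A (ℓ + i + 1).
  · intro k h1 h2 t
    rw [g3, g3]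
    rw [hBz (ℓ + k + 1) (by omega), hBz (ℓ + k + 1 + 1) (by omega)]
    rcases h1.eq_or_lt with rfl | h1
    · have h3 := H.diff (ℓ + i) (by omega) (by omega) t
      have h4 := H.zero t
      rw [show ℓ + (i + 1) + 1 = ℓ + i + 2 by ring] at h4
      have h5 := hBA (ℓ + i) (by omega) le_rfl t
      omega
    · have := H.tail k h1 h2 t
      rw [hBz (ℓ + k) (by omega)]
      omega
  · intro j
    have h1 := g3 j n
    have h2 : ∀ k, B k n = if 2 * i < k ∧ k ≤ ℓ + i then (a i : ℤ) else 0 := by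
      intro k
      split_ifs with hk
      · exact (hBn k hk.1 hk.2).eq n le_rfl
      · exact hBz k (by omega) n
    rw [cnt_of_ge _ n le_rfl, cnt_of_ge _ n le_rfl, H.card j, h2, h2] at h1
    rw [h1]
    by_cases e1 : j = 2 * i
    · subst e1
      rw [show 2 * i / 2 = i by omega]
      split_ifs <;> omega
    · by_cases e2 : j = ℓ + i
      · subst e2
        rw [show ℓ + i - ℓ = i by omega]
        split_ifs <;> omega
      · split_ifs <;> omega

/-- The path is lowered by 2 exactly where the block moves n̄ into the next column. If n̄ is moved
into column k, then n̄ was missing from T_i^R and from every column strictly between 2i and k. Only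
column 2i can compensate the descent at column 2i - 1, so the path at k is at most its value at 2i -
1, and k is not a first maximum. -/
theorem IsChainMove.keepsFirstMax {i s M : ℕ} {d e : ℕ → Col n} {A B : ℕ → ℕ → ℤ} (hn : 1 ≤ n)
    (D : SepData ℓ a c G) (H : SepInv ℓ a c G (i + 1) d A) (hi : 1 ≤ i) (hiℓ : i < ℓ) (hs : s ≤ 1)
    (g2 : IsChainMove n (a i) (2 * i) (ℓ - i) (fun k => cnt (d k)) B)
    (g3 : ∀ k t, cnt (e k) t = cnt (d k) t + B k t - B (k + 1) t)
    (hanti : ∀ k, 2 * i ≤ k → k < ℓ + i → ∀ t, cnt (d (k + 1)) t ≤ cnt (d k) t) :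
    KeepsFirstMax (colPath s d) (colPath s e) M := by
  obtain ⟨N, rfl⟩ : ∃ N, n = N + 1 := ⟨n - 1, by omega⟩
  have hhas : ∀ U : Col (N + 1), has U (N + 1 - 1) = cnt U (N + 1) - cnt U N := fun U => by
    have := cnt_succ U N
    rw [Nat.add_sub_cancel]; omega
  have hz : ∀ k, k ≤ 2 * i ∨ ℓ + i < k → ∀ t, B k t = 0 := fun k hk t => g2.zero k (by omega) t
  -- The contributions B k - B (k + 1) telescope, leaving only the flow of n̄ into column s + p.
  have hW : ∀ p, colPath s e p = colPath s d p - 2 * (B (s + p) (N + 1) - B (s + p) N) := by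
    intro p
    induction p with
    | zero => simp [colPath, hz s (by omega)]
    | succ p ih =>
      rw [colPath_succ, colPath_succ, ih, hhas, hhas, g3, g3]
      rw [show s + (p + 1) = s + p + 1 by ring]; ring
  have hpos : ∀ k, 0 ≤ B k (N + 1) - B k N := by
    intro k
    by_cases hk : k ≤ 2 * i ∨ ℓ + i < k
    · rw [hz k hk, hz k hk]; simp
    · have := (g2.moved (k - 1) (by omega) (by omega)).mono (Nat.le_succ N)
      rw [show k - 1 + 1 = k by omega] at this
      rw [Nat.succ_eq_add_one] at this
      omega
  -- If n̄ moves into column k + 1, fewer than a_i other letters do, so the minimum defining this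
  -- number is attained at t = n - 1. Moreover this column cannot have had n̄ already.
  have hlow : ∀ k, 2 * i ≤ k → k < ℓ + i → 0 < B (k + 1) (N + 1) - B (k + 1) N →
      cnt (d k) N + B k N + 1 ≤ cnt (d (k + 1)) N + a i ∧ has (d (k + 1)) (N + 1 - 1) = 0 := by
    intro k h1 h2 h3
    have hm := g2.moved k h1 (by omega)
    have h4 := hm.eq (N + 1) le_rfl
    constructor
    · rcases hm.lower N with h5 | ⟨t, ht, h5⟩
      · omega
      · rcases ht.eq_or_lt with rfl | ht
        · omega
        · have h6 := hm.upper t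
          rw [hm.eq t ht] at h6
          omega
    · have h5 := g2.step (k + 1) (by omega) (by omega) N
      have h6 := has_nonneg (d (k + 1)) (N + 1 - 1)
      rw [hhas] at h6 ⊢
      omega
  have key : ∀ k, 2 * i < k → k ≤ ℓ + i → 0 < B k (N + 1) - B k N →
      colPath s d (k - s) ≤ colPath s d (2 * i - 1 - s) := by
    intro k hk
    induction k, hk using Nat.le_induction with
    | base =>
      intro h2 h3
      have h4 := (hlow (2 * i) le_rfl (by omega) h3).1
      rw [hz (2 * i) (by omega), H.same (2 * i) (by omega), H.same (2 * i + 1) (by omega)] at h4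
      have h5 := D.admL i hi hiℓ N
      have h6 := D.eq i hi hiℓ.le (N + 1) le_rfl
      have h7 := D.step i hi hiℓ N
      -- Fewer than a_i letters other than n̄ are counted by G i, hence n̄ is among those which
      -- ℰ^{a_i} moves into T_i^R, and it was not there before.
      have h8 : has (d (2 * i - 1)) (N + 1 - 1) = 0 := by
        have h6 := has_nonneg (d (2 * i - 1)) (N + 1 - 1)
        rw [hhas] at h6 ⊢
        rw [H.same (2 * i - 1) (by omega)] at *
        omega
      have e1 := colPath_succ s d (2 * i - 1 - s)
      have e2 := colPath_succ s d (2 * i - s)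
      rw [show 2 * i - 1 - s + 1 = 2 * i - s by omega, show s + (2 * i - 1 - s) = 2 * i - 1 by omega] at e1
      rw [show 2 * i - s + 1 = 2 * i + 1 - s by omega, show s + (2 * i - s) = 2 * i by omega] at e2
      have := has_le_one (d (2 * i)) (N + 1 - 1)
      rw [Nat.succ_eq_add_one, e2, e1]
      omega
    | succ k hk ih =>
      intro h2 h3
      have h4 := hlow k (by omega) (by omega) h3
      have h5 := hanti k (by omega) (by omega) N
      have hm := (g2.moved (k - 1) (by omega) (by omega)).eq (N + 1) le_rfl
      rw [show k - 1 + 1 = k by omega] at hm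
      -- If n̄ moves out of column k at this stage, then it also moved into column k, so column k
      -- had no n̄ and the path goes down there.
      have h6 : 0 < B k (N + 1) - B k N := by omega
      have h7 := ih (by omega) h6
      have h8 := hlow (k - 1) (by omega) (by omega) (by rwa [show k - 1 + 1 = k by omega])
      rw [show k - 1 + 1 = k by omega] at h8
      have e1 := colPath_succ s d (k - s)
      rw [show k - s + 1 = k + 1 - s by omega, show s + (k - s) = k by omega, h8.2] at e1
      omega
  apply KeepsFirstMax.of_le
  · intro q _
    rw [hW]
    have := hpos (s + q)
    omega
  · intro p _ hp
    rw [hW] at hp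
    have h1 := hpos (s + p)
    have h2 : ¬ (s + p ≤ 2 * i ∨ ℓ + i < s + p) := by
      intro h
      rw [hz _ h, hz _ h] at hp
      simp at hp
    refine ⟨2 * i - 1 - s, by omega, ?_⟩
    have := key (s + p) (by omega) (by omega) (by omega)
    rwa [show s + p - s = p by omega] at this

theorem SepInv.chains {k s M : ℕ} {d : ℕ → Col n} {A : ℕ → ℕ → ℤ} (hn : 1 ≤ n)
    (D : SepData ℓ a c G) (H : SepInv ℓ a c G (k + 1) d A) (hk : k < ℓ) (hs : s ≤ 1) :
    ∃ e B, jdtChains a (fun i => 2 * i) (fun i => ℓ - i) k d = some e ∧ SepInv ℓ a c G 1 e B ∧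
      KeepsFirstMax (colPath s d) (colPath s e) M := by
  induction k generalizing d A with
  | zero => exact ⟨d, A, rfl, H, KeepsFirstMax.refl _ _⟩
  | succ k ih =>
    obtain ⟨e, B, B₁, g1, g2, g3, g4, g5⟩ := H.chain D (by omega) hk
    obtain ⟨e', B', h1, h2, h3⟩ := ih g5 (by omega)
    refine ⟨e', B', ?_, h2, (g2.keepsFirstMax hn D H (by omega) hk hs g3 g4).trans h3⟩
    rw [jdtChains, g1]; exact h1

/-- By `MovedBy.unique`, each displacement is determined by the counting functions at t < n, so two
states which agree there are displaced in the same way, also at t ≥ n. -/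
theorem SepInv.chains_eq {a : ℕ → ℕ} {c' : ℕ → Col n} {G' : ℕ → ℕ → ℤ} {k : ℕ} {d d' e e' : ℕ → Col n}
    {A A' : ℕ → ℕ → ℤ} (D : SepData ℓ a c G) (D' : SepData ℓ a c' G') (H : SepInv ℓ a c G (k + 1) d A)
    (H' : SepInv ℓ a c' G' (k + 1) d' A') (hk : k < ℓ)
    (hd : ∀ j t, t < n → cnt (d j) t = cnt (d' j) t)
    (he : jdtChains a (fun i => 2 * i) (fun i => ℓ - i) k d = some e)
    (he' : jdtChains a (fun i => 2 * i) (fun i => ℓ - i) k d' = some e') (j t : ℕ) :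
    cnt (e' j) t - cnt (d' j) t = cnt (e j) t - cnt (d j) t := by
  induction k generalizing d d' A A' with
  | zero =>
    obtain rfl := Option.some.inj he
    obtain rfl := Option.some.inj he'
    ring
  | succ k ih =>
    obtain ⟨f, B, B₁, g1, g2, g3, g4, g5⟩ := H.chain D (by omega) hk
    obtain ⟨f', B', B₁', g1', g2', g3', g4', g5'⟩ := H'.chain D' (by omega) hk
    rw [jdtChains, g1] at he
    rw [jdtChains, g1'] at he'
    have hB : ∀ j, B j = B' j := by
      intro j
      induction j with
      | zero => funext t; rw [g2.zero 0 (by omega), g2'.zero 0 (by omega)]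
      | succ j ihj =>
        by_cases hj : j + 1 ≤ 2 * (k + 1) ∨ 2 * (k + 1) + (ℓ - (k + 1)) < j + 1
        · funext t; rw [g2.zero _ hj, g2'.zero _ hj]
        · have m := g2.moved j (by omega) (by omega)
          have m' := g2'.moved j (by omega) (by omega)
          exact m.unique m' (fun t ht => by simp only [hd _ t ht, ihj])
            (fun t ht => (m.eq t ht).symm.trans_le (m.upper t))
            (fun t ht => (m'.eq t ht).symm.trans_le (m'.upper t))
    have h1 := ih g5 g5' (by omega) (fun j t ht => by rw [g3, g3', hd j t ht, hB, hB]) he he'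
    rw [g3, g3', hB, hB] at h1
    omega

end SeparationCounts

/-! ### Body and tail -/

section BodyTail

variable {n : ℕ}

open Col

/-- The `m` lowest boxes of a column. -/
def lowPart (U : Col n) (m : ℕ) : Col n := U.filter fun x => cnt U (letterIdx x) < m

theorem has_lowPart (U : Col n) (m t : ℕ) :
    has (lowPart U m) t = if cnt U t < m then has U t else 0 := by
  unfold has lowPart
  by_cases h : ∃ x ∈ U, letterIdx x = t
  · obtain ⟨x, hx, rfl⟩ := h
    rw [if_pos (show ∃ y ∈ U, letterIdx y = letterIdx x from ⟨x, hx, rfl⟩)]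
    congr 1
    simp only [Finset.mem_filter, eq_iff_iff]
    constructor
    · rintro ⟨y, ⟨-, hy⟩, h⟩
      rwa [h] at hy
    · exact fun h => ⟨x, ⟨hx, h⟩, rfl⟩
  · rw [if_neg h, ite_self, if_neg]
    rintro ⟨x, hx, rfl⟩
    exact h ⟨x, (Finset.mem_filter.1 hx).1, rfl⟩

theorem cnt_lowPart (U : Col n) (m t : ℕ) : cnt (lowPart U m) t = min (m : ℤ) (cnt U t) := by
  induction t with
  | zero => simp
  | succ t ih =>
    rw [cnt_succ, cnt_succ, ih, has_lowPart]
    have := has_nonneg U t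
    have := has_le_one U t
    split_ifs <;> omega

theorem drop_toFinset (U : Col n) (b : ℕ) : (U.down.drop b).toFinset = lowPart U (U.card - b) := by
  ext x
  rw [List.mem_toFinset, List.mem_iff_getElem?]
  simp only [List.getElem?_drop, down_getElem?, lowPart, Finset.mem_filter]
  constructor
  · rintro ⟨i, h1, h2⟩
    rw [cnt_succ_of_mem _ _ h1] at h2
    have := cnt_nonneg U (letterIdx x)
    refine ⟨h1, ?_⟩
    push_cast at h2
    omega
  · rintro ⟨h1, h2⟩
    have := cnt_nonneg U (letterIdx x)
    refine ⟨(U.card - b - 1 - cnt U (letterIdx x)).toNat, h1, ?_⟩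
    rw [cnt_succ_of_mem _ _ h1]
    push_cast
    omega

theorem cnt_take (U : Col n) (b t : ℕ) :
    cnt (U.down.take b).toFinset t = cnt U t - min ((U.card - b : ℕ) : ℤ) (cnt U t) := by
  rw [← cnt_lowPart, ← drop_toFinset]
  have hnd : (U.down).Nodup := Finset.sort_nodup _ _
  have hU : U = (U.down.take b).toFinset ∪ (U.down.drop b).toFinset := by
    rw [← List.toFinset_append, List.take_append_drop]
    exact (Finset.sort_toFinset _ _).symm
  have hdis : Disjoint (U.down.take b).toFinset (U.down.drop b).toFinset := by
    rw [List.disjoint_toFinset_iff_disjoint]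
    exact List.disjoint_take_drop hnd le_rfl
  have : ((U.filter fun x => letterIdx x < t).card : ℤ) =
      (((U.down.take b).toFinset.filter fun x => letterIdx x < t).card : ℤ) +
        (((U.down.drop b).toFinset.filter fun x => letterIdx x < t).card : ℤ) := by
    conv_lhs => rw [hU, Finset.filter_union]
    rw [Finset.card_union_of_disjoint (Finset.disjoint_filter_filter hdis)]
    push_cast; rfl
  unfold cnt
  omega

/-! ### The result of the separation, and moving the tails across the body. -/

variable {ℓ : ℕ} {a : ℕ → ℕ} {c d : ℕ → Col n} {G : ℕ → ℕ → ℤ}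

/-- The properties of the result `d` of the separation algorithm. -/
structure Separated (ℓ : ℕ) (a : ℕ → ℕ) (c d : ℕ → Col n) : Prop where
  anti : ∀ j, 1 ≤ j → j < ℓ → ∀ t, cnt (d (j + 1)) t ≤ cnt (d j) t
  mid : 1 ≤ ℓ → ∀ t, cnt (d (ℓ + 1)) t ≤ cnt (d ℓ) t + a 1
  tail : ∀ k, 1 ≤ k → k < ℓ → ∀ t, cnt (d (ℓ + k + 1)) t + a k ≤ cnt (d (ℓ + k)) t + a (k + 1)
  card : ∀ k, 1 ≤ k → k ≤ ℓ → (d (ℓ + k)).card = bodyHt a c (ℓ + k) + a k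
  card_body : ∀ j, 1 ≤ j → j ≤ ℓ → (d j).card = bodyHt a c j
  a_mono : ∀ i, 1 ≤ i → i < ℓ → a i ≤ a (i + 1)
  empty : ∀ j, 2 * ℓ < j → d j = ∅
  eq_zero : d 0 = c 0
  eq_one : d 1 = c 1

theorem separate_exists (hn : 1 ≤ n) (D : SepData ℓ a c G) {s M : ℕ} (hs : s ≤ 1) :
    ∃ d, separate ℓ a c = some d ∧ Separated ℓ a c d ∧ KeepsFirstMax (colPath s c) (colPath s d) M := by
  rw [separate_eq]
  rcases Nat.eq_zero_or_pos ℓ with rfl | hℓ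
  · exact ⟨c, rfl, ⟨fun j _ _ => by omega, fun h => by omega, fun k _ _ => by omega,
      fun k _ _ => by omega, fun k _ _ => by omega, fun k _ _ => by omega, D.empty, rfl, rfl⟩,
      KeepsFirstMax.refl _ _⟩
  obtain ⟨A, hA⟩ := D.init hℓ
  obtain ⟨d, B, g1, g2, g3⟩ := SepInv.chains (k := ℓ - 1) (s := s) (M := M) hn D
    (by rwa [Nat.sub_add_cancel hℓ]) (by omega) hs
  -- The subtraction of natural numbers in `bodyHt` is genuine, since T_i^L has at least a_i boxes.
  have hcle : ∀ j, 1 ≤ j → j ≤ 2 * ℓ → (bodyHt a c j : ℤ) = (c j).card - if j % 2 = 0 then a (j / 2) else 0 := by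
    intro j h1 h2
    unfold bodyHt
    split_ifs with h3
    · have := D.card_le (j / 2) (by omega) (by omega)
      rw [show 2 * (j / 2) = j by omega] at this
      push_cast [this]; rfl
    · simp
  refine ⟨d, g1, ⟨?_, ?_, ?_, ?_, ?_, ?_, ?_, ?_, ?_⟩, g3⟩
  · exact fun j h1 h2 => g2.anti le_rfl j (by omega) (by omega)
  · intro _ t
    have h1 := g2.diff ℓ (by omega) (by omega) t
    have h2 := g2.le (ℓ + 1) (by omega) (by omega) t
    have h3 : B (ℓ + 2) t = 0 := g2.zero t
    omega
  · exact g2.tail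
  · intro k h1 h2
    have h3 := g2.card (ℓ + k)
    have h4 := hcle (ℓ + k) (by omega) (by omega)
    rw [show ℓ + k - ℓ = k by omega] at h3
    rcases h2.eq_or_lt with rfl | h2
    · rw [if_neg (by omega), if_neg (by omega)] at h3
      rw [if_pos (by omega), show (k + k) / 2 = k by omega] at h4
      omega
    · rw [if_pos (show ℓ + 1 ≤ ℓ + k ∧ ℓ + k < 2 * ℓ by omega)] at h3
      split_ifs at h3 h4 <;> omega
  · intro j h1 h2
    have h3 := g2.card j
    have h4 := hcle j (by omega) (by omega)
    rw [if_neg (show ¬ (ℓ + 1 ≤ j ∧ j < 2 * ℓ) by omega)] at h3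
    split_ifs at h3 h4 <;> omega
  · exact D.a_mono
  · intro j hj; rw [g2.same j (by omega), D.empty j hj]
  · exact g2.same 0 (by omega)
  · exact g2.same 1 (by omega)

namespace Separated

/-- In the columns ℓ + 1, …, 2ℓ the part below L consists of the a_{j-ℓ} lowest boxes, so its
counting function is a truncation of that of the column. -/
theorem cnt_body (H : Separated ℓ a c d) (j t : ℕ) : cnt (bodyPart ℓ a c d j) t =
    cnt (d j) t - if ℓ < j ∧ j ≤ 2 * ℓ then min (a (j - ℓ) : ℤ) (cnt (d j) t) else 0 := by
  unfold bodyPart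
  by_cases h1 : j ≤ ℓ
  · rw [if_pos h1, if_neg (by omega)]; ring
  · rw [if_neg h1, cnt_take]
    by_cases h2 : j ≤ 2 * ℓ
    · rw [if_pos (by omega)]
      have := H.card (j - ℓ) (by omega) (by omega)
      rw [show ℓ + (j - ℓ) = j by omega] at this
      rw [this, Nat.add_sub_cancel_left]
    · rw [if_neg (by omega), H.empty j (by omega)]
      simp

theorem cnt_tail (H : Separated ℓ a c d) (k t : ℕ) (h1 : 1 ≤ k) (h2 : k ≤ ℓ) :
    cnt (tailPart a c d (ℓ + k)) t = min (a k : ℤ) (cnt (d (ℓ + k)) t) := by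
  unfold tailPart
  rw [drop_toFinset, cnt_lowPart, H.card k h1 h2, Nat.add_sub_cancel_left]

theorem body_empty (H : Separated ℓ a c d) (j : ℕ) (hj : 2 * ℓ < j) : bodyPart ℓ a c d j = ∅ := by
  apply cnt_inj
  intro t
  rw [H.cnt_body, if_neg (by omega), H.empty j hj]; simp

/-- For j < ℓ this is monotonicity of the separated columns, at j = ℓ the surplus is at most a 1,
and for j > ℓ the inequality `tail` survives subtracting the truncations by a k and a (k + 1),
because a k ≤ a (k + 1). -/
theorem cnt_body_anti (H : Separated ℓ a c d) (j t : ℕ) (hj : 1 ≤ j) :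
    cnt (bodyPart ℓ a c d (j + 1)) t ≤ cnt (bodyPart ℓ a c d j) t := by
  rw [H.cnt_body, H.cnt_body]
  have h0 := cnt_nonneg (d j) t
  have h0' := cnt_nonneg (d (j + 1)) t
  rcases lt_trichotomy j ℓ with h | rfl | h
  · rw [if_neg (by omega), if_neg (by omega)]
    have := H.anti j hj h t
    omega
  · rw [if_pos (by omega), if_neg (by omega), show j + 1 - j = 1 by omega]
    have := H.mid hj t
    omega
  · rw [if_congr (show (ℓ < j + 1 ∧ j + 1 ≤ 2 * ℓ) ↔ j < 2 * ℓ by omega) rfl rfl]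
    split_ifs with h1 h2
    · obtain ⟨k, rfl⟩ : ∃ k, j = ℓ + k := ⟨j - ℓ, by omega⟩
      have := H.tail k (by omega) (by omega) t
      rw [show ℓ + k - ℓ = k by omega, show ℓ + k + 1 - ℓ = k + 1 by omega]
      omega
    · omega
    · rw [H.empty (j + 1) (by omega), cnt_empty]; omega
    · rw [H.empty (j + 1) (by omega), cnt_empty]; omega

theorem card_bodyPart (H : Separated ℓ a c d) (j : ℕ) (h1 : 1 ≤ j) (h2 : j ≤ 2 * ℓ) :
    (bodyPart ℓ a c d j).card = bodyHt a c j := by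
  have := H.cnt_body j n
  rw [cnt_of_ge _ n le_rfl, cnt_of_ge _ n le_rfl] at this
  split_ifs at this with h
  · have h3 := H.card (j - ℓ) (by omega) (by omega)
    rw [show ℓ + (j - ℓ) = j by omega] at h3
    omega
  · have h3 := H.card_body j h1 (by omega)
    omega

/-- The columns of the body and of the tail one after the other: the body has the indices
`0, …, 2ℓ` and the tail has the indices `2ℓ + 1, …, 3ℓ`. -/
def _root_.flatColumns (ℓ : ℕ) (a : ℕ → ℕ) (c d : ℕ → Col n) (k j : ℕ) : Col n :=
  if j ≤ ℓ + k then d j else if j ≤ 2 * ℓ + k then bodyPart ℓ a c d j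
  else if j ≤ 3 * ℓ then tailPart a c d (j - ℓ) else ∅

/-- The a_{k+1} letters moved at each stage are precisely the tail of column ℓ + k + 1. The body
columns decrease, so the function governing the move is at least the counting function of the tail;
and where the tail count is below a_{k+1}, the body columns involved have count 0, so it is no
larger. -/
theorem chain_finish (H : Separated ℓ a c d) (k : ℕ) (hk : k < ℓ) :
    jdtChain (a (k + 1)) (ℓ + (k + 1)) ℓ (flatColumns ℓ a c d (k + 1)) =
      some (flatColumns ℓ a c d k) := by
  set f := flatColumns ℓ a c d (k + 1) with hf
  have f0 : f (ℓ + (k + 1)) = d (ℓ + (k + 1)) := if_pos le_rfl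
  have f1 : ∀ j, ℓ + (k + 1) < j → j ≤ 2 * ℓ + (k + 1) → f j = bodyPart ℓ a c d j := by
    intro j h1 h2
    simp only [hf, flatColumns]
    rw [if_neg (by omega), if_pos h2]
  have hb0 := fun t => H.cnt_body (ℓ + (k + 1)) t
  simp only [show ℓ < ℓ + (k + 1) ∧ ℓ + (k + 1) ≤ 2 * ℓ by omega, if_true,
    show ℓ + (k + 1) - ℓ = k + 1 by omega, and_true] at hb0
  have hcardp := H.card (k + 1) (by omega) (by omega)
  have hanti : ∀ j, ℓ + (k + 1) ≤ j → ∀ t, cnt (bodyPart ℓ a c d (j + 1)) t ≤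
      cnt (bodyPart ℓ a c d j) t := fun j hj t => H.cnt_body_anti j t (by omega)
  obtain ⟨e, A, g1, g2, g3⟩ := jdtChain_exists (a (k + 1)) (ℓ + (k + 1)) ℓ f (by
      intro j h1 h2 t
      rw [f1 (j + 1) (by omega) (by omega)]
      have h3 := hanti j h1 t
      rcases h1.eq_or_lt with rfl | h1
      · rw [f0]
        rw [hb0 t] at h3
        have := cnt_nonneg (d (ℓ + (k + 1))) t
        omega
      · rwa [f1 j h1 (by omega)]) (by
      intro _
      rw [f1 _ (by omega) (by omega), f0]
      have h3 := hanti _ le_rfl n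
      rw [hb0 n, cnt_of_ge _ n le_rfl, cnt_of_ge _ n le_rfl] at h3
      omega)
  have htail := fun t => H.cnt_tail (k + 1) t (by omega) (by omega)
  have hT : ∀ j, ℓ + (k + 1) < j → j ≤ 2 * ℓ + (k + 1) → ∀ t,
      A j t = cnt (tailPart a c d (ℓ + (k + 1))) t := by
    intro j hj
    induction j, hj using Nat.le_induction with
    | base =>
      intro h2 t
      change A (ℓ + (k + 1) + 1) t = _
      have hm := g2.moved (ℓ + (k + 1)) le_rfl (by omega)
      have h4 := hm.upper t
      have h5 := hm.le t
      rw [g2.zero _ (Or.inl le_rfl), f0] at h4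
      have h6 := cnt_nonneg (f (ℓ + (k + 1) + 1)) t
      rw [htail]
      rcases hm.lower t with h7 | ⟨s, hs, h7⟩
      · omega
      · rw [g2.zero _ (Or.inl le_rfl), f0, f1 _ (by omega) (by omega)] at h7
        have h8 := hanti _ le_rfl s
        rw [hb0] at h8
        have := cnt_mono (d (ℓ + (k + 1))) hs
        omega
    | succ j hj ih =>
      intro h2 t
      have hm := g2.moved j (by omega) (by omega)
      have hA := ih (by omega)
      have h4 := hm.upper t
      have h5 := hm.le t
      rw [hA, f1 j (by omega) (by omega)] at h4
      have h6 := cnt_nonneg (f (j + 1)) t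
      -- Bounding by the first body column shows that its successors also have count 0 where the
      -- tail is not yet exhausted.
      have hj0 : cnt (bodyPart ℓ a c d j) t ≤ cnt (bodyPart ℓ a c d (ℓ + (k + 1))) t := by
        clear ih h2 hm hA h4 h5 h6
        induction j, hj using Nat.le_induction with
        | base => exact hanti _ le_rfl t
        | succ j hj ih => exact (hanti j (by omega) t).trans ih
      rw [hb0] at hj0
      rw [htail] at h4 ⊢
      rcases hm.lower t with h7 | ⟨s, hs, h7⟩
      · omega
      · rw [hA, f1 j (by omega) (by omega), f1 (j + 1) (by omega) (by omega), htail] at h7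
        have h8 := hanti j (by omega) s
        have := cnt_mono (d (ℓ + (k + 1))) hs
        omega
  rw [g1]
  congr 1
  funext j
  apply cnt_inj
  intro t
  rw [g3]
  simp only [hf, flatColumns]
  rcases lt_trichotomy j (ℓ + (k + 1)) with h | rfl | h
  · rw [g2.zero j (by omega), g2.zero (j + 1) (by omega), if_pos (by omega), if_pos (by omega)]; ring
  · rw [g2.zero _ (by omega), hT (ℓ + (k + 1) + 1) (by omega) (by omega), if_pos le_rfl,
      if_neg (by omega), if_pos (by omega), hb0, htail]; ring
  · by_cases h1 : j < 2 * ℓ + (k + 1)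
    · rw [hT j h (by omega), hT (j + 1) (by omega) (by omega), if_neg (by omega), if_pos (by omega),
        if_neg (by omega), if_pos (by omega)]; ring
    · rcases (not_lt.1 h1).eq_or_lt with rfl | h1
      · rw [hT _ h le_rfl, g2.zero (2 * ℓ + (k + 1) + 1) (by omega), if_neg (by omega), if_pos le_rfl,
          if_neg (by omega), if_neg (by omega), if_pos (by omega), H.body_empty _ (by omega),
          show 2 * ℓ + (k + 1) - ℓ = ℓ + (k + 1) by omega]; simp
      · rw [g2.zero j (by omega), g2.zero (j + 1) (by omega), if_neg (show ¬ j ≤ ℓ + (k + 1) by omega),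
          if_neg (show ¬ j ≤ 2 * ℓ + (k + 1) by omega), if_neg (show ¬ j ≤ ℓ + k by omega),
          if_neg (show ¬ j ≤ 2 * ℓ + k by omega)]; ring

/-- The columns beyond 2ℓ are empty and make room for the tails. The leftmost tail leaves first, and
each tail crosses exactly ℓ columns to its left without meeting those already placed. -/
theorem chains_finish (H : Separated ℓ a c d) :
    jdtChains a (fun i => ℓ + i) (fun _ => ℓ) ℓ d = some (flatColumns ℓ a c d 0) := by
  have key : ∀ k, k ≤ ℓ → jdtChains a (fun i => ℓ + i) (fun _ => ℓ) k (flatColumns ℓ a c d k) =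
      some (flatColumns ℓ a c d 0) := by
    intro k
    induction k with
    | zero => intro _; rfl
    | succ k ih =>
      intro hk
      rw [jdtChains, H.chain_finish k (by omega)]
      exact ih (by omega)
  -- With no tail moved yet, this is just the separated state, since all columns beyond 2ℓ are
  -- empty.
  have : d = flatColumns ℓ a c d ℓ := by
    funext j
    unfold flatColumns
    split_ifs with h1 h2 h3
    · rfl
    · rw [H.empty j (by omega), H.body_empty j (by omega)]
    · omega
    · exact H.empty j (by omega)
  conv_lhs => rw [this]
  exact key ℓ le_rfl

theorem flatColumns_body (j : ℕ) (hj : j ≤ 2 * ℓ) :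
    flatColumns ℓ a c d 0 j = bodyPart ℓ a c d j := by
  unfold flatColumns
  split_ifs with h1 h2
  · unfold bodyPart; rw [if_pos (by omega)]
  · rfl
  · omega
  · omega

theorem flatColumns_tail (k : ℕ) (h1 : 1 ≤ k) (h2 : k ≤ ℓ) :
    flatColumns ℓ a c d 0 (2 * ℓ + k) = tailPart a c d (ℓ + k) := by
  unfold flatColumns
  rw [if_neg (by omega), if_neg (by omega), if_pos (by omega), show 2 * ℓ + k - ℓ = ℓ + k by omega]

theorem flatColumns_empty (j : ℕ) (h : 3 * ℓ < j) : flatColumns ℓ a c d 0 j = ∅ := by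
  unfold flatColumns
  rw [if_neg (by omega), if_neg (by omega), if_neg (by omega)]

end Separated

end BodyTail

/-! ### The signature rule on lists -/

/-- The data `ε`, `⟨wt, h⟩`, `ẽ` of a crystal for one vertex of the Dynkin diagram. -/
structure Sig (β : Type) where
  eps : β → ℤ
  w : β → ℤ
  e : β → Option β
  eps_nonneg : ∀ b, 0 ≤ eps b
  e_none : ∀ b, eps b = 0 → e b = none

namespace Sig

variable {β : Type} (σ : Sig β)

/-- `ε` on the tensor product of the members of a list. -/
def listEps : List β → ℤ
  | [] => 0
  | b :: l => max (σ.eps b) (listEps l - σ.w b)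

/-- `⟨wt, h⟩` on the tensor product of the members of a list. -/
def listW : List β → ℤ
  | [] => 0
  | b :: l => σ.w b + listW l

/-- `ẽ` on the tensor product of the members of a list. -/
def listE : List β → Option (List β)
  | [] => none
  | b :: l => if σ.listEps l ≤ σ.eps b + σ.w b then (σ.e b).map (· :: l) else (listE l).map (b :: ·)

theorem listEps_nonneg (l : List β) : 0 ≤ σ.listEps l := by
  cases l with
  | nil => exact le_rfl
  | cons b l => exact le_max_of_le_left (σ.eps_nonneg b)

theorem listE_none (l : List β) (h : σ.listEps l = 0) : σ.listE l = none := by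
  induction l with
  | nil => rfl
  | cons b l ih =>
    have h1 := σ.eps_nonneg b
    have h2 := σ.listEps_nonneg l
    simp only [listEps] at h
    have hb : σ.eps b = 0 := by have := le_max_left (σ.eps b) (σ.listEps l - σ.w b); omega
    have hl : σ.listEps l - σ.w b ≤ 0 := by have := le_max_right (σ.eps b) (σ.listEps l - σ.w b); omega
    simp only [listE]
    rw [σ.e_none b hb]
    rw [if_pos (by omega)]
    rfl

theorem listEps_append (l₁ l₂ : List β) :
    σ.listEps (l₁ ++ l₂) = max (σ.listEps l₁) (σ.listEps l₂ - σ.listW l₁) := by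
  induction l₁ with
  | nil =>
    have := σ.listEps_nonneg l₂
    simp [listEps, listW, this]
  | cons b l ih =>
    simp only [List.cons_append, listEps, listW, ih]
    omega

/-- The associativity of the tensor product rule: the two blocks act as two factors with the block
values of ε and of the weight. -/
theorem listE_append (l₁ l₂ : List β) : σ.listE (l₁ ++ l₂) =
    if σ.listEps l₂ ≤ σ.listEps l₁ + σ.listW l₁ then (σ.listE l₁).map (· ++ l₂)
    else (σ.listE l₂).map (l₁ ++ ·) := by
  induction l₁ with
  | nil =>
    simp only [List.nil_append, listE, Option.map_none]
    split_ifs with h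
    · have := σ.listEps_nonneg l₂
      simp only [listEps, listW] at h
      exact σ.listE_none l₂ (by omega)
    · simp
  | cons b l ih =>
    have hE : ∀ b l, σ.listE (b :: l) = if σ.listEps l ≤ σ.eps b + σ.w b then (σ.e b).map (· :: l)
      else (σ.listE l).map (b :: ·) := fun _ _ => rfl
    have hp : σ.listEps (b :: l) = max (σ.eps b) (σ.listEps l - σ.w b) := rfl
    have hw : σ.listW (b :: l) = σ.w b + σ.listW l := rfl
    rw [List.cons_append, hE, hE b l, ih, listEps_append, hp, hw]
    by_cases h1 : σ.listEps l ≤ σ.eps b + σ.w b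
    · by_cases h2 : σ.listEps l₂ - σ.listW l ≤ σ.eps b + σ.w b
      · rw [if_pos (by omega), if_pos (by omega), if_pos h1, Option.map_map]; rfl
      · rw [if_neg (by omega), if_neg (by omega), if_neg (by omega), Option.map_map]; rfl
    · by_cases h2 : σ.listEps l₂ ≤ σ.listEps l + σ.listW l
      · rw [if_neg (by omega), if_pos h2, if_pos (by omega), if_neg h1, Option.map_map,
          Option.map_map]; rfl
      · rw [if_neg (by omega), if_neg h2, if_neg (by omega), Option.map_map]; rfl

theorem length_of_listE {l l' : List β} (h : σ.listE l = some l') : l'.length = l.length := by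
  induction l generalizing l' with
  | nil => simp [listE] at h
  | cons b l ih =>
    simp only [listE] at h
    split_ifs at h
    · obtain ⟨x, -, rfl⟩ := Option.map_eq_some_iff.1 h; simp
    · obtain ⟨x, hx, rfl⟩ := Option.map_eq_some_iff.1 h; simp [ih hx]

/-- Which block ẽ acts on depends only on the values of ε and of the weight of the blocks. So a
middle block may be exchanged for one with the same values, and ẽ then acts in the same place:
outside the block, or inside both p and q. -/
theorem listE_replace {l₁ p l₂ q x : List β} (heps : σ.listEps p = σ.listEps q)
    (hw : σ.listW p = σ.listW q) (h : σ.listE (l₁ ++ (p ++ l₂)) = some x) :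
    ∃ l₁' p' l₂', x = l₁' ++ (p' ++ l₂') ∧ l₁'.length = l₁.length ∧ p'.length = p.length ∧
      ((p' = p ∧ σ.listE (l₁ ++ (q ++ l₂)) = some (l₁' ++ (q ++ l₂'))) ∨
        (l₁' = l₁ ∧ l₂' = l₂ ∧ σ.listE p = some p' ∧
          ∀ q', σ.listE q = some q' → σ.listE (l₁ ++ (q ++ l₂)) = some (l₁ ++ (q' ++ l₂)))) := by
  simp only [listE_append, listEps_append, heps, hw] at h ⊢
  split_ifs at h with h1 h2
  · obtain ⟨y, hy, rfl⟩ := Option.map_eq_some_iff.1 h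
    refine ⟨y, p, l₂, rfl, σ.length_of_listE hy, rfl, Or.inl ⟨rfl, ?_⟩⟩
    rw [if_pos h1, hy]; rfl
  · obtain ⟨y, hy, rfl⟩ := Option.map_eq_some_iff.1 h
    obtain ⟨z, hz, rfl⟩ := Option.map_eq_some_iff.1 hy
    refine ⟨l₁, z, l₂, rfl, rfl, σ.length_of_listE hz, Or.inr ⟨rfl, rfl, hz, fun q' hq => ?_⟩⟩
    rw [if_neg h1, if_pos h2, hq]; rfl
  · obtain ⟨y, hy, rfl⟩ := Option.map_eq_some_iff.1 h
    obtain ⟨z, hz, rfl⟩ := Option.map_eq_some_iff.1 hy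
    refine ⟨l₁, p, z, rfl, rfl, rfl, Or.inl ⟨rfl, ?_⟩⟩
    rw [if_neg h1, if_neg h2, hz]; rfl

theorem listEps_replace {l₁ p l₂ q : List β} (heps : σ.listEps p = σ.listEps q)
    (hw : σ.listW p = σ.listW q) :
    σ.listEps (l₁ ++ (p ++ l₂)) = σ.listEps (l₁ ++ (q ++ l₂)) := by
  simp only [listEps_append, heps, hw]

end Sig

/-! ### Commutation of `ẽ_i`, `i < n`, and `ℱ` -/

section Commutation

variable {n : ℕ}

open Col

/-- The signature data of columns for the vertex `i`. -/
def colSig (i : Fin n) : Sig (Col n) where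
  eps := Col.eps i
  w U := Col.phi i U - Col.eps i U
  e := Col.e i
  eps_nonneg U := by unfold Col.eps; split_ifs <;> norm_num
  e_none U h := by
    unfold Col.eps at h
    unfold Col.e
    split_ifs at h ⊢ <;> simp_all

theorem bar_ne_bar_succ (i : Fin n) (h : i.1 + 1 < n) : bar i ≠ bar ⟨i.1 + 1, h⟩ := by
  intro hh
  have := congrArg letterIdx hh
  simp only [letterIdx_bar] at this
  omega

theorem cnt_swap (U : Col n) (x y : Letter n) (hx : x ∈ U) (hy : y ∉ U)
    (hxy : letterIdx y = letterIdx x + 1) (t : ℕ) :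
    cnt (insert y (U.erase x)) t = cnt U t - if t = letterIdx x + 1 then 1 else 0 := by
  rw [cnt_insert _ _ (by simp [hy]), cnt_erase _ _ hx, hxy]
  split_ifs <;> omega

/-- Only moving the letter ī or the letter after it in the crystal chain could change the signature.
Every change is excluded by D having its last maximum at the moved letter x: for x = ī look two
places further, for the other letter one place back. -/
theorem FStep.pair_invariant (i : Fin n) (hi : i.1 + 1 < n) {R L R' L' : Col n}
    (h : FStep (R, L) (R', L')) :
    (colSig i).listEps [R, L] = (colSig i).listEps [R', L'] ∧
      (colSig i).listW [R, L] = (colSig i).listW [R', L'] := by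
  obtain ⟨x, hx1, hx2, hS, h1, h2⟩ := h
  rw [Prod.mk.injEq] at hS
  obtain ⟨rfl, rfl⟩ := hS
  dsimp only at hx1 hx2
  have hne := bar_ne_bar_succ i hi
  have e1 := cnt_succ R i.1
  have e2 := cnt_succ R (i.1 + 1)
  have e3 := cnt_succ L i.1
  have e4 := cnt_succ L (i.1 + 1)
  rw [has_fin] at e1 e3
  rw [has_fin _ (⟨i.1 + 1, hi⟩ : Fin n)] at e2 e4
  simp only [Sig.listEps, Sig.listW, colSig, Col.eps, Col.phi, hi, dite_true, Finset.mem_erase,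
    Finset.mem_insert]
  by_cases c1 : x = bar i
  · rw [c1] at hx1 hx2 h1 h2 ⊢
    have f2 := h2 (i.1 + 1 + 1) (by rw [letterIdx_bar]; omega)
    unfold colDiff at f2
    simp only [letterIdx_bar] at f2
    simp only [hx1, hx2, if_true, if_false] at e1 e3
    by_cases b1 : bar ⟨i.1 + 1, hi⟩ ∈ R <;> by_cases b2 : bar ⟨i.1 + 1, hi⟩ ∈ L <;>
      simp [hx1, hx2, b1, b2, hne.symm] at e2 e4 ⊢
    omega
  · by_cases c2 : x = bar ⟨i.1 + 1, hi⟩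
    · subst c2
      have f2 := h1 i.1
      unfold colDiff at f2
      simp only [letterIdx_bar] at f2
      by_cases b1 : bar i ∈ R <;> by_cases b2 : bar i ∈ L <;>
        simp [hx1, hx2, b1, b2, hne] at e1 e3 ⊢
      omega
    · simp only [show bar i ≠ x from Ne.symm c1, show bar ⟨i.1 + 1, hi⟩ ≠ x from Ne.symm c2,
        false_or, true_and, ne_eq, not_false_eq_true]

theorem colSig_listE_pair (i : Fin n) (hi : i.1 + 1 < n) (R L : Col n) :
    (colSig i).listE [R, L] =
      if bar i ∈ L ∧ bar ⟨i.1 + 1, hi⟩ ∉ L ∧ ¬ (bar i ∉ R ∧ bar ⟨i.1 + 1, hi⟩ ∈ R) then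
        some [R, insert (bar ⟨i.1 + 1, hi⟩) (L.erase (bar i))]
      else if bar i ∈ R ∧ bar ⟨i.1 + 1, hi⟩ ∉ R then
        some [insert (bar ⟨i.1 + 1, hi⟩) (R.erase (bar i)), L]
      else none := by
  simp only [Sig.listE, Sig.listEps, colSig, Col.eps, Col.phi, Col.e, hi, dite_true]
  by_cases a1 : bar i ∈ R <;> by_cases a2 : bar ⟨i.1 + 1, hi⟩ ∈ R <;> by_cases a3 : bar i ∈ L <;>
    by_cases a4 : bar ⟨i.1 + 1, hi⟩ ∈ L <;> simp [a1, a2, a3, a4]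

/-- ẽ_i changes D only at the place i + 1, counted from 0, by one unit. If this displaces the last
maximum, then ℱ moves the other one of the two letters, and ẽ_i acts on the other column after ℱ.
Otherwise ℱ moves the same letter x before and after ẽ_i. -/
theorem FStep.pair_comm (i : Fin n) (hi : i.1 + 1 < n) {R L R' L' : Col n} {p : List (Col n)}
    (h : FStep (R, L) (R', L')) (hp : (colSig i).listE [R, L] = some p) :
    ∃ R₁ L₁ R₁' L₁', p = [R₁, L₁] ∧ FStep (R₁, L₁) (R₁', L₁') ∧
      (colSig i).listE [R', L'] = some [R₁', L₁'] := by
  obtain ⟨x, hx1, hx2, hS, h1, h2⟩ := h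
  rw [Prod.mk.injEq] at hS
  obtain ⟨rfl, rfl⟩ := hS
  dsimp only at hx1 hx2
  have hne := bar_ne_bar_succ i hi
  have e1 := cnt_succ R i.1
  have e2 := cnt_succ R (i.1 + 1)
  have e3 := cnt_succ L i.1
  have e4 := cnt_succ L (i.1 + 1)
  rw [has_fin] at e1 e3
  rw [has_fin _ (⟨i.1 + 1, hi⟩ : Fin n)] at e2 e4
  have hab : letterIdx (bar ⟨i.1 + 1, hi⟩) = letterIdx (bar i) + 1 := rfl
  have hia : letterIdx (bar i) = i.1 := rfl
  simp only [colDiff] at h1 h2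
  rw [colSig_listE_pair i hi] at hp
  split_ifs at hp with hc hc'
  · -- `ẽ_i` acts on the left column
    obtain rfl := Option.some.inj hp
    obtain ⟨c1, c2, c3⟩ := hc
    have hsw := cnt_swap L _ _ c1 c2 hab
    rw [hia] at hsw
    simp only [c1, c2, if_true, if_false, add_zero] at e3 e4
    have hxa : x ≠ bar i := by rintro rfl; exact hx2 c1
    -- Here D takes its maximum at i and at i + 1; ẽ_i destroys the second, so the moved letter
    -- becomes `bar i`.
    by_cases hxb : x = bar ⟨i.1 + 1, hi⟩
    · subst hxb
      have c4 : bar i ∈ R := by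
        by_contra h; exact c3 ⟨h, hx1⟩
      simp only [c4, hx1, if_true] at e1 e2
      refine ⟨_, _, R.erase (bar i), insert (bar i) (insert (bar ⟨i.1 + 1, hi⟩) (L.erase (bar i))), rfl,
        ⟨bar i, c4, by simp [hne], rfl, ?_, ?_⟩, ?_⟩
      · intro t
        have := h1 t
        simp only [colDiff, hsw, hia, hab] at this ⊢
        split_ifs <;> omega
      · intro t ht
        simp only [colDiff, hsw, hia, hab] at ht h2 ⊢
        rcases eq_or_ne t (i.1 + 1) with rfl | h
        · split_ifs <;> omega
        · have := h2 t (by omega)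
          split_ifs <;> omega
      · rw [colSig_listE_pair i hi, if_neg (by simp), if_pos (by simp [c4, hne])]
        congr 2
        · ext y; simp only [Finset.mem_insert, Finset.mem_erase]; grind
        · congr 1
          ext y; simp only [Finset.mem_insert, Finset.mem_erase]; grind
    · refine ⟨_, _, R.erase x, insert x (insert (bar ⟨i.1 + 1, hi⟩) (L.erase (bar i))), rfl,
        ⟨x, hx1, by simp [hx2, hxb], rfl, ?_, ?_⟩, ?_⟩
      · intro t
        have := h1 t
        have hx : letterIdx x ≠ i.1 + 1 := fun h => hxb (letterIdx_inj h)
        simp only [colDiff, hsw]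
        split_ifs <;> omega
      · intro t ht
        have := h2 t ht
        have hx : letterIdx x ≠ i.1 + 1 := fun h => hxb (letterIdx_inj h)
        simp only [colDiff, hsw]
        split_ifs <;> omega
      · rw [colSig_listE_pair i hi, if_pos (by
          simp only [Finset.mem_insert, Finset.mem_erase, c1, c2, or_true, true_and, or_false]
          refine ⟨Ne.symm hxb, ?_⟩
          rintro ⟨k1, k2⟩
          exact c3 ⟨fun k => k1 ⟨Ne.symm hxa, k⟩, k2.2⟩)]
        congr 3
        ext y; simp only [Finset.mem_insert, Finset.mem_erase]; grind
  · -- `ẽ_i` acts on the right column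
    obtain rfl := Option.some.inj hp
    obtain ⟨c1, c2⟩ := hc'
    have c3 : ¬ (bar i ∈ L ∧ bar ⟨i.1 + 1, hi⟩ ∉ L) := fun h => hc ⟨h.1, h.2, fun h' => h'.1 c1⟩
    have hsw := cnt_swap R _ _ c1 c2 hab
    rw [hia] at hsw
    simp only [c1, c2, if_true, if_false, add_zero] at e1 e2
    have hxb : x ≠ bar ⟨i.1 + 1, hi⟩ := by rintro rfl; exact c2 hx1
    -- The rise of D at i + 1 creates a new last maximum there, just after the one at i; so the
    -- moved letter becomes the one with index i + 1.
    by_cases hxa : x = bar i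
    · rw [hxa] at hx1 hx2 h1 h2 ⊢
      have c4 : bar ⟨i.1 + 1, hi⟩ ∉ L := by
        intro h
        have f2 := h2 (i.1 + 1 + 1) (by rw [hia]; omega)
        simp only [hx2, h, if_true, if_false, hia] at e3 e4 f2
        omega
      simp only [hx2, c4, if_false, add_zero] at e3 e4
      refine ⟨_, _, R.erase (bar i), insert (bar ⟨i.1 + 1, hi⟩) L, rfl,
        ⟨bar ⟨i.1 + 1, hi⟩, by simp, c4, ?_, ?_, ?_⟩, ?_⟩
      · rw [Prod.mk.injEq]
        refine ⟨?_, rfl⟩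
        ext y; simp only [Finset.mem_insert, Finset.mem_erase]; grind
      · intro t
        have := h1 t
        simp only [colDiff, hsw, hia, hab, if_true] at this ⊢
        split_ifs with h
        · subst h; omega
        · omega
      · intro t ht
        rw [hab, hia] at ht
        have := h2 t (by omega)
        simp only [colDiff, hsw, hia, hab, if_true] at this ⊢
        split_ifs with h
        · subst h; omega
        · omega
      · rw [colSig_listE_pair i hi, if_pos (by simp [c2, c4, hne.symm])]
        congr 3
        ext y; simp only [Finset.mem_insert, Finset.mem_erase]; grind
    · have hx : letterIdx x ≠ i.1 := fun h => hxa (letterIdx_inj h)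
      have hx' : letterIdx x ≠ i.1 + 1 := fun h => hxb (letterIdx_inj h)
      -- As ẽ_i acts on the right column, the raised value of D at i + 1 is either at most the value
      -- at i or equal to the value at i + 2, so no new maximum appears.
      have hL : cnt L (i.1 + 1) ≤ cnt L i.1 ∨ cnt L (i.1 + 1 + 1) = cnt L (i.1 + 1) + 1 := by
        by_cases d1 : bar i ∈ L
        · have d2 : bar ⟨i.1 + 1, hi⟩ ∈ L := by by_contra d2; exact c3 ⟨d1, d2⟩
          right; simpa [d2] using e4
        · left; simp [d1] at e3; omega
      refine ⟨_, _, (insert (bar ⟨i.1 + 1, hi⟩) (R.erase (bar i))).erase x, insert x L, rfl,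
        ⟨x, by simp [hx1, hxa], hx2, rfl, ?_, ?_⟩, ?_⟩
      · intro t
        have f0 := h1 t
        have f1 := h1 i.1
        have f2 := h1 (i.1 + 1 + 1)
        have hs := has_le_one L i.1
        rw [has_fin] at hs
        simp only [colDiff, hsw]
        rcases eq_or_ne t (i.1 + 1) with rfl | h
        · split_ifs at * <;> omega
        · rw [if_neg h, if_neg hx']; omega
      · intro t ht
        have f0 := h2 t ht
        simp only [colDiff, hsw]
        rcases eq_or_ne t (i.1 + 1) with rfl | h
        · have f1 := h2 i.1 (by omega)
          have f2 := h2 (i.1 + 1 + 1) (by omega)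
          rw [if_pos rfl, if_neg hx']
          have hs : cnt L (i.1 + 1) ≤ cnt L i.1 + 1 := by
            rw [e3]; split_ifs <;> omega
          omega
        · rw [if_neg h, if_neg hx']; omega
      · rw [colSig_listE_pair i hi, if_neg (by
          rintro ⟨k1, k2, -⟩
          simp only [Finset.mem_insert, not_or] at k1 k2
          exact c3 ⟨k1.resolve_left (Ne.symm hxa), k2.2⟩), if_pos (by
          simp only [Finset.mem_erase]
          exact ⟨⟨Ne.symm hxa, c1⟩, fun k => c2 k.2⟩)]
        congr 2
        ext y; simp only [Finset.mem_insert, Finset.mem_erase]; grind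

end Commutation

/-! ### Commutation of `ẽ_i`, `i < n`, and the operators `ℱ_j` -/

section SequenceCommutation

variable {n : ℕ}

open Col

/-- The columns with indices `s`, …, `s + M - 1`. -/
def seqList {β : Type} (c : ℕ → β) (s M : ℕ) : List β := (List.range' s M).map c

theorem length_seqList {β : Type} (c : ℕ → β) (s M : ℕ) : (seqList c s M).length = M := by
  simp [seqList]

theorem seqList_append {β : Type} (c : ℕ → β) (s k m : ℕ) :
    seqList c s (k + m) = seqList c s k ++ seqList c (s + k) m := by
  unfold seqList
  rw [← List.map_append, List.range'_append_1]

theorem seqList_congr {β : Type} {c d : ℕ → β} {s M : ℕ} (h : ∀ j, s ≤ j → j < s + M → c j = d j) :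
    seqList c s M = seqList d s M :=
  List.map_congr_left fun j hj => h j (List.mem_range'_1.1 hj).1 (List.mem_range'_1.1 hj).2

theorem seqList_inj {β : Type} {c d : ℕ → β} {s M : ℕ} (h : seqList c s M = seqList d s M) (j : ℕ)
    (h1 : s ≤ j) (h2 : j < s + M) : c j = d j :=
  List.map_inj_left.1 h j (List.mem_range'_1.2 ⟨h1, h2⟩)

theorem seqList_split {β : Type} (c : ℕ → β) {s M j : ℕ} (h1 : s ≤ j) (h2 : j + 1 < s + M) :
    seqList c s M = seqList c s (j - s) ++ ([c j, c (j + 1)] ++ seqList c (j + 2) (s + M - (j + 2))) := by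
  obtain ⟨k, rfl⟩ := Nat.exists_eq_add_of_le h1
  obtain ⟨m, rfl⟩ : ∃ m, M = k + (2 + m) := ⟨M - k - 2, by omega⟩
  rw [seqList_append, seqList_append, show s + k - s = k by omega,
    show s + (k + (2 + m)) - (s + k + 2) = m by omega]
  rfl

/-- `ẽ_i` sends the columns of `c` with indices `s`, …, `s + M - 1` to those of `c'`. -/
def Raises (i : Fin n) (s M : ℕ) (c c' : ℕ → Col n) : Prop :=
  (colSig i).listE (seqList c s M) = some (seqList c' s M) ∧ ∀ j, j < s ∨ s + M ≤ j → c' j = c j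

/-- A partial map on sequences of columns is injective, and compatible with the `𝔩`-crystal
structure given by the columns with indices `s`, …, `s + M - 1`. -/
structure LeviCompat (n s M : ℕ) (F : (ℕ → Col n) → Option (ℕ → Col n)) : Prop where
  inj : ∀ c c' d, F c = some d → F c' = some d → c = c'
  wt : ∀ g c d, F c = some d →
    ((seqList d s M).map (Col.wtL g)).sum = ((seqList c s M).map (Col.wtL g)).sum
  eps : ∀ (i : Fin n) c d, i.1 + 1 < n → F c = some d →
    (colSig i).listEps (seqList d s M) = (colSig i).listEps (seqList c s M)
  comm : ∀ (i : Fin n) c c' d, i.1 + 1 < n → F c = some d → Raises i s M c c' →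
    ∃ d', F c' = some d' ∧ Raises i s M d d'

namespace LeviCompat

variable {s M : ℕ} {F F' : (ℕ → Col n) → Option (ℕ → Col n)}

theorem pure : LeviCompat n s M some where
  inj c c' d h h' := by rw [Option.some.inj h, Option.some.inj h']
  wt g c d h := by rw [Option.some.inj h]
  eps i c d _ h := by rw [Option.some.inj h]
  comm i c c' d _ h h' := ⟨c', rfl, by rwa [← Option.some.inj h]⟩

theorem bind (H : LeviCompat n s M F) (H' : LeviCompat n s M F') :
    LeviCompat n s M fun c => (F c).bind F' where
  inj c c' d h h' := by
    obtain ⟨e, h1, h2⟩ := Option.bind_eq_some_iff.1 h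
    obtain ⟨e', h1', h2'⟩ := Option.bind_eq_some_iff.1 h'
    obtain rfl := H'.inj _ _ _ h2 h2'
    exact H.inj _ _ _ h1 h1'
  wt g c d h := by
    obtain ⟨e, h1, h2⟩ := Option.bind_eq_some_iff.1 h
    rw [H'.wt g _ _ h2, H.wt g _ _ h1]
  eps i c d hi h := by
    obtain ⟨e, h1, h2⟩ := Option.bind_eq_some_iff.1 h
    rw [H'.eps i _ _ hi h2, H.eps i _ _ hi h1]
  comm i c c' d hi h h' := by
    obtain ⟨e, h1, h2⟩ := Option.bind_eq_some_iff.1 h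
    obtain ⟨e', h3, h4⟩ := H.comm i _ _ _ hi h1 h'
    obtain ⟨d', h5, h6⟩ := H'.comm i _ _ _ hi h2 h4
    exact ⟨d', by rw [h3]; exact h5, h6⟩

/-- ℱ_j replaces a block of two columns by one with the same ε and weight, so `Sig.listE_replace`
leaves two cases: ẽ_i acts outside the block, or inside it, where `FStep.pair_comm` applies. -/
theorem jdtFAt {j : ℕ} (h1 : s ≤ j) (h2 : j + 1 < s + M) : LeviCompat n s M (jdtFAt j) where
  inj c c' d h h' := by
    rw [jdtFAt_eq_some_iff] at h h'
    have := h.1.injective h'.1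
    rw [Prod.mk.injEq] at this
    funext k
    by_cases hk : k = j
    · rw [hk]; exact this.1
    by_cases hk' : k = j + 1
    · rw [hk']; exact this.2
    rw [← h.2 k hk hk', ← h'.2 k hk hk']
  wt g c d h := by
    rw [jdtFAt_eq_some_iff] at h
    obtain ⟨⟨x, hx1, hx2, hS, -⟩, hd⟩ := h
    rw [Prod.mk.injEq] at hS
    dsimp only at hx1 hx2 hS
    rw [seqList_split c h1 h2, seqList_split d h1 h2,
      seqList_congr (s := s) fun k _ _ => hd k (by omega) (by omega),
      seqList_congr (s := j + 2) fun k _ _ => hd k (by omega) (by omega)]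
    simp only [List.map_append, List.map_cons, List.map_nil, List.sum_append, List.sum_cons,
      List.sum_nil, hS.1, hS.2, wtL_erase _ _ _ hx1, wtL_insert _ _ _ hx2]
    abel
  eps i c d hi h := by
    rw [jdtFAt_eq_some_iff] at h
    obtain ⟨h, hd⟩ := h
    obtain ⟨h3, h4⟩ := h.pair_invariant i hi
    rw [seqList_split c h1 h2, seqList_split d h1 h2,
      seqList_congr (s := s) fun k _ _ => hd k (by omega) (by omega),
      seqList_congr (s := j + 2) fun k _ _ => hd k (by omega) (by omega)]
    exact Sig.listEps_replace _ h3.symm h4.symm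
  comm i c c' d hi h h' := by
    rw [jdtFAt_eq_some_iff] at h
    obtain ⟨hF, hd⟩ := h
    obtain ⟨h', hc⟩ := h'
    obtain ⟨h3, h4⟩ := hF.pair_invariant i hi
    have hdL : seqList d s M = seqList c s (j - s) ++ ([d j, d (j + 1)] ++
        seqList c (j + 2) (s + M - (j + 2))) := by
      rw [seqList_split d h1 h2,
        seqList_congr (s := s) fun k _ _ => hd k (by omega) (by omega),
        seqList_congr (s := j + 2) fun k _ _ => hd k (by omega) (by omega)]
    rw [seqList_split c h1 h2] at h'
    obtain ⟨l₁, p, l₂, hx, hl1, hlp, hcase⟩ := Sig.listE_replace _ h3 h4 h'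
    rw [seqList_split c' h1 h2] at hx
    obtain ⟨g1, hx⟩ := List.append_inj hx (by rw [hl1, length_seqList, length_seqList])
    obtain ⟨g2, g3⟩ := List.append_inj hx (by rw [hlp]; rfl)
    have key : ∀ R L : Col n, FStep (c' j, c' (j + 1)) (R, L) →
        (colSig i).listE (seqList d s M) = some (l₁ ++ ([R, L] ++ l₂)) →
        ∃ d', _root_.jdtFAt j c' = some d' ∧ Raises i s M d d' := by
      intro R L hS hE
      refine ⟨Function.update (Function.update c' j R) (j + 1) L, ?_, ?_, ?_⟩
      · rw [jdtFAt_eq_some_iff]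
        exact ⟨by simpa using hS, fun k k1 k2 => by simp [k1, k2]⟩
      · rw [hE, seqList_split _ h1 h2, ← g1, ← g3,
          seqList_congr (c := c') (s := s) (M := j - s)
            (d := Function.update (Function.update c' j R) (j + 1) L)
            fun k _ _ => by simp [show k ≠ j by omega, show k ≠ j + 1 by omega],
          seqList_congr (c := c') (s := j + 2)
            (d := Function.update (Function.update c' j R) (j + 1) L)
            fun k _ _ => by simp [show k ≠ j by omega, show k ≠ j + 1 by omega]]
        simp
      · intro k hk
        have k1 : k ≠ j := by omega
        have k2 : k ≠ j + 1 := by omega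
        simp [k1, k2, hc k hk, hd k k1 k2]
    rcases hcase with ⟨rfl, hE⟩ | ⟨rfl, rfl, hp, hE⟩
    · simp only [List.cons.injEq, and_true] at g2
      refine key (d j) (d (j + 1)) ?_ (by rw [hdL]; exact hE)
      rw [g2.1, g2.2]; exact hF
    · obtain ⟨R₁, L₁, R₁', L₁', rfl, hS, hE'⟩ := hF.pair_comm i hi hp
      simp only [List.cons.injEq, and_true] at g2
      refine key R₁' L₁' ?_ (by rw [hdL]; exact hE _ hE')
      rw [g2.1, g2.2]; exact hS

theorem jdtFAtPow {j : ℕ} (m : ℕ) (h1 : s ≤ j) (h2 : j + 1 < s + M) :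
    LeviCompat n s M (jdtFAtPow j m) := by
  induction m with
  | zero => exact pure
  | succ m ih =>
    have : _root_.jdtFAtPow (n := n) j (m + 1) = fun c => (_root_.jdtFAt j c).bind (_root_.jdtFAtPow j m) :=
      funext fun c => jdtFAtPow_succ j m c
    rw [this]
    exact (jdtFAt h1 h2).bind ih

theorem jdtChain {a j m : ℕ} (h1 : s ≤ j) (h2 : m = 0 ∨ j + m < s + M) :
    LeviCompat n s M (jdtChain a j m) := by
  induction m generalizing j with
  | zero => exact pure
  | succ m ih =>
    have : _root_.jdtChain (n := n) a j (m + 1) =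
      fun c => (_root_.jdtFAtPow j a c).bind (_root_.jdtChain a (j + 1) m) :=
      funext fun c => jdtChain_succ a j m c
    rw [this]
    exact (jdtFAtPow a h1 (by omega)).bind (ih (by omega) (by omega))

theorem jdtChains {a j m : ℕ → ℕ} {k : ℕ} (h1 : ∀ i, 1 ≤ i → i ≤ k → s ≤ j i)
    (h2 : ∀ i, 1 ≤ i → i ≤ k → j i + m i < s + M) :
    LeviCompat n s M (jdtChains a j m k) := by
  induction k with
  | zero => exact pure
  | succ k ih =>
    exact (jdtChain (h1 _ (by omega) le_rfl) (Or.inr (h2 _ (by omega) le_rfl))).bind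
      (ih (fun i g1 g2 => h1 i g1 (by omega)) fun i g1 g2 => h2 i g1 (by omega))

end LeviCompat

end SequenceCommutation

/-! ### Crystals and the signature rule -/

namespace Crystal

variable {g : ClType} {n : ℕ} {A B β : Type}

/-- For the vertex `i`, the elements of `C` with property `P` are tensor products of lists with the
signature data `σ`. -/
structure Models (C : Crystal g n B) (i : Fin n) (σ : Sig β) (P : B → Prop) (fl : B → List β) :
    Prop where
  ε_eq : ∀ b, P b → C.ε i b = ((σ.listEps (fl b) : ℤ) : WithBot ℤ)
  e_iff : ∀ b b', P b → P b' → (C.e i b = some b' ↔ σ.listE (fl b) = some (fl b'))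
  inj : ∀ b b', P b → P b' → fl b = fl b' → b = b'
  len : ∀ b b', P b → P b' → (fl b).length = (fl b').length

/-- Lists attached to elements of one factor have constant length, so the concatenation can be cut
uniquely and the tensor rule agrees with `Sig.listE_append`. -/
theorem Models.tensor {C₁ : Crystal g n A} {C₂ : Crystal g n B} {i : Fin n} {σ : Sig β}
    {P₁ : A → Prop} {P₂ : B → Prop} {fl₁ : A → List β} {fl₂ : B → List β}
    (H₁ : C₁.Models i σ P₁ fl₁) (H₂ : C₂.Models i σ P₂ fl₂)
    (hw : ∀ a, P₁ a → C₁.wt a i = σ.listW (fl₁ a)) :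
    (C₁.tensor C₂).Models i σ (fun x => P₁ x.1 ∧ P₂ x.2) fun x => fl₁ x.1 ++ fl₂ x.2 where
  ε_eq x h := by
    change max (C₁.ε i x.1) (C₂.ε i x.2 + ((-(C₁.wt x.1 i) : ℤ) : WithBot ℤ)) = _
    rw [H₁.ε_eq _ h.1, H₂.ε_eq _ h.2, hw _ h.1, Sig.listEps_append]
    norm_cast
  e_iff x y h h' := by
    obtain ⟨a, b⟩ := x
    obtain ⟨a', b'⟩ := y
    change tensorE C₁ C₂ i (a, b) = _ ↔ _
    have hc : C₂.ε i b ≤ C₁.φ i a ↔ σ.listEps (fl₂ b) ≤ σ.listEps (fl₁ a) + σ.listW (fl₁ a) := by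
      rw [C₁.φ_eq, H₁.ε_eq _ h.1, H₂.ε_eq _ h.2, hw _ h.1, add_comm (σ.listEps (fl₁ a))]
      norm_cast
    unfold tensorE
    simp only [Sig.listE_append, hc]
    split_ifs with h1
    · simp only [Option.map_eq_some_iff, Prod.mk.injEq]
      constructor
      · rintro ⟨a'', ha, rfl, rfl⟩
        exact ⟨_, (H₁.e_iff _ _ h.1 h'.1).1 ha, rfl⟩
      · rintro ⟨y, hy, he⟩
        obtain ⟨rfl, h2⟩ := List.append_inj he (by
          rw [σ.length_of_listE hy]; exact H₁.len _ _ h.1 h'.1)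
        exact ⟨a', (H₁.e_iff _ _ h.1 h'.1).2 hy, rfl, H₂.inj _ _ h.2 h'.2 h2⟩
    · simp only [Option.map_eq_some_iff, Prod.mk.injEq]
      constructor
      · rintro ⟨b'', hb, rfl, rfl⟩
        exact ⟨_, (H₂.e_iff _ _ h.2 h'.2).1 hb, rfl⟩
      · rintro ⟨y, hy, he⟩
        obtain ⟨h2, rfl⟩ := List.append_inj he (H₁.len _ _ h.1 h'.1)
        exact ⟨b', (H₂.e_iff _ _ h.2 h'.2).2 hy, H₁.inj _ _ h.1 h'.1 h2, rfl⟩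
  inj x y h h' he := by
    obtain ⟨h1, h2⟩ := List.append_inj he (H₁.len _ _ h.1 h'.1)
    exact Prod.ext (H₁.inj _ _ h.1 h'.1 h1) (H₂.inj _ _ h.2 h'.2 h2)
  len x y h h' := by
    rw [List.length_append, List.length_append, H₁.len _ _ h.1 h'.1, H₂.len _ _ h.2 h'.2]

theorem Models.ofEquiv {C : Crystal g n A} {i : Fin n} {σ : Sig β} {P : A → Prop} {fl : A → List β}
    (H : C.Models i σ P fl) (q : B ≃ A) :
    (C.ofEquiv q).Models i σ (fun b => P (q b)) fun b => fl (q b) where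
  ε_eq b h := H.ε_eq _ h
  e_iff b b' h h' := by
    rw [← H.e_iff _ _ h h']
    simp [Crystal.ofEquiv, Option.map_eq_some_iff, Equiv.symm_apply_eq]
  inj b b' h h' he := q.injective (H.inj _ _ h h' he)
  len b b' h h' := H.len _ _ h h'

theorem Models.restrict {C : Crystal g n B} {i : Fin n} {σ : Sig β} {P : B → Prop} {fl : B → List β}
    (H : C.Models i σ P fl) (S : Set B) :
    (C.restrict S).Models i σ (fun b => P b.1) fun b => fl b.1 where
  ε_eq b h := H.ε_eq _ h
  e_iff b b' h h' := by
    rw [← H.e_iff _ _ h h']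
    exact toSub_eq_some _ _ _
  inj b b' h h' he := Subtype.ext (H.inj _ _ h h' he)
  len b b' h h' := H.len _ _ h h'

theorem Models.congr {C : Crystal g n B} {i : Fin n} {σ : Sig β} {P P' : B → Prop}
    {fl fl' : B → List β} (H : C.Models i σ P fl) (hP : ∀ b, P' b → P b) (hfl : ∀ b, fl' b = fl b) :
    C.Models i σ P' fl' where
  ε_eq b h := by rw [hfl]; exact H.ε_eq _ (hP _ h)
  e_iff b b' h h' := by rw [hfl, hfl]; exact H.e_iff _ _ (hP _ h) (hP _ h')
  inj b b' h h' he := H.inj _ _ (hP _ h) (hP _ h') (by rwa [hfl, hfl] at he)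
  len b b' h h' := by rw [hfl, hfl]; exact H.len _ _ (hP _ h) (hP _ h')

theorem Models.levi {C : Crystal g n B} {i : Fin n} {σ : Sig β} {P : B → Prop} {fl : B → List β}
    (H : C.Models i σ P fl) (hi : i.1 + 1 < n) : C.levi.Models i σ P fl where
  ε_eq b h := by simp only [Crystal.levi, hi, if_true]; exact H.ε_eq _ h
  e_iff b b' h h' := by simp only [Crystal.levi, hi, if_true]; exact H.e_iff _ _ h h'
  inj := H.inj
  len := H.len

theorem Models.tpow {C : Crystal g n B} {i : Fin n} {σ : Sig β} {fl : B → List β}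
    (H : C.Models i σ (fun _ => True) fl) (hw : ∀ b, C.wt b i = σ.listW (fl b)) (k : ℕ) :
    (C.tpow k).Models i σ (fun _ => True) fun x => (List.ofFn x).flatMap fl := by
  induction k with
  | zero =>
    exact ⟨fun _ _ => rfl, fun b b' _ _ => by simp [Crystal.tpow, unit, Sig.listE],
      fun b b' _ _ _ => Subsingleton.elim _ _, fun _ _ _ _ => by simp⟩
  | succ k ih =>
    refine ((H.tensor ih fun a _ => hw a).ofEquiv (Fin.consEquiv fun _ => B).symm).congr
      (fun _ _ => ⟨trivial, trivial⟩) fun x => ?_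
    rw [List.ofFn_succ, List.flatMap_cons]
    rfl

open FinSeq

theorem bound_le {v : β} (c : FinSeq β v) (k : ℕ) (h : ∀ j, k ≤ j → c.1 j = v) : c.bound ≤ k := by
  classical exact Nat.find_min' c.2 h

/-- The structure on the limit does not depend on the number of factors once it is large enough. One
fixed k therefore serves for all sequences which have become constant by then, and ẽ_i can be
compared inside one tensor power. -/
theorem Models.limit {D : Crystal g n B} {v : B} {i : Fin n} {σ : Sig β} {k : ℕ}
    {fl : (Fin k → B) → List β} (H : (D.tpow k).Models i σ (fun _ => True) fl)
    (hε : ∀ i, D.ε i v = 0) (he : ∀ i, D.e i v = none) (hw : D.wt v = omegaLast n) :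
    (D.limit v hε he hw).Models i σ (fun c => ∀ j, k ≤ j → c.1 j = v) fun c => fl (trunc k c.1) where
  ε_eq c h := by
    change (D.level (c.bound + 1)).ε i (trunc _ c.1, ()) = _
    rw [← level_ε_eq D v hε hw i c k (bound_le c k h), level_ε]
    exact H.ε_eq _ trivial
  e_iff c c' h h' := by
    change levelE D v i (c.bound + 1) c = _ ↔ _
    rw [← levelE_eq D v hε he hw i c k (bound_le c k h)]
    unfold levelE
    rw [map_extend_iff _ _ (bound_le c' k h'), level_e, ← H.e_iff _ _ trivial trivial,
      Option.map_eq_some_iff]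
    simp
  inj c c' h h' hh := by
    have := H.inj _ _ trivial trivial hh
    rw [← extend_trunc c (bound_le c k h), ← extend_trunc c' (bound_le c' k h'), this]
  len c c' h h' := H.len _ _ trivial trivial

theorem limit_wt {D : Crystal g n B} {v : B} (hε : ∀ i, D.ε i v = 0) (he : ∀ i, D.e i v = none)
    (hw : D.wt v = omegaLast n) (c : FinSeq B v) (k : ℕ) (h : ∀ j, k ≤ j → c.1 j = v) :
    (D.limit v hε he hw).wt c = (D.tpow k).wt (trunc k c.1) - (k : ℤ) • omegaLast n := by
  change (D.level (c.bound + 1)).wt (trunc _ c.1, ()) = _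
  rw [← level_wt_eq D v hw c k (bound_le c k h), sub_eq_add_neg]
  rfl

theorem tensor_ε_of_bot (C₁ : Crystal g n A) (C₂ : Crystal g n B) (i : Fin n) (x : A × B)
    (h : C₂.ε i x.2 = ⊥) : (C₁.tensor C₂).ε i x = C₁.ε i x.1 := by
  change max _ (C₂.ε i x.2 + _) = _
  simp [h]

theorem tensor_e_of_bot (C₁ : Crystal g n A) (C₂ : Crystal g n B) (i : Fin n) (x : A × B)
    (h : C₂.ε i x.2 = ⊥) : (C₁.tensor C₂).e i x = (C₁.e i x.1).map fun a => (a, x.2) := by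
  change tensorE C₁ C₂ i x = _
  unfold tensorE
  rw [if_pos (by rw [h]; exact bot_le)]

theorem tpow_wt_sum (C : Crystal g n B) (k : ℕ) (x : Fin k → B) :
    (C.tpow k).wt x = ((List.ofFn x).map C.wt).sum := by
  induction k with
  | zero => simp [tpow, unit]
  | succ k ih =>
    rw [List.ofFn_succ, List.map_cons, List.sum_cons, ← ih]
    rfl

/-- A map which is total and injective, and which preserves `wt`, `ε_i`, `ẽ_i`, is an embedding. -/
theorem isEmbedding_of_e {C₁ : Crystal g n A} {C₂ : Crystal g n B} {ψ : A → Option B} (F : A → B)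
    (hψ : ∀ a, ψ a = some (F a)) (hinj : Function.Injective F) (hwt : ∀ a, C₂.wt (F a) = C₁.wt a)
    (hε : ∀ i a, C₂.ε i (F a) = C₁.ε i a)
    (he : ∀ i a a', C₁.e i a = some a' → C₂.e i (F a) = some (F a')) : IsEmbedding C₁ C₂ ψ := by
  obtain rfl : ψ = fun a => some (F a) := funext hψ
  have hF : ∀ {a b}, some (F a) = some b → b = F a := fun h => (Option.some.inj h).symm
  refine ⟨⟨fun a b h => ?_, fun a b h i => ?_, fun a b h i => ?_, fun i a a' b b' h1 h2 h3 => ?_,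
    fun i a a' b b' h1 h2 h3 => ?_⟩, ?_⟩
  · rw [hF h]; exact hwt a
  · rw [hF h]; exact hε i a
  · rw [hF h, φ_eq, φ_eq, hwt, hε]
  · rw [hF h2, hF h3]; exact he i a a' h1
  · rw [hF h2, hF h3, f_iff]; exact he i a' a ((f_iff _ _ _ _).1 h1)
  · intro x y h
    cases x <;> cases y <;> simp at h ⊢
    exact hinj h

end Crystal

/-! ### The crystals of columns -/

section ColumnModels

variable {n : ℕ}

open Col

theorem colLevi_models (g : ClType) (i : Fin n) (hi : i.1 + 1 < n) :
    (colLevi g n).Models i (colSig i) (fun _ => True) fun U => [U] where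
  ε_eq U _ := by
    have : 0 ≤ eps i U := (colSig i).eps_nonneg U
    have h : (colSig i).listEps [U] = eps i U := by
      simp only [Sig.listEps, colSig, Col.phi, Col.eps, hi, dite_true]; split_ifs <;> grind
    rw [h]
    simp [colLevi, hi]
  e_iff U V _ _ := by
    have h : (colSig i).listEps [] ≤ (colSig i).eps U + (colSig i).w U := by
      simp only [Sig.listEps, colSig, Col.phi, Col.eps, hi, dite_true]; split_ifs <;> grind
    simp only [Sig.listE, if_pos h, colLevi, hi, if_true]
    simp [colSig]
  inj U V _ _ h := by simpa using h
  len _ _ _ _ := rfl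

theorem colLevi_wt (g : ClType) (i : Fin n) (hi : i.1 + 1 < n) (U : Col n) :
    (colLevi g n).wt U i = (colSig i).listW [U] := by
  simp only [Sig.listW, colSig, add_zero]
  rw [phi_eq_of_lt g i hi]
  simp [colLevi]

theorem spinCrystal_models (i : Fin n) :
    (spinCrystal n).Models i (colSig i) (fun _ => True) fun U => [U] where
  ε_eq U _ := by
    have h : (colSig i).listEps [U] = eps i U := by
      simp only [Sig.listEps, colSig, Col.phi, Col.eps]; split_ifs <;> grind
    rw [h]
    rfl
  e_iff U V _ _ := by
    have h : (colSig i).listEps [] ≤ (colSig i).eps U + (colSig i).w U := by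
      simp only [Sig.listEps, colSig, Col.phi, Col.eps]; split_ifs <;> grind
    simp only [Sig.listE, if_pos h]
    simp [colSig, spinCrystal]
  inj U V _ _ h := by simpa using h
  len _ _ _ _ := rfl

theorem spinCrystal_wt (i : Fin n) (U : Col n) :
    (spinCrystal n).wt U i = (colSig i).listW [U] := by
  have h := (spinCrystal n).φ_eq i U
  simp only [Sig.listW, colSig, add_zero]
  have h' : phi i U = (spinCrystal n).wt U i + eps i U := by
    have : ((phi i U : ℤ) : WithBot ℤ) = (((spinCrystal n).wt U i + eps i U : ℤ) : WithBot ℤ) := by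
      push_cast; exact h
    exact_mod_cast this
  omega

/-- Pairs of columns as lists of columns, for the vertices of the Levi subalgebra in type `C_n` and for
all vertices in type `B_n`. -/
theorem pairCrystal_models (g : ClType) (i : Fin n) (hi : g = .b ∨ i.1 + 1 < n) :
    (pairCrystal n g).Models i (colSig i) (fun _ => True) fun T => [T.1, T.2] := by
  cases g with
  | b =>
    exact ((spinCrystal_models i).tensor (spinCrystal_models i) fun U _ => spinCrystal_wt i U).congr
      (fun _ _ => ⟨trivial, trivial⟩) fun _ => rfl
  | c =>
    have hi : i.1 + 1 < n := by simpa using hi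
    have H := ((colLevi_models .c i hi).tensor (colLevi_models .c i hi)
      fun U _ => colLevi_wt .c i hi U).congr (P' := fun _ => True)
      (fun _ _ => ⟨trivial, trivial⟩) fun T => (rfl : [T.1, T.2] = _)
    refine ⟨fun T h => ?_, fun T S h h' => ?_, H.inj, H.len⟩
    · rw [← H.ε_eq T h]; simp [pairCrystal, dominoCrystal, dominoEps, hi]
    · rw [← H.e_iff T S h h']; simp [pairCrystal, dominoCrystal, dominoE, hi]

theorem pairCrystal_wt (g : ClType) (i : Fin n) (hi : g = .b ∨ i.1 + 1 < n) (T : Col n × Col n) :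
    (pairCrystal n g).wt T i = (colSig i).listW [T.1, T.2] := by
  cases g with
  | b =>
    change (spinCrystal n).wt T.1 i + (spinCrystal n).wt T.2 i = _
    rw [spinCrystal_wt, spinCrystal_wt]
    simp [Sig.listW]
  | c =>
    have hi : i.1 + 1 < n := by simpa using hi
    change omegaLast n i + ((colLevi .c n).wt T.1 i + (colLevi .c n).wt T.2 i) = _
    rw [omegaLast_of_lt i hi, colLevi_wt _ i hi, colLevi_wt _ i hi]
    simp [Sig.listW]

/-- The signature data of dominoes for the last vertex in type `C_n`. -/
noncomputable def dominoSig (i : Fin n) : Sig (Col n × Col n) where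
  eps T := if bar i ∈ T.1 ∧ bar i ∈ T.2 then 1 else 0
  w T := 1 - (if bar i ∈ T.1 then 1 else 0) - if bar i ∈ T.2 then 1 else 0
  e T := if bar i ∈ T.1 ∧ bar i ∈ T.2 then some (T.1.erase (bar i), T.2.erase (bar i)) else none
  eps_nonneg T := by split_ifs <;> norm_num
  e_none T h := by
    split_ifs at h ⊢
    · exact absurd h one_ne_zero
    · rfl

theorem dominoCrystal_models (i : Fin n) (hi : ¬ i.1 + 1 < n) :
    (dominoCrystal n).Models i (dominoSig i) (fun _ => True) fun T => [T] where
  ε_eq T _ := by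
    have h : (dominoSig i).listEps [T] = (dominoSig i).eps T := by
      simp only [Sig.listEps, dominoSig]; split_ifs <;> grind
    rw [h]
    simp only [dominoCrystal, dominoEps, hi, if_false, dominoSig]
    split_ifs <;> rfl
  e_iff U V _ _ := by
    have h : (dominoSig i).listEps [] ≤ (dominoSig i).eps U + (dominoSig i).w U := by
      simp only [Sig.listEps, dominoSig]; split_ifs <;> grind
    simp only [Sig.listE, if_pos h]
    simp [dominoSig, dominoCrystal, dominoE, hi]
  inj U V _ _ h := by simpa using h
  len _ _ _ _ := rfl

theorem dominoCrystal_wt (i : Fin n) (hi : ¬ i.1 + 1 < n) (T : Col n × Col n) :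
    (dominoCrystal n).wt T i = (dominoSig i).listW [T] := by
  change omegaLast n i + (wtL .c T.1 i + wtL .c T.2 i) = _
  rw [omegaLast_last i hi, wtL_apply_last _ i hi, wtL_apply_last _ i hi]
  simp only [Sig.listW, dominoSig]
  split_ifs <;> norm_num

end ColumnModels

/-! ### The signature rule for the last vertex -/

namespace Sig

variable {β : Type} (σ : Sig β)

/-- The path of the signature rule. -/
def path (s : ℕ) (c : ℕ → β) (p : ℕ) : ℤ := ∑ j ∈ Finset.range p, -σ.w (c (s + j))

theorem path_cons (s : ℕ) (c : ℕ → β) (p : ℕ) :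
    σ.path s c (p + 1) = σ.path (s + 1) c p - σ.w (c s) := by
  unfold path
  rw [Finset.sum_range_succ', add_zero, sub_eq_add_neg]
  congr 1
  exact Finset.sum_congr rfl fun j _ => by rw [show s + (j + 1) = s + 1 + j by omega]

/-- When ε is the positive part of -⟨wt, h⟩ on each factor, ε of the product is the maximum over the
partial sums of -⟨wt, h⟩, including the empty one. -/
theorem listEps_seqList (heps : ∀ b, σ.eps b = max 0 (-σ.w b)) (s : ℕ) (c : ℕ → β) (M p : ℕ)
    (hp : FirstMax (σ.path s c) M p) : σ.listEps (seqList c s M) = σ.path s c p := by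
  have key : ∀ M s, (∀ q ≤ M, σ.path s c q ≤ σ.listEps (seqList c s M)) ∧
      ∃ q ≤ M, σ.path s c q = σ.listEps (seqList c s M) := by
    intro M
    induction M with
    | zero => intro s; exact ⟨fun q hq => by rw [Nat.le_zero.1 hq]; rfl, 0, le_rfl, rfl⟩
    | succ M ih =>
      intro s
      obtain ⟨h1, q, h2, h3⟩ := ih (s + 1)
      have hl : σ.listEps (seqList c s (M + 1)) =
        max (σ.eps (c s)) (σ.listEps (seqList c (s + 1) M) - σ.w (c s)) := rfl
      have hs := heps (c s)
      have h0 : σ.path s c 0 = 0 := rfl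
      have h0' : σ.path (s + 1) c 0 = 0 := rfl
      rw [hl]
      refine ⟨fun q hq => ?_, ?_⟩
      · rcases q with _ | q
        · omega
        · have := h1 q (by omega)
          rw [path_cons]; omega
      · have h10 := h1 0 (by omega)
        by_cases hc : σ.eps (c s) ≤ σ.listEps (seqList c (s + 1) M) - σ.w (c s)
        · exact ⟨q + 1, by omega, by rw [path_cons]; omega⟩
        · exact ⟨0, by omega, by omega⟩
  obtain ⟨h1, q, h2, h3⟩ := key M s
  have := hp.2.1 q h2
  have := h1 p hp.1
  omega

/-- Under the same hypothesis on the factors, ẽ acts on the factor whose step leads up to the first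
maximum of the path. -/
theorem listE_seqList (heps : ∀ b, σ.eps b = max 0 (-σ.w b)) (s : ℕ) (c : ℕ → β) (M p : ℕ)
    (hp : FirstMax (σ.path s c) M (p + 1)) : σ.listE (seqList c s M) =
      (σ.e (c (s + p))).map fun y => seqList (Function.update c (s + p) y) s M := by
  induction M generalizing s p with
  | zero => exact absurd hp.1 (by omega)
  | succ M ih =>
    have hE : σ.listE (seqList c s (M + 1)) = if σ.listEps (seqList c (s + 1) M) ≤ σ.eps (c s) + σ.w (c s)
      then (σ.e (c s)).map (· :: seqList c (s + 1) M)
      else (σ.listE (seqList c (s + 1) M)).map (c s :: ·) := rfl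
    obtain ⟨q, hq⟩ := exists_firstMax (σ.path (s + 1) c) M
    have hq' := σ.listEps_seqList heps (s + 1) c M q hq
    have hs := heps (c s)
    have h0 : σ.path s c 0 = 0 := rfl
    have h1 : σ.path s c 1 = -σ.w (c s) := by
      rw [path_cons]; change 0 - _ = _; ring
    have hc : ∀ y k, seqList (Function.update c (s + k) y) s (M + 1) =
      Function.update c (s + k) y s :: seqList (Function.update c (s + k) y) (s + 1) M := fun _ _ => rfl
    rw [hE]
    rcases p with _ | p
    · have h2 := hp.2.2 0 (by omega)
      have h3 := hp.2.1 (q + 1) (by have := hq.1; omega)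
      rw [path_cons, zero_add, h1] at h3
      rw [if_pos (by omega)]
      congr 1
      funext y
      rw [hc, add_zero, Function.update_self]
      congr 1
      exact seqList_congr fun j h1 _ => by rw [Function.update_of_ne (by omega)]
    · have h2 := hp.2.2 0 (by omega)
      have h3 := hp.2.2 1 (by omega)
      have h4 := hq.2.1 (p + 1) (by have := hp.1; omega)
      have h5 := σ.path_cons s c (p + 1)
      have hp' : FirstMax (σ.path (s + 1) c) M (p + 1) := by
        refine ⟨by have := hp.1; omega, fun r hr => ?_, fun r hr => ?_⟩
        · have := hp.2.1 (r + 1) (by omega)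
          rw [path_cons, path_cons] at this; omega
        · have := hp.2.2 (r + 1) (by omega)
          rw [path_cons, path_cons] at this; omega
      rw [if_neg (by omega), ih _ _ hp', Option.map_map, show s + 1 + p = s + (p + 1) by omega]
      congr 1
      funext y
      rw [hc, Function.update_of_ne (by omega)]
      rfl

theorem exists_of_listE (heps : ∀ b, σ.eps b = max 0 (-σ.w b)) {s : ℕ} {c c' : ℕ → β} {M : ℕ}
    (h : σ.listE (seqList c s M) = some (seqList c' s M)) :
    ∃ p < M, FirstMax (σ.path s c) M (p + 1) ∧ σ.e (c (s + p)) = some (c' (s + p)) ∧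
      ∀ j, s ≤ j → j < s + M → j ≠ s + p → c' j = c j := by
  obtain ⟨p, hp⟩ := exists_firstMax (σ.path s c) M
  rcases p with _ | p
  · rw [σ.listE_none _ (σ.listEps_seqList heps s c M 0 hp)] at h
    exact absurd h (by simp)
  · have hpM := hp.1
    rw [σ.listE_seqList heps s c M p hp, Option.map_eq_some_iff] at h
    obtain ⟨y, hy, h⟩ := h
    refine ⟨p, by omega, hp, ?_, fun j h1 h2 h3 => ?_⟩
    · rw [hy, ← seqList_inj h (s + p) (by omega) (by omega), Function.update_self]
    · rw [← seqList_inj h j h1 h2, Function.update_of_ne h3]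

end Sig

section LastVertex

variable {n : ℕ}

open Col

theorem colSig_eps_last (i : Fin n) (hi : ¬ i.1 + 1 < n) (U : Col n) :
    (colSig i).eps U = max 0 (-(colSig i).w U) := by
  simp only [colSig, Col.phi, Col.eps, hi, dite_false]
  split_ifs <;> norm_num

theorem colSig_path_last (i : Fin n) (hi : ¬ i.1 + 1 < n) (s : ℕ) (c : ℕ → Col n) :
    (colSig i).path s c = colPath s c := by
  funext p
  have hn : n - 1 = i.1 := by omega
  refine Finset.sum_congr rfl fun j _ => ?_
  rw [hn, has_fin]
  simp only [colSig, Col.phi, Col.eps, hi, dite_false]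
  split_ifs <;> norm_num

theorem dominoSig_eps (i : Fin n) (T : Col n × Col n) :
    (dominoSig i).eps T = max 0 (-(dominoSig i).w T) := by
  simp only [dominoSig]
  split_ifs <;> grind

/-- The pairs of columns with indices `2j + 1`, `2j + 2`. -/
def pairSeq (c : ℕ → Col n) (j : ℕ) : Col n × Col n := (c (2 * j + 1), c (2 * j + 2))

theorem dominoSig_path (i : Fin n) (hi : ¬ i.1 + 1 < n) (c : ℕ → Col n) (p : ℕ) :
    2 * (dominoSig i).path 0 (pairSeq c) p = colPath 1 c (2 * p) := by
  have hn : n - 1 = i.1 := by omega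
  induction p with
  | zero => simp [Sig.path, colPath]
  | succ p ih =>
    have : (dominoSig i).path 0 (pairSeq c) (p + 1) = (dominoSig i).path 0 (pairSeq c) p -
      (dominoSig i).w (pairSeq c p) := by
      unfold Sig.path
      rw [Finset.sum_range_succ, zero_add]; ring
    rw [this, show 2 * (p + 1) = 2 * p + 1 + 1 by ring, colPath_succ, colPath_succ, ← ih, hn, has_fin,
      has_fin]
    simp only [dominoSig, pairSeq, show 1 + (2 * p) = 2 * p + 1 by ring,
      show 1 + (2 * p + 1) = 2 * p + 2 by ring]
    ring

/-- For pairs in which `n̄` is in the left column if it is in the right one, the first maxima of the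
two paths agree. -/
theorem firstMax_domino_iff (i : Fin n) (hi : ¬ i.1 + 1 < n) (c : ℕ → Col n)
    (hc : ∀ j, has (c (2 * j + 1)) (n - 1) ≤ has (c (2 * j + 2)) (n - 1)) (M p : ℕ) :
    FirstMax ((dominoSig i).path 0 (pairSeq c)) M p ↔ FirstMax (colPath 1 c) (2 * M) (2 * p) := by
  have h := dominoSig_path i hi c
  -- In the middle of a pair the path is lower than at one of its ends: it goes up at the second
  -- column if n̄ is there, and otherwise n̄ is in neither and the path goes down at the first. So
  -- neither maxima nor first maxima are odd.
  have hodd : ∀ q, colPath 1 c (2 * q + 1) < colPath 1 c (2 * q) ∨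
      colPath 1 c (2 * q + 1) < colPath 1 c (2 * q + 2) := by
    intro q
    have h1 := hc q
    have h2 := has_le_one (c (2 * q + 2)) (n - 1)
    have h3 := has_nonneg (c (2 * q + 1)) (n - 1)
    rw [colPath_succ 1 c (2 * q + 1), colPath_succ, show 1 + (2 * q) = 2 * q + 1 by ring,
      show 1 + (2 * q + 1) = 2 * q + 2 by ring]
    omega
  constructor
  · rintro ⟨h1, h2, h3⟩
    have hle : ∀ q ≤ M, colPath 1 c (2 * q) ≤ colPath 1 c (2 * p) := fun q hq => by
      have := h2 q hq
      have := h q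
      have := h p
      omega
    have hlt : ∀ q < p, colPath 1 c (2 * q) < colPath 1 c (2 * p) := fun q hq => by
      have := h3 q hq
      have := h q
      have := h p
      omega
    refine ⟨by omega, fun q hq => ?_, fun q hq => ?_⟩
    · obtain ⟨r, rfl | rfl⟩ := Nat.even_or_odd' q
      · exact hle r (by omega)
      · have g1 := hle r (by omega)
        have g2 := hle (r + 1) (by omega)
        rw [show 2 * (r + 1) = 2 * r + 2 by ring] at g2
        rcases hodd r with g | g <;> omega
    · obtain ⟨r, rfl | rfl⟩ := Nat.even_or_odd' q
      · exact hlt r (by omega)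
      · have g1 := hle r (by omega)
        have g2 := hle (r + 1) (by omega)
        rw [show 2 * (r + 1) = 2 * r + 2 by ring] at g2
        rcases hodd r with g | g <;> omega
  · rintro ⟨h1, h2, h3⟩
    refine ⟨by omega, fun q hq => ?_, fun q hq => ?_⟩
    · have := h2 (2 * q) (by omega)
      have := h q
      have := h p
      omega
    · have := h3 (2 * q) (by omega)
      have := h q
      have := h p
      omega

/-! ### Elements of the spinor model as sequences of columns -/

/-- The properties of the columns of an element of `𝐓_λ` which are used for the map `Θ_λ`; the columns
have the indices `s, …, 2ℓ`. -/
structure SpinorColumns (g : ClType) (ℓ : ℕ) (a : ℕ → ℕ) (s : ℕ) (c : ℕ → Col n) : Prop where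
  data : ∃ G, SepData ℓ a c G
  attained : ∀ i, 1 ≤ i → i ≤ ℓ → ∃ t, cnt (c (2 * i)) t = cnt (c (2 * i - 1)) t + a i
  lead : s = 0 → ∀ t, cnt (c 1) t ≤ cnt (c 0) t
  zero : s = 1 → c 0 = ∅
  card : g = .c → ∀ i, 1 ≤ i → i ≤ ℓ → (c (2 * i)).card = (c (2 * i - 1)).card + a i

/-! ### The letters n̄ in the body. -/

variable {g : ClType} {ℓ s : ℕ} {a : ℕ → ℕ} {c d c' d' : ℕ → Col n}

theorem SepData.bodyHt_anti {G : ℕ → ℕ → ℤ} (D : SepData ℓ a c G) {j k : ℕ} (hj : 1 ≤ j) (hk : j ≤ k) :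
    bodyHt a c k ≤ bodyHt a c j := by
  induction k, hk using Nat.le_induction with
  | base => exact le_rfl
  | succ k hk ih =>
    refine le_trans ?_ ih
    unfold bodyHt
    by_cases hl : 2 * ℓ < k + 1
    · rw [D.empty _ hl]; simp
    obtain ⟨r, rfl | rfl⟩ := Nat.even_or_odd' k
    · rw [if_neg (by omega), if_pos (by omega), show 2 * r / 2 = r by omega]
      have h1 := D.admL r (by omega) (by omega) n
      rw [D.eq r (by omega) (by omega) n le_rfl, cnt_of_ge _ n le_rfl, cnt_of_ge _ n le_rfl] at h1
      omega
    · rw [if_pos (by omega), if_neg (by omega), show (2 * r + 1 + 1) / 2 = r + 1 by omega]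
      have h1 := D.diff (r + 1) (by omega) (by omega) n
      rw [D.eq (r + 1) (by omega) (by omega) n le_rfl, cnt_of_ge _ n le_rfl, cnt_of_ge _ n le_rfl,
        show 2 * (r + 1) - 1 = 2 * r + 1 by omega] at h1
      rw [show 2 * r + 1 + 1 = 2 * (r + 1) by ring]
      omega

/-- Every second step from j on is a descent, which the step in between can at best make up for. -/
theorem colPath_odd_le (c : ℕ → Col n) {j : ℕ} (hj : s ≤ j)
    (h : ∀ k, has (c (j + 2 * k)) (n - 1) = 0) (p : ℕ) (hp : j - s ≤ p) :
    colPath s c p ≤ colPath s c (j - s) := by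
  have key : ∀ m, colPath s c (j - s + 2 * m) ≤ colPath s c (j - s) ∧
      colPath s c (j - s + 2 * m + 1) ≤ colPath s c (j - s) - 1 := by
    intro m
    induction m with
    | zero =>
      refine ⟨le_rfl, ?_⟩
      have h0 := h 0
      rw [mul_zero, add_zero] at h0 ⊢
      rw [colPath_succ, show s + (j - s) = j by omega, h0]
      omega
    | succ m ih =>
      have h2 := has_le_one (c (s + (j - s + 2 * m + 1))) (n - 1)
      have h3 : colPath s c (j - s + 2 * (m + 1)) ≤ colPath s c (j - s) := by
        rw [show j - s + 2 * (m + 1) = j - s + 2 * m + 1 + 1 by ring, colPath_succ]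
        have := ih.2
        omega
      refine ⟨h3, ?_⟩
      rw [colPath_succ, show s + (j - s + 2 * (m + 1)) = j + 2 * (m + 1) by omega, h]
      omega
  obtain ⟨r, hr | hr⟩ := Nat.even_or_odd' (p - (j - s))
  · have := (key r).1
    rwa [show j - s + 2 * r = p by omega] at this
  · have := (key r).2
    rw [show j - s + 2 * r + 1 = p by omega] at this
    omega

/-- Beyond a column with empty body there is no first maximum. All later bodies are empty, in
particular the right columns are empty, so every second step goes down. If the column is some T_i^L
containing n̄, the descents start already at T_i^R, which is then empty. -/
theorem SpinorColumns.colPath_le (H : SpinorColumns g ℓ a s c) (hs : s ≤ 1) {j : ℕ}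
    (hj : 1 ≤ j) (hj2 : j ≤ 2 * ℓ) (hb : bodyHt a c j = 0) {p : ℕ} (hp : j - s < p) :
    ∃ q < p, colPath s c p ≤ colPath s c q := by
  obtain ⟨G, D⟩ := H.data
  have hodd : ∀ m, 1 ≤ m → m % 2 = 1 → bodyHt a c m = 0 → ∀ p, m - s ≤ p →
      colPath s c p ≤ colPath s c (m - s) := by
    intro m hm hm2 hb p hp
    refine colPath_odd_le c (by omega) (fun k => ?_) p hp
    have h1 := D.bodyHt_anti hm (show m ≤ m + 2 * k by omega)
    unfold bodyHt at h1 hb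
    rw [if_neg (by omega)] at hb
    rw [if_neg (by omega), if_neg (by omega), hb, Nat.le_zero, Finset.card_eq_zero] at h1
    rw [h1]
    unfold has
    simp
  by_cases hj' : j % 2 = 1
  · exact ⟨j - s, hp, hodd j hj hj' hb p hp.le⟩
  obtain ⟨i, rfl⟩ : ∃ i, j = 2 * i := ⟨j / 2, by omega⟩
  have hbL := hb
  unfold bodyHt at hbL
  rw [if_pos (by omega), show 2 * i / 2 = i by omega] at hbL
  have hst := colPath_succ s c (2 * i - s)
  rw [show s + (2 * i - s) = 2 * i by omega] at hst
  by_cases hf : has (c (2 * i)) (n - 1) = 0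
  · have hb' := D.bodyHt_anti (show 1 ≤ 2 * i by omega) (show 2 * i ≤ 2 * i + 1 by omega)
    have := hodd (2 * i + 1) (by omega) (by omega) (by omega) p (by omega)
    rw [show 2 * i + 1 - s = 2 * i - s + 1 by omega, hst, hf] at this
    exact ⟨2 * i - s, hp, by omega⟩
  · have hf1 : has (c (2 * i)) (n - 1) = 1 := by
      have h1 := has_le_one (c (2 * i)) (n - 1)
      have h2 := has_nonneg (c (2 * i)) (n - 1)
      omega
    -- T_i^L has exactly a_i letters, so it exceeds T_i^R by a_i only where all of them are counted.
    -- Its letter n̄ pushes this to t ≥ n, which forces T_i^R to be empty.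
    obtain ⟨t, ht⟩ := H.attained i (by omega) (by omega)
    have hn : n - 1 + 1 = n := by
      by_contra hn
      rw [has_of_ge _ _ (by omega)] at hf1
      omega
    have h1 := cnt_nonneg (c (2 * i - 1)) t
    have h2 := D.card_le i (by omega) (by omega)
    have h3 := cnt_le_card (c (2 * i)) t
    have htn : n ≤ t := by
      by_contra h
      have h4 := cnt_mono (c (2 * i)) (show t ≤ n - 1 by omega)
      have h5 := cnt_succ (c (2 * i)) (n - 1)
      rw [hn, cnt_of_ge _ n le_rfl] at h5
      omega
    rw [cnt_of_ge _ _ htn] at ht h1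
    rw [cnt_of_ge _ _ htn] at ht
    have hR : bodyHt a c (2 * i - 1) = 0 := by
      unfold bodyHt
      rw [if_neg (by omega)]
      omega
    exact ⟨2 * i - 1 - s, by omega, hodd (2 * i - 1) (by omega) (by omega) hR p (by omega)⟩

/-- Cutting off a tail removes n̄ from a column only if it removes the whole column, as n̄ is on
top. By `SpinorColumns.colPath_le` no first maximum lies beyond such a column. -/
theorem SpinorColumns.keepsFirstMax_body (H : SpinorColumns g ℓ a s c) (hn : 1 ≤ n) (hs : s ≤ 1)
    (S : Separated ℓ a c d) {M : ℕ} (hK : KeepsFirstMax (colPath s c) (colPath s d) M) :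
    KeepsFirstMax (colPath s c) (colPath s (bodyPart ℓ a c d)) M := by
  have hn' : n - 1 + 1 = n := by omega
  have hcnt : ∀ j, cnt (bodyPart ℓ a c d j) n = cnt (bodyPart ℓ a c d j) (n - 1) +
      has (bodyPart ℓ a c d j) (n - 1) := fun j => by rw [← cnt_succ, hn']
  have hcnt' : ∀ j, cnt (d j) n = cnt (d j) (n - 1) + has (d j) (n - 1) :=
    fun j => by rw [← cnt_succ, hn']
  have hflag : ∀ j, has (bodyPart ℓ a c d j) (n - 1) ≤ has (d j) (n - 1) ∧
      (has (bodyPart ℓ a c d j) (n - 1) ≠ has (d j) (n - 1) → 1 ≤ j ∧ j ≤ 2 * ℓ ∧ bodyHt a c j = 0) := by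
    intro j
    have h1 := hcnt j
    have h2 := hcnt' j
    rw [S.cnt_body, S.cnt_body] at h1
    have h3 := has_le_one (d j) (n - 1)
    have h4 := has_nonneg (d j) (n - 1)
    split_ifs at h1 with hj
    · have h5 := S.card_bodyPart j (by omega) hj.2
      have h6 := S.cnt_body j n
      rw [if_pos hj, cnt_of_ge _ n le_rfl, h5] at h6
      have h7 := cnt_of_ge (d j) n le_rfl
      omega
    · omega
  have hle : ∀ q, colPath s (bodyPart ℓ a c d) q ≤ colPath s d q := fun q =>
    Finset.sum_le_sum fun j _ => by have := (hflag (s + j)).1; omega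
  intro p hp
  obtain ⟨h1, h2⟩ := hK p hp
  have heq : colPath s (bodyPart ℓ a c d) p = colPath s d p := by
    by_contra hne
    obtain ⟨j, hj, hj'⟩ : ∃ j < p, has (bodyPart ℓ a c d (s + j)) (n - 1) ≠ has (d (s + j)) (n - 1) := by
      by_contra hcon
      push Not at hcon
      exact hne (Finset.sum_congr rfl fun j hj => by rw [hcon j (Finset.mem_range.1 hj)])
    obtain ⟨g1, g2, g3⟩ := (hflag (s + j)).2 hj'
    obtain ⟨q, hq, hq'⟩ := H.colPath_le hs g1 g2 g3 (p := p) (by omega)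
    exact absurd (hp.2.2 q hq) (not_lt.2 hq')
  exact ⟨h1.of_le (fun q _ => hle q) heq, heq.trans h2⟩

/-- The displacements of the separation algorithm only depend on the letters different from `n̄`. -/
theorem separate_cnt_eq (D : ∃ G, SepData ℓ a c G) (D' : ∃ G, SepData ℓ a c' G)
    (hcc : ∀ j t, t < n → cnt (c j) t = cnt (c' j) t) (h : separate ℓ a c = some d)
    (h' : separate ℓ a c' = some d') (j t : ℕ) :
    cnt (d' j) t - cnt (c' j) t = cnt (d j) t - cnt (c j) t := by
  obtain ⟨G, D⟩ := D
  obtain ⟨G', D'⟩ := D'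
  rw [separate_eq] at h h'
  rcases Nat.eq_zero_or_pos ℓ with rfl | hℓ
  · obtain rfl := Option.some.inj h
    obtain rfl := Option.some.inj h'
    ring
  · obtain ⟨A, hA⟩ := D.init hℓ
    obtain ⟨A', hA'⟩ := D'.init hℓ
    exact SepInv.chains_eq (k := ℓ - 1) D D' (by rwa [Nat.sub_add_cancel hℓ])
      (by rwa [Nat.sub_add_cancel hℓ]) (by omega) hcc h h' j t

/-- Each body column has the height of the original column minus a constant depending only on the
a_i, so the heights of columns and of their bodies vary together. -/
theorem SpinorColumns.body_card (H : SpinorColumns g ℓ a s c) (H' : SpinorColumns g ℓ a s c')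
    (S : Separated ℓ a c d) (S' : Separated ℓ a c' d') (j : ℕ) :
    (bodyPart ℓ a c' d' j).card + (c j).card = (bodyPart ℓ a c d j).card + (c' j).card := by
  obtain ⟨G, D⟩ := H.data
  obtain ⟨G', D'⟩ := H'.data
  rcases Nat.eq_zero_or_pos j with rfl | hj
  · unfold bodyPart
    rw [if_pos (by omega), if_pos (by omega), S.eq_zero, S'.eq_zero, add_comm]
  by_cases hj2 : j ≤ 2 * ℓ
  · rw [S.card_bodyPart j hj hj2, S'.card_bodyPart j hj hj2]
    unfold bodyHt
    split_ifs with h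
    · have h1 := D.card_le (j / 2) (by omega) (by omega)
      have h2 := D'.card_le (j / 2) (by omega) (by omega)
      rw [show 2 * (j / 2) = j by omega] at h1 h2
      omega
    · omega
  · rw [S.body_empty j (by omega), S'.body_empty j (by omega), D.empty j (by omega),
      D'.empty j (by omega)]

theorem cnt_body_eq (S : Separated ℓ a c d) (S' : Separated ℓ a c' d') (t : ℕ)
    (hd : ∀ j, cnt (d' j) t = cnt (d j) t) (j : ℕ) :
    cnt (bodyPart ℓ a c' d' j) t = cnt (bodyPart ℓ a c d j) t := by
  rw [S.cnt_body, S'.cnt_body, hd]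

theorem tailPart_eq (S : Separated ℓ a c d) (S' : Separated ℓ a c' d')
    (hd : ∀ j t, t < n → cnt (d' j) t = cnt (d j) t) (k : ℕ) (h1 : 1 ≤ k) (h2 : k ≤ ℓ) :
    tailPart a c' d' (ℓ + k) = tailPart a c d (ℓ + k) := by
  apply cnt_inj
  intro t
  rw [S.cnt_tail k t h1 h2, S'.cnt_tail k t h1 h2]
  by_cases ht : t < n
  · rw [hd _ t ht]
  · rw [cnt_of_ge _ t (by omega), cnt_of_ge _ t (by omega), S.card k h1 h2, S'.card k h1 h2]
    omega

theorem eq_of_cnt_of_card {U V : Col n} (h : ∀ t < n, cnt V t = cnt U t) (hc : V.card = U.card) : V = U := by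
  apply cnt_inj
  intro t
  by_cases ht : t < n
  · exact h t ht
  · rw [cnt_of_ge _ t (by omega), cnt_of_ge _ t (by omega), hc]

theorem eq_erase_of_cnt {U V : Col n} (i : Fin n) (hi : ¬ i.1 + 1 < n) (h : ∀ t < n, cnt V t = cnt U t)
    (hc : V.card + 1 = U.card) : bar i ∈ U ∧ V = U.erase (bar i) := by
  have hn : i.1 + 1 = n := by omega
  have h1 := cnt_succ U i.1
  have h2 := cnt_succ V i.1
  rw [has_fin, hn, cnt_of_ge _ n le_rfl] at h1 h2
  have h3 := h i.1 i.2
  have hm : bar i ∈ U := by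
    by_contra hm
    rw [if_neg hm] at h1
    split_ifs at h2 <;> omega
  refine ⟨hm, eq_of_cnt_of_card (fun t ht => ?_) ?_⟩
  · rw [cnt_erase _ _ hm, letterIdx_bar, if_neg (by omega), h t ht, sub_zero]
  · rw [Finset.card_erase_of_mem hm]; omega

theorem cnt_erase_last (U : Col n) (i : Fin n) (hi : ¬ i.1 + 1 < n) (hm : bar i ∈ U) (t : ℕ) (ht : t < n) :
    cnt (U.erase (bar i)) t = cnt U t := by
  rw [cnt_erase _ _ hm, letterIdx_bar, if_neg (by omega), sub_zero]

end LastVertex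

/-! ### The columns of an element of the spinor model -/

section SpinorModel

variable {n : ℕ}

open Col

/-- The semistandard condition bounds D by a, and 𝔯_T = 0 makes the bound sharp. In type C_n, and
whenever b = 0, it is attained at the end. -/
theorem TSet.facts {g : ClType} {a : ℕ} {T : Col n × Col n} (h : T ∈ TSet g a) :
    (∀ t, colDiff T t ≤ a) ∧ (∃ t, colDiff T t = a) ∧ a ≤ T.2.card ∧
      (g = .c → T.2.card = T.1.card + a) := by
  have key : ∀ b c, IsSST a b c T → (∀ t, colDiff T t ≤ a) ∧ a ≤ T.2.card := by
    rintro b c ⟨h1, h2, h3⟩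
    refine ⟨fun t => ?_, by omega⟩
    have := ((overlap_iff _ _ _).1 h3).2.2 t
    unfold colDiff
    omega
  have h0 : colDiff T 0 = 0 := by simp [colDiff]
  have hn : colDiff T n = T.2.card - T.1.card := by
    unfold colDiff; rw [cnt_of_ge _ n le_rfl, cnt_of_ge _ n le_rfl]
  cases g with
  | c =>
    obtain ⟨c, h⟩ := h
    obtain ⟨h1, h2⟩ := key _ _ h
    have h3 := h.1
    have h4 := h.2.1
    exact ⟨h1, ⟨n, by omega⟩, h2, fun _ => by omega⟩
  | b =>
    obtain ⟨b, c, h, hs⟩ := h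
    obtain ⟨h1, h2⟩ := key _ _ h
    refine ⟨h1, ?_, h2, fun h => absurd h (by simp)⟩
    have h3 := h.1
    have h4 := h.2.1
    rcases Nat.eq_zero_or_pos a with rfl | ha
    · exact ⟨0, by rw [h0]; rfl⟩
    rcases Nat.eq_zero_or_pos b with rfl | hb
    · exact ⟨n, by omega⟩
    -- Sliding down by one position already suffices: it would be possible if D stayed below a.
    have hs1 := hs 1 one_pos (by omega)
    have : ¬ Overlap T.2 T.1 (c + 1) := fun ho => hs1 ⟨by omega, by omega, ho⟩
    rw [overlap_iff] at this
    by_contra hcon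
    push Not at hcon
    refine this ⟨by omega, by omega, fun t => ?_⟩
    have g1 := h1 t
    have g2 := hcon t
    unfold colDiff at g1 g2
    push_cast
    omega

theorem tailLen_mono (μ : Fin n → ℕ) (i : ℕ) : tailLen μ i ≤ tailLen μ (i + 1) := by
  unfold tailLen
  have : (Finset.univ.filter fun j => i + 1 ≤ μ j).card ≤ (Finset.univ.filter fun j => i ≤ μ j).card := by
    refine Finset.card_le_card fun j hj => ?_
    simp only [Finset.mem_filter, Finset.mem_univ, true_and] at hj ⊢
    omega
  omega

theorem columnsOf_right (T₀ : Col n) {ℓ : ℕ} (T : Fin ℓ → Col n × Col n) (i : Fin ℓ) :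
    columnsOf T₀ T (2 * i.1 + 1) = (T i).1 := by
  unfold columnsOf
  have h : 2 * i.1 / 2 = i.1 := by omega
  simp [h]

theorem columnsOf_left (T₀ : Col n) {ℓ : ℕ} (T : Fin ℓ → Col n × Col n) (i : Fin ℓ) :
    columnsOf T₀ T (2 * i.1 + 2) = (T i).2 := by
  have h : (2 * i.1 + 1) / 2 = i.1 := by omega
  have h' : ¬ (2 * i.1 + 1) % 2 = 0 := by omega
  simp [columnsOf, h]

theorem columnsOf_empty (T₀ : Col n) {ℓ : ℕ} (T : Fin ℓ → Col n × Col n) (j : ℕ) (h : 2 * ℓ < j) :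
    columnsOf T₀ T j = ∅ := by
  obtain ⟨m, rfl⟩ : ∃ m, j = m + 1 := ⟨j - 1, by omega⟩
  have h' : ¬ m / 2 < ℓ := by omega
  simp [columnsOf, h']

/-- The letters moved by `ℰ^a`. -/
theorem exists_moved {g : ClType} {a : ℕ} {T : Col n × Col n} (h : T ∈ TSet g a) :
    ∃ G : ℕ → ℤ, Monotone G ∧ (∀ t, G t ≤ a) ∧ (∀ t, n ≤ t → G t = a) ∧ (∀ t, colDiff T t ≤ G t) ∧
      ∀ S, jdtEPow a T = some S → (∀ t, cnt S.1 t = cnt T.1 t + G t) ∧ ∀ t, cnt S.2 t = cnt T.2 t - G t := by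
  have h1 := (TSet.facts h).1
  cases hS : jdtEPow a T with
  -- A default for ℰ^a T = 0: the constant a satisfies the inequalities, and the statement on the
  -- resulting columns is void.
  | none => exact ⟨fun _ => a, monotone_const, fun _ => le_rfl, fun _ _ => rfl, h1, by simp⟩
  | some S =>
    obtain ⟨G, g1, g2, g3, g4, g5, g6⟩ := jdtEPow_some a T S a h1 hS
    refine ⟨G, g1, g2, g3, fun t => by simpa using g6 t, fun S' hS' => ?_⟩
    obtain rfl := Option.some.inj hS'
    exact ⟨g4, g5⟩

/-- Translates admissibility by `entryLE_up_iff`. The last inequality holds because the right column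
of ℰ^{a₂} T₂ is an actual column and grows by at most one letter at each t. -/
theorem AdmissibleCols.cnt_le {a₂ a₁ : ℕ} {T₂ : Col n × Col n} {U V : Col n} {G : ℕ → ℤ}
    (h : AdmissibleCols a₂ T₂ a₁ U V) (ha : a₁ ≤ a₂) (hV : T₂.1.card ≤ V.card)
    (hGn : G n = a₂) (hG : ∀ S, jdtEPow a₂ T₂ = some S → ∀ t, cnt S.1 t = cnt T₂.1 t + G t) :
    (∀ t, cnt T₂.1 t ≤ cnt V t) ∧ (∀ t, cnt T₂.1 t + G t + a₁ ≤ cnt U t + a₂) ∧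
      ∀ t, cnt T₂.1 (t + 1) + G (t + 1) ≤ cnt T₂.1 t + G t + 1 := by
  obtain ⟨h1, h2, S, hS, h3⟩ := h
  have hS' := hG S hS
  have hn := hS' n
  rw [cnt_of_ge _ n le_rfl, cnt_of_ge _ n le_rfl, hGn] at hn
  refine ⟨fun t => ?_, fun t => ?_, fun t => ?_⟩
  · have := (entryLE_up_iff T₂.1 V 0 (by simpa using hV)).1 (by simpa using h2) t
    simpa using this
  · have := (entryLE_up_iff S.1 U (a₂ - a₁) (by omega)).1 h3 t
    rw [hS'] at this
    omega
  · rw [← hS', ← hS', cnt_succ]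
    have := has_le_one S.1 t
    omega

/-- The passage from tableaux to the inequalities on which the rest of the argument is based. The
hypothesis on s = 0 supplies the comparison with the spin column T₀, and s = 1 means that there is
none. -/
theorem spinorColumns {g : ClType} {μ : Fin n → ℕ} {T : Fin (numCols μ) → Col n × Col n}
    (hT : T ∈ spinorSet g μ) (T₀ : Col n) (s : ℕ) (hs : s = 1 → T₀ = ∅)
    (h0 : s = 0 → ∀ i : Fin (numCols μ), i.1 = 0 → AdmissibleSpin (tailLen μ 1) (T i) T₀) :
    SpinorColumns g (numCols μ) (tailLen μ) s (columnsOf T₀ T) := by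
  obtain ⟨h1, h2⟩ := hT
  have hex : ∀ i : Fin (numCols μ), _ := fun i => exists_moved (h1 i)
  choose G hG1 hG2 hG3 hG4 hG5 using hex
  have hR := columnsOf_right T₀ T
  have hL := columnsOf_left T₀ T
  have hidx : ∀ i, 1 ≤ i → i ≤ numCols μ → ∃ k : Fin (numCols μ), i = k.1 + 1 := fun i h1 h2 =>
    ⟨⟨i - 1, by omega⟩, by simp only; omega⟩
  have hR' : ∀ k : Fin (numCols μ), columnsOf T₀ T (2 * (k.1 + 1) - 1) = (T k).1 := fun k => by
    rw [← hR]; rfl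
  have hL' : ∀ k : Fin (numCols μ), columnsOf T₀ T (2 * (k.1 + 1)) = (T k).2 := fun k => by
    rw [← hL]; rfl
  have hadm : ∀ k k' : Fin (numCols μ), k'.1 = k.1 + 1 →
      (∀ t, cnt (T k').1 t + G k t ≤ cnt (T k).2 t) ∧
      (∀ t, cnt (T k').1 t + G k' t + tailLen μ (k.1 + 1) ≤ cnt (T k).2 t + tailLen μ (k'.1 + 1)) ∧
      ∀ t, cnt (T k).1 (t + 1) + G k (t + 1) ≤ cnt (T k).1 t + G k t + 1 := by
    intro k k' hk
    obtain ⟨S, hS, hA⟩ := h2 k k' hk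
    obtain ⟨hS1, hS2⟩ := hG5 k S hS
    have hc := hS2 n
    rw [cnt_of_ge _ n le_rfl, cnt_of_ge _ n le_rfl, hG3 k n le_rfl] at hc
    have hA1 := hA.1
    obtain ⟨g1, g2, g3⟩ := hA.cnt_le (G := G k') (by rw [hk]; exact tailLen_mono μ _) (by omega)
      (hG3 k' n le_rfl) fun S hS => (hG5 k' S hS).1
    refine ⟨fun t => ?_, g2, fun t => ?_⟩
    · have := g1 t
      rw [hS2] at this
      omega
    · rw [← hS1, ← hS1, cnt_succ]
      have := has_le_one S.1 t
      omega
  refine ⟨⟨fun i t => if h : i - 1 < numCols μ then G ⟨i - 1, h⟩ t else 0, ?_⟩, ?_, ?_, ?_, ?_⟩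
  · have hGk : ∀ (k : Fin (numCols μ)) t,
        (if h : k.1 + 1 - 1 < numCols μ then G ⟨k.1 + 1 - 1, h⟩ t else 0) = G k t := fun k t => by
      simp
    constructor
    · intro i g1 g2 t t' ht
      obtain ⟨k, rfl⟩ := hidx i g1 g2
      simp only [hGk]; exact hG1 k ht
    · intro i g1 g2 t
      obtain ⟨k, rfl⟩ := hidx i g1 g2
      simp only [hGk]; exact hG2 k t
    · intro i g1 g2 t ht
      obtain ⟨k, rfl⟩ := hidx i g1 g2
      simp only [hGk]; exact hG3 k t ht
    · intro i g1 g2 t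
      obtain ⟨k, rfl⟩ := hidx i g1 g2
      simp only [hGk, hR', hL']
      have := hG4 k t
      unfold colDiff at this
      omega
    · intro i _ _; exact tailLen_mono μ i
    · intro i g1 g2 t
      obtain ⟨k, rfl⟩ := hidx i g1 g2.le
      have := (hadm k ⟨k.1 + 1, g2⟩ rfl).1 t
      simp only [hGk, hL']
      rwa [← hR] at this
    · intro i g1 g2 t
      obtain ⟨k, rfl⟩ := hidx i g1 g2.le
      have := (hadm k ⟨k.1 + 1, g2⟩ rfl).2.1 t
      have h3 := hGk ⟨k.1 + 1, g2⟩ t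
      simp only at h3
      simp only [h3, hL']
      rwa [← hR] at this
    · intro i g1 g2 t
      obtain ⟨k, rfl⟩ := hidx i g1 g2.le
      have := (hadm k ⟨k.1 + 1, g2⟩ rfl).2.2 t
      simpa only [hGk, hR'] using this
    · intro i g1 g2
      obtain ⟨k, rfl⟩ := hidx i g1 g2
      rw [hL']; exact (TSet.facts (h1 k)).2.2.1
    · exact columnsOf_empty T₀ T
  · intro i g1 g2
    obtain ⟨k, rfl⟩ := hidx i g1 g2
    obtain ⟨t, ht⟩ := (TSet.facts (h1 k)).2.1
    refine ⟨t, ?_⟩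
    rw [hL', hR']
    unfold colDiff at ht
    omega
  · intro hs0 t
    by_cases hℓ : 0 < numCols μ
    · have hA := h0 hs0 ⟨0, hℓ⟩ rfl
      have h3 := columnsOf_right T₀ T ⟨0, hℓ⟩
      simp only [mul_zero, zero_add] at h3
      rw [h3]
      have h4 := hA.1
      have := (entryLE_up_iff (T ⟨0, hℓ⟩).1 T₀ 0 (by simpa using h4)).1 (by simpa using hA.2.1) t
      rw [show columnsOf T₀ T 0 = T₀ from rfl]
      simpa using this
    · rw [columnsOf_empty T₀ T 1 (by omega), cnt_empty]
      exact cnt_nonneg _ t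
  · exact hs
  · intro hg i g1 g2
    obtain ⟨k, rfl⟩ := hidx i g1 g2
    rw [hL', hR']
    exact (TSet.facts (h1 k)).2.2.2 hg

end SpinorModel

/-! ### The body and the tail as crystals -/

section Lists

variable {β : Type}

theorem ofFn_eq_seqList {k : ℕ} (x : Fin k → β) (c : ℕ → β) (s : ℕ) (h : ∀ i, x i = c (s + i.1)) :
    List.ofFn x = seqList c s k := by
  apply List.ext_getElem
  · simp [seqList]
  · intro j h1 h2
    simp [seqList, h]

theorem flatMap_singleton (l : List β) : (l.flatMap fun b => [b]) = l := by
  induction l with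
  | nil => rfl
  | cons b l ih => rw [List.flatMap_cons, ih]; rfl

theorem flatMap_pair_eq_seqList {k : ℕ} (x : Fin k → β × β) (c : ℕ → β) (s : ℕ)
    (h : ∀ i, x i = (c (s + 2 * i.1), c (s + 2 * i.1 + 1))) :
    ((List.ofFn x).flatMap fun p => [p.1, p.2]) = seqList c s (2 * k) := by
  induction k generalizing s with
  | zero => simp [seqList]
  | succ k ih =>
    rw [List.ofFn_succ, List.flatMap_cons, ih _ (s + 2) fun i => by
      rw [h]; congr 2 <;> simp <;> ring, h 0]
    rfl

theorem seqList_shift (c : ℕ → β) (s N : ℕ) : seqList (fun k => c (k + s)) 0 N = seqList c s N := by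
  apply List.ext_getElem
  · simp [seqList]
  · intro j h1 h2
    simp [seqList, add_comm]

end Lists

section Verma

variable {n : ℕ}

open Col FinSeq

theorem columnsCrystal_b :
    ∃ hε he hw, columnsCrystal n .b = (spinCrystal n).limit ∅ hε he hw :=
  ⟨fun i => by simp [spinCrystal, Col.eps_empty], fun i => by simp [spinCrystal, Col.e_empty],
    by simp [spinCrystal, Col.wtL_empty], rfl⟩

theorem columnsCrystal_c : ∃ hε he hw,
    columnsCrystal n .c = ((dominoCrystal n).limit (∅, ∅) hε he hw).ofEquiv pairEquiv := ⟨_, _, _, rfl⟩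

/-- In type C_n the factors of the limit are pairs of columns, hence the even number of columns. -/
theorem columnsCrystal_models (g : ClType) (i : Fin n) (hi : g = .b ∨ i.1 + 1 < n) (N : ℕ)
    (hN : g = .c → N % 2 = 0) : (columnsCrystal n g).Models i (colSig i)
      (fun c => ∀ j, N ≤ j → c.1 j = ∅) fun c => seqList c.1 0 N := by
  cases g with
  | b =>
    obtain ⟨hε, he, hw, h⟩ := columnsCrystal_b (n := n)
    rw [h]
    refine (((spinCrystal_models i).tpow (spinCrystal_wt i) N).limit _ _ _).congr
      (fun _ h => h) fun c => ?_
    rw [flatMap_singleton]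
    exact (ofFn_eq_seqList _ _ 0 fun i => by simp [trunc]).symm
  | c =>
    obtain ⟨M, rfl⟩ : ∃ M, N = 2 * M := ⟨N / 2, by have := hN rfl; omega⟩
    have H : (dominoCrystal n).Models i (colSig i) (fun _ => True) fun T => [T.1, T.2] :=
      pairCrystal_models .c i hi
    refine (((H.tpow (pairCrystal_wt .c i hi) M).limit _ _ _).ofEquiv pairEquiv).congr
      (fun c h j hj => ?_) fun c => ?_
    · exact Prod.ext (h _ (by omega)) (h _ (by omega))
    · exact (flatMap_pair_eq_seqList _ _ 0 fun i => by simp [trunc, pairEquiv, pairUp]).symm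

theorem columnsCrystal_models_domino (i : Fin n) (hi : ¬ i.1 + 1 < n) (M : ℕ) :
    (columnsCrystal n .c).Models i (dominoSig i)
      (fun c => ∀ j, 2 * M ≤ j → c.1 j = ∅) fun c => seqList (fun j => (c.1 (2 * j), c.1 (2 * j + 1))) 0 M := by
  refine ((((dominoCrystal_models i hi).tpow (dominoCrystal_wt i hi) M).limit _ _ _).ofEquiv
    pairEquiv).congr (fun c h j hj => ?_) fun c => ?_
  · exact Prod.ext (h _ (by omega)) (h _ (by omega))
  · rw [flatMap_singleton]
    exact (ofFn_eq_seqList _ _ 0 fun i => by simp [trunc, pairEquiv, pairUp]).symm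

theorem sum_map_add_const {ι G : Type} [AddCommGroup G] (l : List ι) (f : ι → G) (v : G) :
    (l.map fun x => v + f x).sum = (l.map f).sum + (l.length : ℤ) • v := by
  induction l with
  | nil => simp
  | cons x l ih =>
    simp only [List.map_cons, List.sum_cons, ih, List.length_cons]
    push_cast
    rw [add_smul, one_smul]; abel

theorem sum_flatMap_pair {G : Type} [AddCommGroup G] (l : List (Col n × Col n)) (f : Col n → G) :
    ((l.flatMap fun p => [p.1, p.2]).map f).sum = (l.map fun p => f p.1 + f p.2).sum := by
  induction l with
  | nil => rfl
  | cons x l ih =>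
    simp only [List.flatMap_cons, List.map_append, List.sum_append, ih, List.map_cons, List.sum_cons,
      List.map_nil, List.sum_nil, add_zero]

theorem spinCrystal_tpow_wt (k : ℕ) (x : Fin k → Col n) :
    ((spinCrystal n).tpow k).wt x = ((List.ofFn x).map (wtL .b)).sum + (k : ℤ) • omegaLast n := by
  rw [Crystal.tpow_wt_sum]
  have := sum_map_add_const (List.ofFn x) (wtL .b) (omegaLast n)
  rw [List.length_ofFn] at this
  exact this

theorem dominoCrystal_tpow_wt (k : ℕ) (x : Fin k → Col n × Col n) :
    ((dominoCrystal n).tpow k).wt x =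
      (((List.ofFn x).flatMap fun p => [p.1, p.2]).map (wtL .c)).sum + (k : ℤ) • omegaLast n := by
  rw [Crystal.tpow_wt_sum, sum_flatMap_pair]
  have := sum_map_add_const (List.ofFn x) (fun p => wtL .c p.1 + wtL .c p.2) (omegaLast n)
  rw [List.length_ofFn] at this
  exact this

theorem pairCrystal_tpow_wt (g : ClType) (k : ℕ) (x : Fin k → Col n × Col n) :
    ((pairCrystal n g).tpow k).wt x = (((List.ofFn x).flatMap fun p => [p.1, p.2]).map (wtL g)).sum +
      ((match g with | .b => 2 * k | .c => k : ℕ) : ℤ) • omegaLast n := by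
  cases g with
  | c => exact dominoCrystal_tpow_wt k x
  | b =>
    rw [Crystal.tpow_wt_sum, sum_flatMap_pair]
    have := sum_map_add_const (List.ofFn x) (fun p => wtL .b p.1 + wtL .b p.2) ((2 : ℤ) • omegaLast n)
    rw [List.length_ofFn, smul_smul] at this
    push_cast
    rw [mul_comm (2 : ℤ), ← this]
    congr 2
    funext p
    change omegaLast n + wtL .b p.1 + (omegaLast n + wtL .b p.2) = _
    rw [two_smul]; abel

theorem columnsCrystal_wt (g : ClType) (N : ℕ) (hN : g = .c → N % 2 = 0) (c : FinSeq (Col n) ∅)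
    (hc : ∀ j, N ≤ j → c.1 j = ∅) :
    (columnsCrystal n g).wt c = ((seqList c.1 0 N).map (wtL g)).sum := by
  cases g with
  | b =>
    obtain ⟨hε, he, hw, h⟩ := columnsCrystal_b (n := n)
    rw [h, Crystal.limit_wt _ _ _ c N hc, spinCrystal_tpow_wt, add_sub_cancel_right]
    congr 2
    exact ofFn_eq_seqList _ _ 0 fun i => by simp [trunc]
  | c =>
    obtain ⟨M, rfl⟩ : ∃ M, N = 2 * M := ⟨N / 2, by have := hN rfl; omega⟩
    obtain ⟨hε, he, hw, h⟩ := columnsCrystal_c (n := n)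
    rw [h]
    refine (Crystal.limit_wt hε he hw (pairEquiv c) M fun j hj => ?_).trans ?_
    · exact Prod.ext (hc _ (by omega)) (hc _ (by omega))
    · rw [dominoCrystal_tpow_wt, add_sub_cancel_right]
      congr 2
      exact flatMap_pair_eq_seqList _ _ 0 fun i => by simp [trunc, pairEquiv, pairUp]

theorem vermaCrystal_models (g : ClType) (μ : Fin n → ℕ) (i : Fin n) (hi : i.1 + 1 < n) (N : ℕ)
    (hN : g = .c → N % 2 = 0) : (vermaCrystal g μ).Models i (colSig i)
      (fun V => ∀ j, N ≤ j → V.1.1.1 j = ∅) fun V => seqList V.1.1.1 0 N ++ List.ofFn V.2.1 := by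
  have H₁ := (columnsCrystal_models g i (Or.inr hi) N hN).restrict (vermaBodySet g n)
  have H₂ := (((colLevi_models g i hi).tpow (colLevi_wt g i hi) (numCols μ)).levi hi).restrict
    (vermaTailSet μ)
  refine (H₁.tensor H₂ fun c hc => ?_).congr (fun V h => ⟨h, trivial⟩) fun V => by
    rw [flatMap_singleton]
  change (columnsCrystal n g).wt c.1 i = _
  rw [columnsCrystal_wt g N hN c.1 hc]
  have : ∀ l : List (Col n), (l.map (wtL g)).sum i = (colSig i).listW l := by
    intro l
    induction l with
    | nil => rfl
    | cons U l ih =>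
      have h : wtL g U i = (colSig i).listW [U] := colLevi_wt g i hi U
      simp only [Sig.listW, add_zero] at h
      rw [List.map_cons, List.sum_cons, Pi.add_apply, ih, h]
      rfl
  exact this _

theorem vermaCrystal_wt (g : ClType) (μ : Fin n → ℕ) (N : ℕ) (hN : g = .c → N % 2 = 0)
    (V : vermaBodySet g n × vermaTailSet μ) (hV : ∀ j, N ≤ j → V.1.1.1 j = ∅) :
    (vermaCrystal g μ).wt V = ((seqList V.1.1.1 0 N ++ List.ofFn V.2.1).map (wtL g)).sum := by
  change (columnsCrystal n g).wt V.1.1 + ((colLevi g n).tpow (numCols μ)).wt V.2.1 = _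
  rw [columnsCrystal_wt g N hN _ hV, Crystal.tpow_wt_sum, List.map_append, List.sum_append]
  rfl

theorem vermaTailCrystal_ε_last (g : ClType) (μ : Fin n → ℕ) (i : Fin n) (hi : ¬ i.1 + 1 < n)
    (t : vermaTailSet μ) : (vermaTailCrystal g μ).ε i t = ⊥ := by
  change (if i.1 + 1 < n then _ else _) = _
  rw [if_neg hi]

theorem vermaCrystal_ε_last (g : ClType) (μ : Fin n → ℕ) (i : Fin n) (hi : ¬ i.1 + 1 < n)
    (V : vermaBodySet g n × vermaTailSet μ) :
    (vermaCrystal g μ).ε i V = (columnsCrystal n g).ε i V.1.1 :=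
  Crystal.tensor_ε_of_bot _ _ i V (vermaTailCrystal_ε_last g μ i hi V.2)

theorem vermaCrystal_e_last (g : ClType) (μ : Fin n → ℕ) (i : Fin n) (hi : ¬ i.1 + 1 < n)
    (V V' : vermaBodySet g n × vermaTailSet μ) (h : (columnsCrystal n g).e i V.1.1 = some V'.1.1)
    (ht : V'.2 = V.2) : (vermaCrystal g μ).e i V = some V' := by
  refine (Crystal.tensor_e_of_bot _ _ i V (vermaTailCrystal_ε_last g μ i hi V.2)).trans ?_
  have : (vermaBodyCrystal g n).e i V.1 = some V'.1 := (Crystal.toSub_eq_some _ _ _).2 h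
  rw [this, Option.map_some, ← ht]

variable {g : ClType} {ℓ s : ℕ} {a : ℕ → ℕ} {c d c' d' : ℕ → Col n}

/-- Removing n̄ does not change counts below n, hence neither the displacements nor the counts of
the resulting body and tail there. The heights then decide whether n̄ is present: tails keep theirs,
and a body loses one box exactly when its column does. -/
theorem body_of_erase (H : SpinorColumns g ℓ a s c) (H' : SpinorColumns g ℓ a s c')
    (h : separate ℓ a c = some d) (h' : separate ℓ a c' = some d') (S : Separated ℓ a c d)
    (S' : Separated ℓ a c' d') (i : Fin n) (hi : ¬ i.1 + 1 < n)
    (hcc : ∀ j, c' j = c j ∨ bar i ∈ c j ∧ c' j = (c j).erase (bar i)) :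
    (∀ k, 1 ≤ k → k ≤ ℓ → tailPart a c' d' (ℓ + k) = tailPart a c d (ℓ + k)) ∧
      ∀ j, (c' j = c j → bodyPart ℓ a c' d' j = bodyPart ℓ a c d j) ∧
        (bar i ∈ c j → c' j = (c j).erase (bar i) → bar i ∈ bodyPart ℓ a c d j ∧
          bodyPart ℓ a c' d' j = (bodyPart ℓ a c d j).erase (bar i)) := by
  have hc : ∀ j t, t < n → cnt (c j) t = cnt (c' j) t := by
    intro j t ht
    rcases hcc j with h1 | ⟨h1, h2⟩
    · rw [h1]
    · rw [h2, cnt_erase_last _ i hi h1 t ht]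
  have hd : ∀ j t, t < n → cnt (d' j) t = cnt (d j) t := by
    intro j t ht
    have h1 := separate_cnt_eq H.data H'.data hc h h' j t
    have h2 := hc j t ht
    omega
  have hb := H.body_card H' S S'
  refine ⟨tailPart_eq S S' hd, fun j => ⟨fun hj => ?_, fun hm hj => ?_⟩⟩
  · refine eq_of_cnt_of_card (fun t ht => cnt_body_eq S S' t (fun j => hd j t ht) j) ?_
    have := hb j
    rw [hj] at this
    omega
  · refine eq_erase_of_cnt i hi (fun t ht => cnt_body_eq S S' t (fun j => hd j t ht) j) ?_
    have := hb j
    have h1 := Finset.card_pos.2 ⟨_, hm⟩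
    rw [hj, Finset.card_erase_of_mem hm] at this
    omega

end Verma

/-! ### The map `Θ_λ` -/

section Theta

variable {n : ℕ}

open Col

variable {g : ClType} {μ : Fin n → ℕ} {s : ℕ} {c : ℕ → Col n}

theorem SpinorColumns.cnt_body_anti {ℓ : ℕ} {a : ℕ → ℕ} {d : ℕ → Col n} (H : SpinorColumns g ℓ a s c)
    (S : Separated ℓ a c d) (j t : ℕ) (hj : s ≤ j) :
    cnt (bodyPart ℓ a c d (j + 1)) t ≤ cnt (bodyPart ℓ a c d j) t := by
  rcases Nat.eq_zero_or_pos j with rfl | h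
  · have h1 := H.lead (by omega) t
    rw [S.cnt_body, S.cnt_body, if_neg (show ¬ (ℓ < 0 ∧ 0 ≤ 2 * ℓ) by omega), S.eq_zero, zero_add,
      S.eq_one]
    have := cnt_nonneg (c 1) t
    split_ifs <;> omega
  · exact S.cnt_body_anti j t h

theorem SpinorColumns.bodyHt_eq {ℓ : ℕ} {a : ℕ → ℕ} (H : SpinorColumns .c ℓ a s c) (j : ℕ) (hj : j < ℓ) :
    bodyHt a c (2 * j + 1) = bodyHt a c (2 * j + 2) := by
  have := H.card rfl (j + 1) (by omega) (by omega)
  rw [show 2 * (j + 1) = 2 * j + 2 by ring, show 2 * j + 2 - 1 = 2 * j + 1 by omega] at this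
  unfold bodyHt
  rw [if_neg (by omega), if_pos (by omega), show (2 * j + 2) / 2 = j + 1 by omega]
  omega

theorem SpinorColumns.card_body_eq {ℓ : ℕ} {a : ℕ → ℕ} {d : ℕ → Col n} (H : SpinorColumns .c ℓ a s c)
    (S : Separated ℓ a c d) (j : ℕ) :
    (bodyPart ℓ a c d (2 * j + 1)).card = (bodyPart ℓ a c d (2 * j + 2)).card := by
  by_cases hj : j < ℓ
  · rw [S.card_bodyPart _ (by omega) (by omega), S.card_bodyPart _ (by omega) (by omega), H.bodyHt_eq j hj]
  · rw [S.body_empty _ (by omega), S.body_empty _ (by omega)]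

/-- `Θ_λ` is defined, and is given by the separation algorithm. -/
theorem SpinorColumns.bodyTail_eq (H : SpinorColumns g (numCols μ) (tailLen μ) s c) (hn : 1 ≤ n)
    (hs : s ≤ 1) (hg : g = .c → s = 1) : ∃ d V, separate (numCols μ) (tailLen μ) c = some d ∧
      Separated (numCols μ) (tailLen μ) c d ∧
      KeepsFirstMax (colPath s c) (colPath s (bodyPart (numCols μ) (tailLen μ) c d)) (2 * numCols μ + 1 - s) ∧
      bodyTail g μ s c = some V ∧
      (V.1.1.1 = fun k => bodyPart (numCols μ) (tailLen μ) c d (k + s)) ∧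
      V.2.1 = fun i : Fin (numCols μ) => tailPart (tailLen μ) c d (numCols μ + i + 1) := by
  obtain ⟨G, D⟩ := H.data
  obtain ⟨d, hd, S, hK⟩ := separate_exists (M := 2 * numCols μ + 1 - s) hn D hs
  have hb : ∃ k, ∀ j, k ≤ j → (fun k => bodyPart (numCols μ) (tailLen μ) c d (k + s)) j = ∅ :=
    ⟨2 * numCols μ + 1, fun j hj => S.body_empty _ (by omega)⟩
  have hbody : (⟨_, hb⟩ : FinSeq (Col n) ∅) ∈ vermaBodySet g n := by
    refine ⟨fun j => ?_, ?_⟩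
    · have h1 := fun t => H.cnt_body_anti S (j + s) t (by omega)
      have h2 := h1 n
      rw [cnt_of_ge _ n le_rfl, cnt_of_ge _ n le_rfl] at h2
      have h3 : (bodyPart (numCols μ) (tailLen μ) c d (j + 1 + s)).card ≤
          (bodyPart (numCols μ) (tailLen μ) c d (j + s)).card := by
        rw [show j + 1 + s = j + s + 1 by ring]; exact_mod_cast h2
      refine ⟨h3, ?_⟩
      have := (entryLE_up_iff (bodyPart (numCols μ) (tailLen μ) c d (j + 1 + s))
        (bodyPart (numCols μ) (tailLen μ) c d (j + s)) 0 (by simpa using h3)).2 (fun t => by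
          rw [show j + 1 + s = j + s + 1 by ring]; simpa using h1 t)
      simpa using this
    · rintro rfl j
      obtain rfl := hg rfl
      exact H.card_body_eq S j
  have htail : (fun i : Fin (numCols μ) => tailPart (tailLen μ) c d (numCols μ + i + 1)) ∈
      vermaTailSet μ := by
    have hcard : ∀ k, 1 ≤ k → k ≤ numCols μ →
        (tailPart (tailLen μ) c d (numCols μ + k)).card = tailLen μ k := by
      intro k h1 h2
      have := S.cnt_tail k n h1 h2
      rw [cnt_of_ge _ n le_rfl, cnt_of_ge _ n le_rfl, S.card k h1 h2] at this
      push_cast at this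
      omega
    refine ⟨fun i => hcard (i + 1) (by omega) i.2, fun i j hj k => entryLE_down _ _ (fun t => ?_) k⟩
    have hi := i.2
    have hj2 := j.2
    simp only [add_assoc]
    rw [hcard (i + 1) (by omega) (by omega), hcard (j + 1) (by omega) (by omega),
      S.cnt_tail _ t (by omega) (by omega), S.cnt_tail _ t (by omega) (by omega)]
    have h1 := S.tail (i + 1) (by omega) (by omega) t
    have h2 := S.a_mono (i + 1) (by omega) (by omega)
    rw [hj, show numCols μ + (i.1 + 1 + 1) = numCols μ + (i.1 + 1) + 1 by ring]
    omega
  refine ⟨d, (⟨⟨_, hb⟩, hbody⟩, ⟨_, htail⟩), hd, S, H.keepsFirstMax_body hn hs S hK, ?_, rfl, rfl⟩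
  unfold bodyTail
  rw [hd, Option.bind_some]
  exact dif_pos ⟨hb, hbody, htail⟩

/-! ### The maps on flattened sequences -/

/-- The separation algorithm, followed by moving the tails to the left of the body. -/
def flattenColumns (ℓ : ℕ) (a : ℕ → ℕ) (c : ℕ → Col n) : Option (ℕ → Col n) :=
  (separate ℓ a c).bind (jdtChains a (fun i => ℓ + i) (fun _ => ℓ) ℓ)

theorem flattenColumns_compat (ℓ : ℕ) (a : ℕ → ℕ) (hs : s ≤ 1) :
    LeviCompat n s (3 * ℓ + 1 - s) (flattenColumns ℓ a) := by
  have h : flattenColumns (n := n) ℓ a = fun c =>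
      (jdtChains a (fun i => 2 * i) (fun i => ℓ - i) (ℓ - 1) c).bind
        (jdtChains a (fun i => ℓ + i) (fun _ => ℓ) ℓ) := by
    funext c
    rw [flattenColumns, separate_eq]
  rw [h]
  exact (LeviCompat.jdtChains (fun i h1 h2 => by omega) fun i h1 h2 => by omega).bind
    (LeviCompat.jdtChains (fun i h1 h2 => by omega) fun i h1 h2 => by omega)

theorem Separated.seqList_flat {ℓ : ℕ} {a : ℕ → ℕ} {d : ℕ → Col n} (hs : s ≤ 1) :
    seqList (flatColumns ℓ a c d 0) s (3 * ℓ + 1 - s) =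
      seqList (bodyPart ℓ a c d) s (2 * ℓ + 1 - s) ++
        List.ofFn fun i : Fin ℓ => tailPart a c d (ℓ + i + 1) := by
  rw [show 3 * ℓ + 1 - s = (2 * ℓ + 1 - s) + ℓ by omega, seqList_append]
  congr 1
  · exact seqList_congr fun j _ _ => flatColumns_body j (by omega)
  · refine (ofFn_eq_seqList _ _ _ fun i => ?_).symm
    rw [show s + (2 * ℓ + 1 - s) + i.1 = 2 * ℓ + (i.1 + 1) by omega,
      flatColumns_tail _ (by omega) (by omega), add_assoc]

/-! ### Padding by empty columns. -/

theorem colSig_empty (i : Fin n) (hi : i.1 + 1 < n) (l : List (Col n)) (hl : ∀ U ∈ l, U = ∅) :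
    (colSig i).listEps l = 0 ∧ (colSig i).listW l = 0 := by
  induction l with
  | nil => exact ⟨rfl, rfl⟩
  | cons U l ih =>
    obtain ⟨h1, h2⟩ := ih fun V hV => hl V (List.mem_cons_of_mem _ hV)
    obtain rfl := hl U List.mem_cons_self
    simp only [Sig.listEps, Sig.listW, h1, h2]
    simp [colSig, Col.eps, Col.phi, hi]

theorem colSig_phi_nonneg (i : Fin n) (l : List (Col n)) :
    0 ≤ (colSig i).listEps l + (colSig i).listW l := by
  induction l with
  | nil => exact le_rfl
  | cons U l ih =>
    simp only [Sig.listEps, Sig.listW]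
    have := le_max_right ((colSig i).eps U) ((colSig i).listEps l - (colSig i).w U)
    omega

theorem seqList_append_empty (hs : s ≤ 1) {ℓ : ℕ} (hc : ∀ j, 2 * ℓ < j → c j = ∅) :
    seqList c s (3 * ℓ + 1 - s) = seqList c s (2 * ℓ + 1 - s) ++ seqList (fun _ => ∅) 0 ℓ := by
  rw [show 3 * ℓ + 1 - s = (2 * ℓ + 1 - s) + ℓ by omega, seqList_append]
  congr 1
  rw [← seqList_shift c]
  exact seqList_congr fun j _ _ => hc _ (by omega)

theorem mem_seqList_empty {ℓ : ℕ} (U : Col n) (h : U ∈ seqList (fun _ : ℕ => (∅ : Col n)) 0 ℓ) : U = ∅ := by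
  simp only [seqList, List.mem_map] at h
  obtain ⟨_, _, h⟩ := h
  exact h.symm

/-- Let `C` be a crystal whose elements are sequences of columns as in the spinor model.  The map given
by the separation algorithm is an embedding. -/
theorem isEmbedding_of_columns (hn : 2 ≤ n) {X : Type} (C : Crystal g n X) (col : X → ℕ → Col n) (r : ℕ)
    {ψ : X → Option ((vermaBodySet g n × vermaTailSet μ) × Unit)} (hs : s ≤ 1) (hg : g = .c → s = 1)
    (hcol : ∀ x, SpinorColumns g (numCols μ) (tailLen μ) s (col x))
    (hmod : ∀ i : Fin n, (g = .b ∨ i.1 + 1 < n) → C.Models i (colSig i) (fun _ => True)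
      fun x => seqList (col x) s (2 * numCols μ + 1 - s))
    (hdom : g = .c → ∀ i : Fin n, ¬ i.1 + 1 < n → C.Models i (dominoSig i) (fun _ => True)
      fun x => seqList (pairSeq (col x)) 0 (numCols μ))
    (hwt : ∀ x, C.wt x = ((seqList (col x) s (2 * numCols μ + 1 - s)).map (wtL g)).sum +
      (r : ℤ) • omegaLast n)
    (hψ : ∀ x, ψ x = (bodyTail g μ s (col x)).map fun V => (V, ())) :
    Crystal.IsEmbedding C
      ((vermaCrystal g μ).tensor (Crystal.single g ((r : ℤ) • omegaLast n))) ψ := by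
  choose d V hd S hK hV hV1 hV2 using fun x => (hcol x).bodyTail_eq (by omega) hs hg
  set ℓ := numCols μ with hℓ
  set a := tailLen μ with ha
  have hN : g = .c → (2 * ℓ + 1 - s) % 2 = 0 := fun h => by rw [hg h]; omega
  have hP : ∀ x j, 2 * ℓ + 1 - s ≤ j → (V x).1.1.1 j = ∅ := fun x j hj => by
    rw [hV1]; exact (S x).body_empty _ (by omega)
  have hflat : ∀ x, flattenColumns ℓ a (col x) = some (flatColumns ℓ a (col x) (d x) 0) := fun x => by
    rw [flattenColumns, hd, Option.bind_some, (S x).chains_finish]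
  have hcompat := flattenColumns_compat (n := n) ℓ a hs
  have hempty : ∀ x j, 2 * ℓ < j → col x j = ∅ := fun x => (hcol x).data.choose_spec.empty
  have hVbody : ∀ x, seqList (V x).1.1.1 0 (2 * ℓ + 1 - s) =
      seqList (bodyPart ℓ a (col x) (d x)) s (2 * ℓ + 1 - s) := fun x => by rw [hV1, seqList_shift]
  have hVlist : ∀ x, seqList (V x).1.1.1 0 (2 * ℓ + 1 - s) ++ List.ofFn (V x).2.1 =
      seqList (flatColumns ℓ a (col x) (d x) 0) s (3 * ℓ + 1 - s) := fun x => by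
    rw [hVbody, hV2, Separated.seqList_flat hs]
  have hout : ∀ x x' j, j < s ∨ 2 * ℓ < j → col x' j = col x j := by
    intro x x' j hj
    rcases hj with hj | hj
    · obtain rfl : j = 0 := by omega
      rw [(hcol x).zero (by omega), (hcol x').zero (by omega)]
    · rw [hempty x j hj, hempty x' j hj]
  have hsingle : ∀ i x, ((vermaCrystal g μ).tensor (Crystal.single g ((r : ℤ) • omegaLast n))).ε i (V x, ()) =
      (vermaCrystal g μ).ε i (V x) := fun i x => Crystal.tensor_ε_of_bot _ _ i _ rfl
  have hsingle_e : ∀ i x y, (vermaCrystal g μ).e i (V x) = some (V y) →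
      ((vermaCrystal g μ).tensor (Crystal.single g ((r : ℤ) • omegaLast n))).e i (V x, ()) =
        some (V y, ()) := fun i x y h => by
    rw [Crystal.tensor_e_of_bot _ _ i _ rfl, h]; rfl
  -- the effect of removing letters `n̄`
  have herase : ∀ (i : Fin n) (hi : ¬ i.1 + 1 < n) x x',
      (∀ j, col x' j = col x j ∨ bar i ∈ col x j ∧ col x' j = (col x j).erase (bar i)) →
      (V x').2 = (V x).2 ∧ ∀ j,
        (col x' j = col x j → bodyPart ℓ a (col x') (d x') j = bodyPart ℓ a (col x) (d x) j) ∧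
        (bar i ∈ col x j → col x' j = (col x j).erase (bar i) → bar i ∈ bodyPart ℓ a (col x) (d x) j ∧
          bodyPart ℓ a (col x') (d x') j = (bodyPart ℓ a (col x) (d x) j).erase (bar i)) := by
    intro i hi x x' h
    obtain ⟨h1, h2⟩ := body_of_erase (hcol x) (hcol x') (hd x) (hd x') (S x) (S x') i hi h
    refine ⟨Subtype.ext ?_, h2⟩
    rw [hV2, hV2]
    funext k
    rw [add_assoc]
    exact h1 (k + 1) (by omega) k.2
  -- If L exceeds R by at most m everywhere and by exactly m in total, then n̄ ∈ R forces n̄ ∈ L, as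
  -- n̄ is counted last. This makes the domino path comparable with the path of columns.
  have hgood : ∀ (i : Fin n), ¬ i.1 + 1 < n → ∀ (R L : Col n) (m : ℕ), (∀ t, cnt L t ≤ cnt R t + m) →
      L.card = R.card + m → has R (n - 1) ≤ has L (n - 1) := by
    intro i hi R L m h1 h2
    have h3 := cnt_succ R (n - 1)
    have h4 := cnt_succ L (n - 1)
    have h5 := h1 (n - 1)
    rw [show n - 1 + 1 = n by omega, cnt_of_ge _ n le_rfl] at h3 h4
    omega
  have hgoodT : g = .c → ∀ (i : Fin n), ¬ i.1 + 1 < n → ∀ x j,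
      has (col x (2 * j + 1)) (n - 1) ≤ has (col x (2 * j + 2)) (n - 1) := by
    intro hgc i hi x j
    by_cases hj : j < ℓ
    · refine hgood i hi _ _ (a (j + 1)) (fun t => ?_) ((hcol x).card hgc (j + 1) (by omega) (by omega))
      obtain ⟨G, D⟩ := (hcol x).data
      have h1 := D.diff (j + 1) (by omega) (by omega) t
      have h2 := D.le (j + 1) (by omega) (by omega) t
      rw [show 2 * (j + 1) = 2 * j + 2 by ring, show 2 * j + 2 - 1 = 2 * j + 1 by omega] at h1
      omega
    · rw [hempty x _ (by omega), hempty x _ (by omega)]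
  have hgoodB : g = .c → ∀ (i : Fin n), ¬ i.1 + 1 < n → ∀ x j,
      has (bodyPart ℓ a (col x) (d x) (2 * j + 1)) (n - 1) ≤
        has (bodyPart ℓ a (col x) (d x) (2 * j + 2)) (n - 1) := by
    intro hgc i hi x j
    refine hgood i hi _ _ 0 (fun t => ?_) ?_
    · have := (S x).cnt_body_anti (2 * j + 1) t (by omega)
      simpa using this
    · subst hgc
      exact ((hcol x).card_body_eq (S x) j).symm
  have hpair : g = .c → ∀ x, seqList (fun j => ((V x).1.1.1 (2 * j), (V x).1.1.1 (2 * j + 1))) 0 ℓ =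
      seqList (pairSeq (bodyPart ℓ a (col x) (d x))) 0 ℓ := by
    intro hgc x
    rw [hV1, hg hgc]
    rfl
  refine Crystal.isEmbedding_of_e (fun x => (V x, ())) (fun x => by rw [hψ, hV]; rfl) ?_ ?_ ?_ ?_
  -- Equal images give equal flattened sequences; a spin column is included when s = 0, and the
  -- column 0 is empty when s = 1. The operators ℱ_j are injective.
  · intro x y hxy
    have hVxy : V x = V y := (Prod.mk.inj hxy).1
    have h1 : flatColumns ℓ a (col x) (d x) 0 = flatColumns ℓ a (col y) (d y) 0 := by
      have h2 : seqList (flatColumns ℓ a (col x) (d x) 0) s (3 * ℓ + 1 - s) =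
          seqList (flatColumns ℓ a (col y) (d y) 0) s (3 * ℓ + 1 - s) := by
        rw [← hVlist, ← hVlist, hVxy]
      funext j
      by_cases hj : s ≤ j ∧ j ≤ 3 * ℓ
      · exact seqList_inj h2 j hj.1 (by omega)
      · rcases Nat.lt_or_ge (3 * ℓ) j with h3 | h3
        · rw [Separated.flatColumns_empty j h3, Separated.flatColumns_empty j h3]
        · obtain rfl : j = 0 := by omega
          rw [Separated.flatColumns_body 0 (by omega), Separated.flatColumns_body 0 (by omega)]
          unfold bodyPart
          rw [if_pos (by omega), if_pos (by omega), (S x).eq_zero, (S y).eq_zero]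
          exact hout y x 0 (by omega)
    have h3 := hcompat.inj _ _ _ (hflat x) (h1 ▸ hflat y)
    -- Any vertex below n serves to recover the element from its columns, and n ≥ 2 provides one.
    exact (hmod ⟨0, by omega⟩ (Or.inr (by simp only; omega))).inj _ _ trivial trivial (by simp only [h3])
  · intro x
    change (vermaCrystal g μ).wt (V x) + (r : ℤ) • omegaLast n = _
    rw [vermaCrystal_wt g μ _ hN _ (hP x), hVlist, hwt, hcompat.wt g _ _ (hflat x),
      seqList_append_empty hs (hempty x), List.map_append, List.sum_append]
    have : ((seqList (fun _ : ℕ => (∅ : Col n)) 0 ℓ).map (wtL g)).sum = 0 := by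
      refine List.sum_eq_zero fun w hw => ?_
      obtain ⟨U, hU, rfl⟩ := List.mem_map.1 hw
      rw [mem_seqList_empty U hU, wtL_empty]
    rw [this, add_zero]
  · intro i x
    rw [hsingle]
    by_cases hi : i.1 + 1 < n
    · rw [(vermaCrystal_models g μ i hi _ hN).ε_eq _ (hP x), (hmod i (Or.inr hi)).ε_eq _ trivial, hVlist,
        hcompat.eps i _ _ hi (hflat x), seqList_append_empty hs (hempty x), Sig.listEps_append,
        (colSig_empty i hi _ mem_seqList_empty).1]
      have h1 := colSig_phi_nonneg i (seqList (col x) s (2 * ℓ + 1 - s))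
      rw [max_eq_left (by omega)]
    · rw [vermaCrystal_ε_last g μ i hi]
      cases g with
      | b =>
        rw [(columnsCrystal_models .b i (Or.inl rfl) _ hN).ε_eq _ (hP x), (hmod i (Or.inl rfl)).ε_eq _ trivial,
          hVbody]
        -- Both values of ε_n are the heights of the first maxima, which agree for the columns and
        -- for their bodies.
        obtain ⟨p, hp⟩ := exists_firstMax (colPath s (col x)) (2 * ℓ + 1 - s)
        obtain ⟨h1, h2⟩ := hK x p hp
        rw [← colSig_path_last i hi] at hp h1
        rw [Sig.listEps_seqList _ (colSig_eps_last i hi) _ _ _ _ hp,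
          Sig.listEps_seqList _ (colSig_eps_last i hi) _ _ _ _ h1, colSig_path_last i hi,
          colSig_path_last i hi, h2]
      | c =>
        obtain rfl := hg rfl
        rw [(columnsCrystal_models_domino i hi ℓ).ε_eq _ (fun j hj => hP x j (by omega)),
          (hdom rfl i hi).ε_eq _ trivial, hpair rfl]
        obtain ⟨p, hp⟩ := exists_firstMax ((dominoSig i).path 0 (pairSeq (col x))) ℓ
        have hp' := (firstMax_domino_iff i hi _ (hgoodT rfl i hi x) _ _).1 hp
        obtain ⟨h1, h2⟩ := hK x (2 * p) hp'
        have h3 := (firstMax_domino_iff i hi _ (hgoodB rfl i hi x) _ _).2 h1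
        rw [← dominoSig_path i hi, ← dominoSig_path i hi] at h2
        rw [Sig.listEps_seqList _ (dominoSig_eps i) _ _ _ _ hp,
          Sig.listEps_seqList _ (dominoSig_eps i) _ _ _ _ h3]
        congr 1
        omega
  · intro i x x' hx
    apply hsingle_e
    by_cases hi : i.1 + 1 < n
    · rw [(vermaCrystal_models g μ i hi _ hN).e_iff _ _ (hP x) (hP x'), hVlist, hVlist]
      rw [(hmod i (Or.inr hi)).e_iff _ _ trivial trivial] at hx
      -- The adjoined empty columns have ε_i = 0 while φ_i of the rest is nonnegative, so ẽ_i acts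
      -- as it did before padding.
      have hR : Raises i s (3 * ℓ + 1 - s) (col x) (col x') := by
        refine ⟨?_, fun j hj => hout x x' j (by omega)⟩
        rw [seqList_append_empty hs (hempty x), seqList_append_empty hs (hempty x'), Sig.listE_append,
          (colSig_empty i hi _ mem_seqList_empty).1, if_pos (colSig_phi_nonneg i _), hx]
        rfl
      obtain ⟨f, hf, hf'⟩ := hcompat.comm i _ _ _ hi (hflat x) hR
      obtain rfl := Option.some.inj ((hflat x').symm.trans hf)
      exact hf'.1
    · cases g with
      | b =>
        rw [(hmod i (Or.inl rfl)).e_iff _ _ trivial trivial] at hx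
        obtain ⟨p, hpM, hp, hpe, hpj⟩ := Sig.exists_of_listE _ (colSig_eps_last i hi) hx
        rw [colSig_path_last i hi] at hp
        -- In the body ẽ_n also acts on column s + p; `herase` shows that removing n̄ there gives
        -- the body of x'.
        obtain ⟨h1, -⟩ := hK x _ hp
        have hmem : bar i ∈ col x (s + p) ∧ col x' (s + p) = (col x (s + p)).erase (bar i) := by
          simp only [colSig, Col.e, hi, dite_false] at hpe
          split_ifs at hpe with h
          exact ⟨h, (Option.some.inj hpe).symm⟩
        have hne : ∀ j, j ≠ s + p → col x' j = col x j := fun j hj => by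
          by_cases hj' : s ≤ j ∧ j < s + (2 * ℓ + 1 - s)
          · exact hpj j hj'.1 hj'.2 hj
          · exact hout x x' j (by omega)
        obtain ⟨h2, h3⟩ := herase i hi x x' fun j => by
          by_cases hj : j = s + p
          · rw [hj]; exact Or.inr hmem
          · exact Or.inl (hne j hj)
        refine vermaCrystal_e_last .b μ i hi _ _ ?_ h2
        rw [(columnsCrystal_models .b i (Or.inl rfl) _ hN).e_iff _ _ (hP x) (hP x'), hVbody, hVbody]
        rw [← colSig_path_last i hi] at h1
        obtain ⟨h4, h5⟩ := (h3 (s + p)).2 hmem.1 hmem.2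
        have h6 : (colSig i).e (bodyPart ℓ a (col x) (d x) (s + p)) =
            some (bodyPart ℓ a (col x') (d x') (s + p)) := by
          rw [h5]
          simp only [colSig, Col.e, hi, dite_false, h4, if_true]
        rw [Sig.listE_seqList _ (colSig_eps_last i hi) _ _ _ _ h1, h6, Option.map_some]
        congr 1
        refine seqList_congr fun j _ _ => ?_
        by_cases hj : j = s + p
        · rw [hj, Function.update_self]
        · rw [Function.update_of_ne hj, (h3 j).1 (hne j hj)]
      | c =>
        obtain rfl := hg rfl
        rw [(hdom rfl i hi).e_iff _ _ trivial trivial] at hx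
        obtain ⟨p, hpM, hp, hpe, hpj⟩ := Sig.exists_of_listE _ (dominoSig_eps i) hx
        have hp' := (firstMax_domino_iff i hi _ (hgoodT rfl i hi x) _ _).1 hp
        obtain ⟨h1, -⟩ := hK x _ hp'
        have h1 := (firstMax_domino_iff i hi _ (hgoodB rfl i hi x) _ _).2 h1
        rw [zero_add] at hpe hpj
        have hmem : (bar i ∈ col x (2 * p + 1) ∧ bar i ∈ col x (2 * p + 2)) ∧
            col x' (2 * p + 1) = (col x (2 * p + 1)).erase (bar i) ∧
            col x' (2 * p + 2) = (col x (2 * p + 2)).erase (bar i) := by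
          simp only [dominoSig, pairSeq] at hpe
          split_ifs at hpe with h
          have h' := Option.some.inj hpe
          rw [Prod.mk.injEq] at h'
          exact ⟨h, h'.1.symm, h'.2.symm⟩
        have hne : ∀ j, j ≠ 2 * p + 1 → j ≠ 2 * p + 2 → col x' j = col x j := fun j h1 h2 => by
          by_cases hj' : 1 ≤ j ∧ j ≤ 2 * ℓ
          · have h3 := hpj ((j - 1) / 2) (by omega) (by omega) (by omega)
            simp only [pairSeq, Prod.mk.injEq] at h3
            rcases Nat.mod_two_eq_zero_or_one j with h4 | h4
            · have := h3.2
              rwa [show 2 * ((j - 1) / 2) + 2 = j by omega] at this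
            · have := h3.1
              rwa [show 2 * ((j - 1) / 2) + 1 = j by omega] at this
          · exact hout x x' j (by omega)
        obtain ⟨h2, h3⟩ := herase i hi x x' fun j => by
          by_cases hj : j = 2 * p + 1
          · rw [hj]; exact Or.inr ⟨hmem.1.1, hmem.2.1⟩
          by_cases hj' : j = 2 * p + 2
          · rw [hj']; exact Or.inr ⟨hmem.1.2, hmem.2.2⟩
          · exact Or.inl (hne j hj hj')
        refine vermaCrystal_e_last .c μ i hi _ _ ?_ h2
        rw [(columnsCrystal_models_domino i hi ℓ).e_iff _ _ (fun j hj => hP x j (by omega))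
          (fun j hj => hP x' j (by omega)), hpair rfl, hpair rfl]
        obtain ⟨h4, h5⟩ := (h3 (2 * p + 1)).2 hmem.1.1 hmem.2.1
        obtain ⟨h4', h5'⟩ := (h3 (2 * p + 2)).2 hmem.1.2 hmem.2.2
        have h6 : (dominoSig i).e (pairSeq (bodyPart ℓ a (col x) (d x)) (0 + p)) =
            some (pairSeq (bodyPart ℓ a (col x') (d x')) p) := by
          rw [zero_add]
          simp only [dominoSig, pairSeq, h5, h5', h4, h4', and_self, if_true]
        rw [Sig.listE_seqList _ (dominoSig_eps i) _ _ _ _ h1, h6, Option.map_some, zero_add]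
        congr 1
        refine seqList_congr fun j _ _ => ?_
        by_cases hj : j = p
        · rw [hj, Function.update_self]
        · rw [Function.update_of_ne hj]
          unfold pairSeq
          rw [(h3 (2 * j + 1)).1 (hne _ (by omega) (by omega)),
            (h3 (2 * j + 2)).1 (hne _ (by omega) (by omega))]

/-! ### The three cases -/

theorem spinorCrystal_models (g : ClType) (μ : Fin n → ℕ) (i : Fin n) (hi : g = .b ∨ i.1 + 1 < n)
    (T₀ : Col n) : ((pairCrystal n g).tpow (numCols μ)).Models i (colSig i) (fun _ => True)
      fun T => seqList (columnsOf T₀ T) 1 (2 * numCols μ) :=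
  ((pairCrystal_models g i hi).tpow (pairCrystal_wt g i hi) (numCols μ)).congr (fun _ h => h) fun T =>
    (flatMap_pair_eq_seqList T _ 1 fun k => by
      rw [show 1 + 2 * k.1 = 2 * k.1 + 1 by ring, columnsOf_right, columnsOf_left]).symm

theorem columnsOf_flatMap (T₀ : Col n) {ℓ : ℕ} (T : Fin ℓ → Col n × Col n) :
    ((List.ofFn T).flatMap fun p => [p.1, p.2]) = seqList (columnsOf T₀ T) 1 (2 * ℓ) :=
  flatMap_pair_eq_seqList T _ 1 fun k => by
    rw [show 1 + 2 * k.1 = 2 * k.1 + 1 by ring, columnsOf_right, columnsOf_left]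

theorem isEmbedding_thetaMap (hn : 2 ≤ n) (g : ClType) (μ : Fin n → ℕ) :
    Crystal.IsEmbedding (spinorCrystal g μ)
      ((vermaCrystal g μ).tensor (Crystal.single g ((twist g μ : ℤ) • omegaLast n)))
      (thetaMap g μ) := by
  refine isEmbedding_of_columns (s := 1) hn _ (fun T => columnsOf ∅ T.1) (twist g μ) le_rfl
    (fun _ => rfl) (fun T => spinorColumns T.2 ∅ 1 (fun _ => rfl) fun h => absurd h one_ne_zero) ?_ ?_ ?_
    fun T => rfl
  · intro i hi
    exact (spinorCrystal_models g μ i hi ∅).restrict (spinorSet g μ)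
  · rintro rfl i hi
    refine (((dominoCrystal_models i hi).tpow (dominoCrystal_wt i hi) (numCols μ)).restrict
      (spinorSet .c μ)).congr (fun _ _ => trivial) fun T => ?_
    rw [flatMap_singleton]
    refine (ofFn_eq_seqList T.1 _ 0 fun k => ?_).symm
    rw [zero_add, pairSeq, columnsOf_right, columnsOf_left]
  · intro T
    change ((pairCrystal n g).tpow (numCols μ)).wt T.1 = _
    rw [pairCrystal_tpow_wt, columnsOf_flatMap ∅]
    cases g <;> rfl

/-- Here λ₁ = ℓ + 1/2, so r = 2ℓ + 1 is the number of columns, each of which contributes one ω_n to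
the weight. -/
theorem isEmbedding_thetaSpinMap (hn : 2 ≤ n) (μ : Fin n → ℕ) :
    Crystal.IsEmbedding (spinorSpinCrystal μ)
      ((vermaCrystal .b μ).tensor
        (Crystal.single .b (((2 * numCols μ + 1 : ℕ) : ℤ) • omegaLast n)))
      (thetaSpinMap μ) := by
  have hcons : ∀ T : Col n × (Fin (numCols μ) → Col n × Col n),
      seqList (columnsOf T.1 T.2) 0 (2 * numCols μ + 1) =
        [T.1] ++ seqList (columnsOf T.1 T.2) 1 (2 * numCols μ) := fun T => by
    rw [add_comm (2 * numCols μ) 1, seqList_append]; rfl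
  refine isEmbedding_of_columns (s := 0) hn _ (fun T => columnsOf T.1.1 T.1.2) (2 * numCols μ + 1)
    (by omega) (fun h => absurd h (by simp))
    (fun T => spinorColumns T.2.1 T.1.1 0 (fun h => absurd h zero_ne_one) fun _ => T.2.2) ?_
    (fun h => absurd h (by simp)) ?_ fun T => rfl
  · intro i hi
    refine (((spinCrystal_models i).tensor (spinorCrystal_models .b μ i hi ∅)
      fun U _ => spinCrystal_wt i U).restrict (spinorSpinSet μ)).congr (fun _ _ => ⟨trivial, trivial⟩)
      fun T => ?_
    rw [Nat.sub_zero, hcons]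
    congr 1
    exact seqList_congr fun j h1 _ => by
      obtain ⟨m, rfl⟩ : ∃ m, j = m + 1 := ⟨j - 1, by omega⟩
      rfl
  · intro T
    change omegaLast n + wtL .b T.1.1 + ((pairCrystal n .b).tpow (numCols μ)).wt T.1.2 = _
    rw [pairCrystal_tpow_wt, columnsOf_flatMap T.1.1, Nat.sub_zero, hcons, List.map_append, List.sum_append]
    push_cast
    rw [add_smul, one_smul]
    simp only [List.map_cons, List.map_nil, List.sum_cons, List.sum_nil, add_zero]
    abel

end Theta

/-- `Θ_λ` is an embedding of `𝔤`-crystals `𝐓^𝔤_λ → 𝐕^𝔤_λ ⊗ T_{rω_n}`, for `λ = μ ∈ 𝒫_n` (in both types),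
and for `λ = μ + (1/2, …, 1/2) ∈ 𝒫_n^sp` in type `B_n`. -/
theorem theorem4p4 (n : ℕ) (hn : 2 ≤ n) (μ : Fin n → ℕ) (hμ : Antitone μ) :
    (∀ g : ClType, Crystal.IsEmbedding (spinorCrystal g μ)
      ((vermaCrystal g μ).tensor (Crystal.single g ((twist g μ : ℤ) • omegaLast n)))
      (thetaMap g μ)) ∧
    Crystal.IsEmbedding (spinorSpinCrystal μ)
      ((vermaCrystal .b μ).tensor
        (Crystal.single .b (((2 * numCols μ + 1 : ℕ) : ℤ) • omegaLast n)))
      (thetaSpinMap μ) :=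
  ⟨fun g => isEmbedding_thetaMap hn g μ, isEmbedding_thetaSpinMap hn μ⟩
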